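/- Let $n,k$ be coprime integers with $1\le k<n$ and let $\tau\in\mathbb C$, $\operatorname{Im}\tau>0$. Put $\theta(z)=\sum_{\alpha\in\mathbb Z}(-1)^\alpha e^{2\pi i(\alpha z+\frac{\alpha(\alpha-1)}2\tau)}$ and, for $\alpha\in\mathbb Z/n\mathbb Z$, $$\theta_\alpha(z)=\prod_{s=0}^{n-1}\theta\Big(z+\frac sn+\frac\alpha n\tau\Big)\,e^{\pi i((2\alpha-n)z-\frac\alpha n+\frac{\alpha(\alpha-n)}n\tau)}$$ (this depends only on $\alpha$ modulo $n$). For $i,r\in\mathbb Z/n\mathbb Z$ put $$c_{i,r}=\frac{\theta_0'(0)\,\theta_{i+r(k-1)}(0)}{\theta_{kr}(0)\,\theta_{i-r}(0)}\ \ (r\ne0,i),\qquad c_{0,0}=0,\qquad c_{i,0}=\frac{\theta_i'(0)}{\theta_i(0)},\quad c_{i,i}=\frac{\theta_{ki}'(0)}{\theta_{ki}(0)}\ \ (i\neq 0).$$ For a $\mathbb C$-algebra $R$ let $F(R)=R/[R,R]$ ($[R,R]$ the linear span of the commutators) and let $\mathrm{tr}:R\to F(R)$ be the quotient map. A nonabelian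 vector field on $R$ is a linear map $F(R)\to F(R)$ that lifts to a derivation of $R$. A nonabelian bivector field is a bilinear antisymmetric map $F(R)\times F(R)\to F(R)$ that is a nonabelian vector field in each argument. It is a nonabelian Poisson structure on $R$ if its Schouten square vanishes, i.e. if the Jacobi identity holds. Let $A=\mathbb C\langle x_i : i\in\mathbb Z/n\mathbb Z\rangle$ be the free algebra and let $\partial/\partial x_i:F(A)\to A$ be the nonabelian partial derivatives, defined by $df=\sum_i\frac{\partial f}{\partial x_i}dx_i$ modulo commutators; they extend to noncommutative Laurent polynomials by $d(x^{-1})=-x^{-1}\,dx\,x^{-1}$. Put $$\nu(f,g)=\mathrm{tr}\Big(\sum_{i,j,r\in\mathbb Z/n\mathbb Z}c_{i-j,r}\frac{\partial f}{\partial x_i}x_{i-r}\frac{\partial g}{\partial x_j}x_{j+r}\Big).$$ Then: 1. $\nu$ is a nonabelian bivector field on $A$, and it is homogeneous: if $a$ is an additional invertible noncommutative generator with $da=0$ and $f\mapsto f^a$ is the homomorphism $x_i\mapsto ax_i$, $a\mapsto a$, then $\nu(f^a,g^a)=\nu(f,g)^a$ for all $f,g\in A$. 2. The Schouten square $[\nu,\nu](f,g,h)$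 vanishes modulo the identities $\sum_i x_i\frac{\partial f}{\partial x_i}=0$, $\sum_i\frac{\partial f}{\partial x_i}x_i=0$ and the same identities for $g$ and $h$. That is, it is a linear combination of expressions $\mathrm{tr}\big(p\,E(f_1)\,q\,\frac{\partial f_2}{\partial x_j}\,s\,\frac{\partial f_3}{\partial x_l}\big)$ with $p,q,s\in A$, $(f_1,f_2,f_3)$ a permutation of $(f,g,h)$, and $E(f_1)=\sum_i x_i\frac{\partial f_1}{\partial x_i}$ or $E(f_1)=\sum_i \frac{\partial f_1}{\partial x_i}x_i$. 3. $\nu$ defines a nonabelian Poisson structure on the noncommutative $\mathbb CP^{n-1}$: there are nonabelian Poisson structures $\{\cdot,\cdot\}_j$ on the affine charts $\mathbb C\langle u_{i,j}: i\ne j\rangle$, $j\in\mathbb Z/n\mathbb Z$, which the substitution $u_{i,j}=x_j^{-1}x_i$ carries to $\nu$, and for $j\ne l$ the brackets $\{\cdot,\cdot\}_j$ and $\{\cdot,\cdot\}_l$ are restrictions of one nonabelian Poisson structure on the overlap $\mathbb C\langle u_{i,j}\,(i\neq j),\,u_{l,j}^{-1}\rangle$ under the change of coordinates $u_{i,l}=u_{l,j}^{-1}u_{i,j}$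 (with $u_{j,j}=1$). 4. Let $q_{n,k}(\tau)$ be the polynomial algebra $\mathbb C[x_i: i\in\mathbb Z/n\mathbb Z]$ with the biderivation defined by $\{x_i,x_i\}=0$ and, for $i\ne j$, $$\{x_i,x_j\}=\Big(\frac{\theta'_{j-i}(0)}{\theta_{j-i}(0)}+\frac{\theta'_{k(j-i)}(0)}{\theta_{k(j-i)}(0)}\Big)x_ix_j+\sum_{r\ne0,j-i}\frac{\theta_0'(0)\theta_{j-i+r(k-1)}(0)}{\theta_{kr}(0)\theta_{j-i-r}(0)}x_{j-r}x_{i+r}.$$ This is a Poisson algebra. The abelianization of $\nu$, that is, the bracket that $\nu$ induces on $\mathbb C[x_i]$ through $F(A)\to\mathbb C[x_i]$, is $-\{\cdot,\cdot\}$, and $x_i\mapsto x_{-i}$ is an isomorphism of Poisson algebras from it to $q_{n,k}(\tau)$. -/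

import Mathlib

open scoped TensorProduct

noncomputable section

namespace NCPoisson

/-! ### Nonabelian functions, vector fields and Poisson structures on an algebra -/

section General

variable {R S : Type*} [Ring R] [Algebra ℂ R] [Ring S] [Algebra ℂ S]

/-- `[R, R]`, the linear span of the commutators. -/
def commSpan (R : Type*) [Ring R] [Algebra ℂ R] : Submodule ℂ R :=
  Submodule.span ℂ {z | ∃ a b : R, z = a * b - b * a}

/-- `F = R / [R, R]`, the space of nonabelian functions. -/
abbrev Cyc (R : Type*) [Ring R] [Algebra ℂ R] : Type _ := R ⧸ commSpan R

/-- The natural map `tr : R → R / [R, R]`. -/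
def tr : R →ₗ[ℂ] Cyc R := (commSpan R).mkQ

/-- A linear map that is symmetric on products descends to `R / [R, R]`. -/
def Cyc.lift {M : Type*} [AddCommGroup M] [Module ℂ M] (φ : R →ₗ[ℂ] M)
    (h : ∀ a b, φ (a * b) = φ (b * a)) : Cyc R →ₗ[ℂ] M :=
  (commSpan R).liftQ φ <| Submodule.span_le.2 <| by
    rintro _ ⟨a, b, rfl⟩
    simp [h a b]

/-- The map `R / [R, R] → S / [S, S]` induced by an algebra homomorphism. -/
def Cyc.map (φ : R →ₐ[ℂ] S) : Cyc R →ₗ[ℂ] Cyc S :=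
  Cyc.lift (tr ∘ₗ φ.toLinearMap) fun a b => by
    refine (Submodule.Quotient.eq _).2 (Submodule.subset_span ⟨φ a, φ b, ?_⟩)
    simp

/-- Derivations of a (noncommutative) algebra. -/
def IsDer (D : R →ₗ[ℂ] R) : Prop := ∀ a b, D (a * b) = D a * b + a * D b

/-- Nonabelian vector fields: linear maps `F → F` that lift to a derivation of `R`. -/
def IsNCVectorField (v : Cyc R →ₗ[ℂ] Cyc R) : Prop :=
  ∃ D : R →ₗ[ℂ] R, IsDer D ∧ ∀ a, v (tr a) = tr (D a)

/-- Nonabelian bivector fields. -/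
structure IsNCBivector (β : Cyc R →ₗ[ℂ] Cyc R →ₗ[ℂ] Cyc R) : Prop where
  antisymm : ∀ f g, β f g = -β g f
  left : ∀ g, IsNCVectorField (β.flip g)
  right : ∀ f, IsNCVectorField (β f)

/-- The Schouten bracket of two bivector fields. -/
def schouten (μ ν : Cyc R →ₗ[ℂ] Cyc R →ₗ[ℂ] Cyc R) (v : Fin 3 → Cyc R) : Cyc R :=
  ∑ σ : Equiv.Perm (Fin 3), (Equiv.Perm.sign σ : ℤ) • μ (ν (v (σ 0)) (v (σ 1))) (v (σ 2)) +
  ∑ σ : Equiv.Perm (Fin 3), (Equiv.Perm.sign σ : ℤ) • ν (μ (v (σ 0)) (v (σ 1))) (v (σ 2))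

/-- Nonabelian Poisson structures. -/
def IsNCPoisson (β : Cyc R →ₗ[ℂ] Cyc R →ₗ[ℂ] Cyc R) : Prop :=
  IsNCBivector β ∧ ∀ v, schouten β β v = 0

/-- The linear map `a ⊗ b ↦ b a`. -/
def revMul (R : Type*) [Ring R] [Algebra ℂ R] : R ⊗[ℂ] R →ₗ[ℂ] R :=
  LinearMap.mul' ℂ R ∘ₗ (TensorProduct.comm ℂ R R).toLinearMap

/-- The matrix form of a derivation `Δ : R → R ⊗ R` (outer bimodule structure): an algebra
homomorphism `f ↦ (f ⊗ 1, Δ f; 0, 1 ⊗ f)`. -/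
def IsDoubleDer (Φ : R →ₐ[ℂ] Matrix (Fin 2) (Fin 2) (R ⊗[ℂ] R)) : Prop :=
  ∀ f, Φ f 0 0 = f ⊗ₜ[ℂ] (1 : R) ∧ Φ f 1 0 = 0 ∧ Φ f 1 1 = (1 : R) ⊗ₜ[ℂ] f

theorem revMul_comm (f : R) (t : R ⊗[ℂ] R) :
    revMul R ((f ⊗ₜ[ℂ] (1 : R)) * t) = revMul R (t * ((1 : R) ⊗ₜ[ℂ] f)) := by
  induction t using TensorProduct.induction_on with
  | zero => simp
  | tmul a b => simp [revMul, mul_assoc]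
  | add s t hs ht => simp [mul_add, add_mul, hs, ht]

/-- The cyclic derivative `F → R` attached to a double derivation: if `Δ f = ∑ a ⊗ b`, that is
`df = ∑ a dx b`, then the derivative of `tr f` is `∑ b a`, because `a dx b = b a dx`
modulo commutators. -/
def cycDeriv (Φ : R →ₐ[ℂ] Matrix (Fin 2) (Fin 2) (R ⊗[ℂ] R)) (h : IsDoubleDer Φ) :
    Cyc R →ₗ[ℂ] R :=
  Cyc.lift (revMul R ∘ₗ Matrix.entryLinearMap ℂ (R ⊗[ℂ] R) 0 1 ∘ₗ Φ.toLinearMap) fun a b => by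
    simp [Matrix.mul_apply, Fin.sum_univ_two, (h a).1, (h a).2.2, (h b).1, (h b).2.2,
      revMul_comm, add_comm]

end General

/-! ### Partial derivatives on free algebras and on noncommutative Laurent polynomials -/

section Partial

variable {X : Type*} [DecidableEq X]

/-- On the free algebra: the double derivation `D/Dx_i`, with `D x_j / D x_i = δ_ij 1 ⊗ 1`. -/
def freeDD (i : X) : FreeAlgebra ℂ X →ₐ[ℂ]
    Matrix (Fin 2) (Fin 2) (FreeAlgebra ℂ X ⊗[ℂ] FreeAlgebra ℂ X) :=
  FreeAlgebra.lift ℂ fun j =>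
    !![FreeAlgebra.ι ℂ j ⊗ₜ[ℂ] 1, if j = i then 1 else 0; 0, 1 ⊗ₜ[ℂ] FreeAlgebra.ι ℂ j]

theorem isDoubleDer_freeDD (i : X) : IsDoubleDer (freeDD i) := by
  intro f
  induction f using FreeAlgebra.induction with
  | grade0 r =>
    simp [Algebra.algebraMap_eq_smul_one, Algebra.TensorProduct.one_def, TensorProduct.smul_tmul']
  | grade1 x => simp [freeDD]
  | mul a b ha hb =>
    simp [Matrix.mul_apply, Fin.sum_univ_two, ha.1, ha.2.1, ha.2.2, hb.1, hb.2.1, hb.2.2]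
  | add a b ha hb =>
    simp [ha.1, ha.2.1, ha.2.2, hb.1, hb.2.1, hb.2.2, TensorProduct.add_tmul,
      TensorProduct.tmul_add]

/-- The nonabelian partial derivative `∂/∂x_i : F → A` on a free algebra. -/
def freePartial (i : X) : Cyc (FreeAlgebra ℂ X) →ₗ[ℂ] FreeAlgebra ℂ X :=
  cycDeriv (freeDD i) (isDoubleDer_freeDD i)

/-- Noncommutative Laurent polynomials: the group algebra of the free group. -/
abbrev Laurent (X : Type*) : Type _ := MonoidAlgebra ℂ (FreeGroup X)

/-- A group element as a Laurent monomial. -/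
abbrev lmon (w : FreeGroup X) : Laurent X := MonoidAlgebra.of ℂ (FreeGroup X) w

/-- The generator `x_i` of the algebra of Laurent polynomials. -/
abbrev lx (i : X) : Laurent X := lmon (FreeGroup.of i)

/-- The inverse `x_i⁻¹` in the algebra of Laurent polynomials. -/
abbrev lxInv (i : X) : Laurent X := lmon (FreeGroup.of i)⁻¹

/-- The invertible matrix `(x_j ⊗ 1, δ_ij; 0, 1 ⊗ x_j)`; its inverse encodes
`d(x⁻¹) = -x⁻¹ dx x⁻¹`. -/
def lauUnit (i j : X) : (Matrix (Fin 2) (Fin 2) (Laurent X ⊗[ℂ] Laurent X))ˣ where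
  val := !![lx j ⊗ₜ[ℂ] 1, if j = i then 1 else 0; 0, 1 ⊗ₜ[ℂ] lx j]
  inv := !![lxInv j ⊗ₜ[ℂ] 1, if j = i then (-lxInv j) ⊗ₜ[ℂ] lxInv j else 0;
    0, 1 ⊗ₜ[ℂ] lxInv j]
  val_inv := by
    have h : lx j * lxInv j = 1 := by rw [← map_mul, mul_inv_cancel, map_one]
    rw [Matrix.mul_fin_two, Matrix.one_fin_two]
    split_ifs <;> simp [h, Algebra.TensorProduct.one_def, ← TensorProduct.add_tmul,
      -MonoidAlgebra.of_apply]
  inv_val := by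
    have h : lxInv j * lx j = 1 := by rw [← map_mul, inv_mul_cancel, map_one]
    rw [Matrix.mul_fin_two, Matrix.one_fin_two]
    split_ifs <;> simp [h, Algebra.TensorProduct.one_def, ← TensorProduct.add_tmul,
      -MonoidAlgebra.of_apply]

/-- On Laurent polynomials: the double derivation `D/Dx_i`. -/
def lauDD (i : X) : Laurent X →ₐ[ℂ] Matrix (Fin 2) (Fin 2) (Laurent X ⊗[ℂ] Laurent X) :=
  MonoidAlgebra.lift ℂ _ _ ((Units.coeHom _).comp (FreeGroup.lift (lauUnit i)))

theorem isDoubleDer_lauDD (i : X) : IsDoubleDer (lauDD i) := by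
  have key : ∀ w : FreeGroup X, lauDD i (lmon w) 0 0 = lmon w ⊗ₜ[ℂ] 1 ∧
      lauDD i (lmon w) 1 0 = 0 ∧ lauDD i (lmon w) 1 1 = 1 ⊗ₜ[ℂ] lmon w := by
    intro w
    induction w using FreeGroup.induction_on with
    | C1 =>
      have e : lmon (1 : FreeGroup X) = 1 := map_one _
      simp [e, Algebra.TensorProduct.one_def, -MonoidAlgebra.of_apply]
    | of j => simp [lauDD, lauUnit]
    | inv_of j _ => simp [lauDD, lauUnit]
    | mul a b ha hb =>
      have e : lauDD i (lmon (a * b)) = lauDD i (lmon a) * lauDD i (lmon b) := by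
        rw [← map_mul, ← map_mul]
      have e' : lmon (a * b) = lmon a * lmon b := map_mul _ _ _
      rw [e, e']
      simp [Matrix.mul_apply, Fin.sum_univ_two, ha.1, ha.2.1, ha.2.2, hb.1, hb.2.1, hb.2.2,
        -MonoidAlgebra.of_apply]
  intro f
  induction f using MonoidAlgebra.induction_on with
  | of w => exact key w
  | add a b ha hb =>
    simp [ha.1, ha.2.1, ha.2.2, hb.1, hb.2.1, hb.2.2, TensorProduct.add_tmul,
      TensorProduct.tmul_add]
  | smul r a ha =>
    simp [ha.1, ha.2.1, ha.2.2, TensorProduct.smul_tmul']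

/-- The nonabelian partial derivative `∂/∂x_i` on Laurent polynomials. -/
def lauPartial (i : X) : Cyc (Laurent X) →ₗ[ℂ] Laurent X :=
  cycDeriv (lauDD i) (isDoubleDer_lauDD i)

end Partial

/-! ### Theta functions and the coefficients -/

section Theta

/-- `θ(z) = ∑_α (-1)^α exp(2πi(αz + α(α-1)τ/2))`. -/
def theta (τ z : ℂ) : ℂ :=
  ∑' α : ℤ, (-1 : ℂ) ^ α *
    Complex.exp (2 * Real.pi * Complex.I * (α * z + (α * (α - 1) : ℂ) / 2 * τ))

/-- The theta function with characteristic `α`; it depends only on `α` modulo `n`. -/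
def thetaChar (n : ℕ) (τ : ℂ) (α : ℤ) (z : ℂ) : ℂ :=
  (∏ s ∈ Finset.range n, theta τ (z + s / n + α / n * τ)) *
    Complex.exp (Real.pi * Complex.I *
      ((2 * α - n) * z - α / n + (α * (α - n) : ℂ) / n * τ))

variable (n : ℕ) [NeZero n]

/-- `θ_α(0)` for `α ∈ ℤ/n`. -/
def th (τ : ℂ) (α : ZMod n) : ℂ := thetaChar n τ α.val 0

/-- `θ'_α(0)` for `α ∈ ℤ/n`. -/
def thD (τ : ℂ) (α : ZMod n) : ℂ := deriv (thetaChar n τ α.val) 0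

/-- The coefficients `c_{i,r}`. -/
def ellCoeff (k : ℕ) (τ : ℂ) (i r : ZMod n) : ℂ :=
  if r = 0 then (if i = 0 then 0 else thD n τ i / th n τ i)
  else if r = i then thD n τ (k * i) / th n τ (k * i)
  else thD n τ 0 * th n τ (i + r * (k - 1)) / (th n τ (k * r) * th n τ (i - r))

end Theta

/-! ### The bivector field -/

section Field

variable {n : ℕ} [NeZero n]

/-- The bracket `tr (∑ c_{i-j,r} ∂f/∂x_i x_{i-r} ∂g/∂x_j x_{j+r})` on `R / [R, R]`, for elements
`x_i` and partial derivatives `∂/∂x_i` on an algebra `R`. -/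
def quadBracket {R : Type*} [Ring R] [Algebra ℂ R] (c : ZMod n → ZMod n → ℂ) (x : ZMod n → R)
    (p : ZMod n → Cyc R →ₗ[ℂ] R) : Cyc R →ₗ[ℂ] Cyc R →ₗ[ℂ] Cyc R :=
  LinearMap.mk₂ ℂ
    (fun f g => tr (∑ i, ∑ j, ∑ r, c (i - j) r • (p i f * x (i - r) * p j g * x (j + r))))
    (by intros; simp [add_mul, Finset.sum_add_distrib])
    (by intros; simp only [map_smul, smul_mul_assoc, Finset.smul_sum, map_sum,
      smul_comm (c _ _)])
    (by intros; simp [add_mul, mul_add, Finset.sum_add_distrib])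
    (by intros; simp only [map_smul, smul_mul_assoc, mul_smul_comm, Finset.smul_sum, map_sum,
      smul_comm (c _ _)])

variable (n)

/-- The free algebra `A = ℂ⟨x_i⟩`, `i ∈ ℤ/n`. -/
abbrev Aff : Type := FreeAlgebra ℂ (ZMod n)

/-- The elliptic nonabelian bivector field `ν` on `A`. -/
def ellNu (k : ℕ) (τ : ℂ) : Cyc (Aff n) →ₗ[ℂ] Cyc (Aff n) →ₗ[ℂ] Cyc (Aff n) :=
  quadBracket (ellCoeff n k τ) (FreeAlgebra.ι ℂ) freePartial

/-- `ν` on Laurent polynomials in the `x_i`. -/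
def ellNuLaurent (k : ℕ) (τ : ℂ) : Cyc (Laurent (ZMod n)) →ₗ[ℂ] Cyc (Laurent (ZMod n)) →ₗ[ℂ]
    Cyc (Laurent (ZMod n)) :=
  quadBracket (ellCoeff n k τ) lx lauPartial

/-! Homogeneity: invariance under `x_i ↦ a x_i`, `a` a noncommutative constant. -/

/-- Laurent polynomials in the `x_i` and an auxiliary generator `a`. -/
abbrev LaurentA : Type := Laurent (Option (ZMod n))

/-- `ν` on Laurent polynomials in the `x_i` and `a`, where `a` is a constant. -/
def ellNuA (k : ℕ) (τ : ℂ) : Cyc (LaurentA n) →ₗ[ℂ] Cyc (LaurentA n) →ₗ[ℂ] Cyc (LaurentA n) :=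
  quadBracket (ellCoeff n k τ) (fun i => lx (some i)) (fun i => lauPartial (some i))

/-- The inclusion of `A` into the Laurent polynomials in the `x_i` and `a`. -/
def inclA : Aff n →ₐ[ℂ] LaurentA n := FreeAlgebra.lift ℂ fun i => lx (some i)

/-- The homomorphism `f ↦ f^a`: `x_i ↦ a x_i`, `a ↦ a`. -/
def dilate : LaurentA n →ₐ[ℂ] LaurentA n :=
  MonoidAlgebra.mapDomainAlgHom ℂ ℂ (FreeGroup.lift fun o : Option (ZMod n) =>
    o.elim (FreeGroup.of none) fun i => FreeGroup.of none * FreeGroup.of (some i))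

/-! The Euler-type relations. -/

/-- `∑ x_i ∂f/∂x_i`. -/
def eulerLeft (f : Cyc (Aff n)) : Aff n := ∑ i, FreeAlgebra.ι ℂ i * freePartial i f

/-- `∑ (∂f/∂x_i) x_i`. -/
def eulerRight (f : Cyc (Aff n)) : Aff n := ∑ i, freePartial i f * FreeAlgebra.ι ℂ i

/-- The trilinear expressions in the derivatives of three functions that vanish modulo the relations
`∑ x_i ∂f/∂x_i = 0`, `∑ (∂f/∂x_i) x_i = 0` for each of the three arguments. -/
def eulerSpan : Submodule ℂ ((Fin 3 → Cyc (Aff n)) → Cyc (Aff n)) :=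
  Submodule.span ℂ {T | ∃ (σ : Equiv.Perm (Fin 3)) (E : Cyc (Aff n) → Aff n) (a b c : Aff n)
    (j l : ZMod n), (E = eulerLeft n ∨ E = eulerRight n) ∧
      T = fun v => tr (a * E (v (σ 0)) * b * freePartial j (v (σ 1)) * c *
        freePartial l (v (σ 2)))}

end Field

/-! ### Nonabelian Poisson structures on the noncommutative projective space, by affine charts -/

section Proj

variable (n : ℕ) [NeZero n]

/-- The chart `ℂ⟨u_{i,j} : i ≠ j⟩`. -/
abbrev Chart (j : ZMod n) : Type := FreeAlgebra ℂ {i : ZMod n // i ≠ j}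

/-- The relations that make `w` the inverse of `u_{k,j}`. -/
inductive OverlapRel (j k : ZMod n) (h : k ≠ j) :
    FreeAlgebra ℂ (Option {i : ZMod n // i ≠ j}) →
      FreeAlgebra ℂ (Option {i : ZMod n // i ≠ j}) → Prop
  | mul_inv : OverlapRel j k h
      (FreeAlgebra.ι ℂ (some ⟨k, h⟩) * FreeAlgebra.ι ℂ none) 1
  | inv_mul : OverlapRel j k h
      (FreeAlgebra.ι ℂ none * FreeAlgebra.ι ℂ (some ⟨k, h⟩)) 1

/-- The overlap of the charts `j` and `k`: `ℂ⟨u_{i,j} (i ≠ j), u_{k,j}⁻¹⟩`. -/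
abbrev Overlap (j k : ZMod n) (h : k ≠ j) : Type := RingQuot (OverlapRel n j k h)

/-- The coordinate `u_{i,j}` on the overlap, with `u_{j,j} = 1`. -/
def ovU (j k : ZMod n) (h : k ≠ j) (i : ZMod n) : Overlap n j k h :=
  if hi : i = j then 1
  else RingQuot.mkAlgHom ℂ (OverlapRel n j k h) (FreeAlgebra.ι ℂ (some ⟨i, hi⟩))

/-- `u_{k,j}⁻¹` on the overlap. -/
def ovInv (j k : ZMod n) (h : k ≠ j) : Overlap n j k h :=
  RingQuot.mkAlgHom ℂ (OverlapRel n j k h) (FreeAlgebra.ι ℂ none)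

/-- Restriction from the chart `j` to the overlap. -/
def resFst (j k : ZMod n) (h : k ≠ j) : Chart n j →ₐ[ℂ] Overlap n j k h :=
  FreeAlgebra.lift ℂ fun i => ovU n j k h i

/-- Restriction from the chart `k` to the overlap: `u_{i,k} = u_{k,j}⁻¹ u_{i,j}`. -/
def resSnd (j k : ZMod n) (h : k ≠ j) : Chart n k →ₐ[ℂ] Overlap n j k h :=
  FreeAlgebra.lift ℂ fun i => ovInv n j k h * ovU n j k h i

/-- A nonabelian Poisson structure on the noncommutative `ℂP^{n-1}`: nonabelian Poisson structures
on all affine charts, any two of which are restrictions of one nonabelian Poisson structure on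
the overlap of the charts. -/
structure IsProjPoisson
    (b : ∀ j, Cyc (Chart n j) →ₗ[ℂ] Cyc (Chart n j) →ₗ[ℂ] Cyc (Chart n j)) : Prop where
  poisson : ∀ j, IsNCPoisson (b j)
  glue : ∀ (j k : ZMod n) (h : k ≠ j),
    ∃ β : Cyc (Overlap n j k h) →ₗ[ℂ] Cyc (Overlap n j k h) →ₗ[ℂ] Cyc (Overlap n j k h),
      IsNCPoisson β ∧
      (∀ f g, β (Cyc.map (resFst n j k h) f) (Cyc.map (resFst n j k h) g) =
        Cyc.map (resFst n j k h) (b j f g)) ∧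
      (∀ f g, β (Cyc.map (resSnd n j k h) f) (Cyc.map (resSnd n j k h) g) =
        Cyc.map (resSnd n j k h) (b k f g))

/-- The affine coordinates in terms of the homogeneous ones: `u_{i,j} = x_j⁻¹ x_i`. -/
def chartEmb (j : ZMod n) : Chart n j →ₐ[ℂ] Laurent (ZMod n) :=
  FreeAlgebra.lift ℂ fun i => lxInv j * lx (i : ZMod n)

end Proj

/-! ### Abelianization and the Poisson algebra `q_{n,k}(τ)` -/

section Abelian

variable (n : ℕ) [NeZero n]

/-- The abelianization map `F = A / [A, A] → ℂ[x_i]`. -/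
def abel : Cyc (Aff n) →ₗ[ℂ] MvPolynomial (ZMod n) ℂ :=
  Cyc.lift (FreeAlgebra.lift ℂ (MvPolynomial.X (R := ℂ) (σ := ZMod n))).toLinearMap fun a b => by
    simp [mul_comm]

/-- The polynomial `{x_i, x_j}` in `q_{n,k}(τ)`. -/
def qGen (k : ℕ) (τ : ℂ) (i j : ZMod n) : MvPolynomial (ZMod n) ℂ :=
  if i = j then 0
  else
    (thD n τ (j - i) / th n τ (j - i) + thD n τ (k * (j - i)) / th n τ (k * (j - i))) •
      (MvPolynomial.X i * MvPolynomial.X j) +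
    ∑ r ∈ Finset.univ.filter (fun r : ZMod n => r ≠ 0 ∧ r ≠ j - i),
      (thD n τ 0 * th n τ (j - i + r * (k - 1)) / (th n τ (k * r) * th n τ (j - i - r))) •
        (MvPolynomial.X (j - r) * MvPolynomial.X (i + r))

/-- The bracket of `q_{n,k}(τ)`: the biderivation of `ℂ[x_i]` with the given values `{x_i, x_j}`. -/
def qBracket (k : ℕ) (τ : ℂ) :
    MvPolynomial (ZMod n) ℂ →ₗ[ℂ] MvPolynomial (ZMod n) ℂ →ₗ[ℂ] MvPolynomial (ZMod n) ℂ :=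
  LinearMap.mk₂ ℂ
    (fun f g => ∑ i, ∑ j, qGen n k τ i j * MvPolynomial.pderiv i f * MvPolynomial.pderiv j g)
    (by intros; simp [add_mul, mul_add, Finset.sum_add_distrib])
    (by intros; simp [Finset.smul_sum])
    (by intros; simp [mul_add, Finset.sum_add_distrib])
    (by intros; simp [Finset.smul_sum])

/-- Poisson brackets on a commutative algebra. -/
structure IsPoissonBracket {P : Type*} [CommRing P] [Algebra ℂ P] (b : P →ₗ[ℂ] P →ₗ[ℂ] P) :
    Prop where
  antisymm : ∀ f g, b f g = -b g f
  leibniz : ∀ f g h, b (f * g) h = f * b g h + g * b f h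
  jacobi : ∀ f g h, b (b f g) h + b (b g h) f + b (b h f) g = 0

/-- The bracket `b` on `ℂ[x_i]` is the abelianization of the bivector field `ν` on `A`
(it is determined by `ν`, as the abelianization map is surjective). -/
def IsAbelianization (ν : Cyc (Aff n) →ₗ[ℂ] Cyc (Aff n) →ₗ[ℂ] Cyc (Aff n))
    (b : MvPolynomial (ZMod n) ℂ →ₗ[ℂ] MvPolynomial (ZMod n) ℂ →ₗ[ℂ] MvPolynomial (ZMod n) ℂ) :
    Prop :=
  ∀ f g, abel n (ν f g) = b (abel n f) (abel n g)

/-- The relabelling `x_i ↦ x_{-i}` of `ℂ[x_i]`. -/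
def relabel : MvPolynomial (ZMod n) ℂ ≃ₐ[ℂ] MvPolynomial (ZMod n) ℂ :=
  MvPolynomial.renameEquiv ℂ (Equiv.neg (ZMod n))

end Abelian

end NCPoisson

end

open NCPoisson

set_option linter.unusedSectionVars false

open scoped TensorProduct

noncomputable section

/-! The coefficient $c_{i,r}$ is the constant term, at the characteristics $(kr, i-r)$, of the
Kronecker function $\theta_0'(0)\theta_{\alpha+\beta}(x+y)/(\theta_\alpha(x)\theta_\beta(y))$ at
$x=y=0$ (`ellCoeff_eq`). The separate cases in the definition of $c_{i,r}$ are the points where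
$\alpha$ or $\beta$ vanishes and the function has a pole. This function satisfies the associative
Yang-Baxter equation (`kron_yang_baxter`): that is the three-term theta identity, which in turn is
the Plücker relation applied to the addition formula $G(x+y)G(x-y)=A(x)B(y)-B(x)A(y)$. Comparing
coefficients in a Laurent expansion gives a quadratic relation for the $c_{i,r}$, with a defect
supported where some characteristic is zero (`kronConst_yang_baxter`).

For any $c$ with $c_{-i,-r}=-c_{i,r}$ the bracket has Hamiltonian vector fields. In the cyclic
Jacobi sum the second derivatives cancel by symmetry, and what is left is trilinear in first
derivatives with coefficients quadratic in $c$ (`IsHamiltonian.jacobiator_eq`). By cyclicity of the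
trace only cyclic sums of these coefficients matter, and such a sum is the left side of the
Yang-Baxter relation. On the defect side each delta function contracts two neighbouring factors into
$\sum x_i\,\partial f/\partial x_i$ or $\sum(\partial f/\partial x_i)\,x_i$ (`triForm_eulerCoeff`,
`cycCoeff_ellCoeff`). This is the claim on the Schouten square.

On an affine chart put $u_j=1$ and define the derivative in the direction $u_j$ so that the left
Euler identity holds; the right one is then the universal identity $\sum[\partial f/\partial
u_i,u_i]=0$ (`IsCoordinates.sum_commutator`). So the Schouten square vanishes there. The same
formula works on overlaps. A change of chart multiplies all homogeneous coordinates by a common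
factor, under which the bracket is invariant (`quadBracket_map`); homogeneity has the same cause.
After abelianization the Euler terms cancel by a reflection symmetry of their coefficients
(`abel_jacobiator`), which yields the Jacobi identity of $q_{n,k}(\tau)$.

The analytic input is that no denominator vanishes: $\theta_\alpha(0)\ne0$ for $\alpha\neq0$ and
$\theta_0'(0)\ne0$. Both come from the Jacobi triple product, after the $n$ factors of
$\theta_\alpha$ are merged into one theta function of period $n\tau$. -/

namespace NCPoisson

/-! ### The Jacobi triple product -/

section TripleProduct

open Finset Filter Topology

/-- The finite product `∏_{i=1}^N (1 - q^i)`. -/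
def qPoch (q : ℂ) (N : ℕ) : ℂ := ∏ i ∈ range N, (1 - q ^ (i + 1))

/-- The inverse of `∏_{i=1}^m (1 - q^i)`, extended by zero to negative `m`. -/
def qPochInv (q : ℂ) (m : ℤ) : ℂ := if 0 ≤ m then (qPoch q m.toNat)⁻¹ else 0

/-- The coefficients `(-1)^j q^(j(j-1)/2)`. -/
def thetaCoeff (q : ℂ) (j : ℤ) : ℂ := (-1) ^ j * q ^ (j * (j - 1) / 2)

variable {q : ℂ}

theorem one_sub_pow_ne_zero (hq : ‖q‖ < 1) (m : ℕ) : 1 - q ^ (m + 1) ≠ 0 := by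
  intro h
  have h1 : ‖q ^ (m + 1)‖ = 1 := by rw [← sub_eq_zero.1 h, norm_one]
  rw [norm_pow] at h1
  exact (pow_lt_one₀ (norm_nonneg q) hq (Nat.succ_ne_zero m)).ne h1

theorem qPoch_ne_zero (hq : ‖q‖ < 1) (N : ℕ) : qPoch q N ≠ 0 :=
  prod_ne_zero_iff.2 fun i _ => one_sub_pow_ne_zero hq i

/-- Thanks to the extension by zero the recursion holds for every integer: at $m=0$ the factor
$1-q^0$ kills the right side, and for $m<0$ both sides are zero. -/
theorem qPochInv_sub_one (hq : ‖q‖ < 1) (m : ℤ) :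
    qPochInv q (m - 1) = (1 - q ^ m) * qPochInv q m := by
  rcases lt_trichotomy m 0 with h | rfl | h
  · simp [qPochInv, not_le.2 h, show ¬ (1 ≤ m) by omega]
  · simp [qPochInv]
  · obtain ⟨k, rfl⟩ : ∃ k : ℕ, m = k + 1 := ⟨(m - 1).toNat, by omega⟩
    have e1 : ((k : ℤ) + 1 - 1).toNat = k := by omega
    have e2 : ((k : ℤ) + 1).toNat = k + 1 := by omega
    have h0 := one_sub_pow_ne_zero hq k
    have h1 := qPoch_ne_zero hq k
    have h2 : q ^ ((k : ℤ) + 1) = q ^ (k + 1) := by exact_mod_cast zpow_natCast q (k + 1)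
    rw [qPochInv, qPochInv, if_pos (by omega), if_pos (by omega), e1, e2, h2, qPoch, qPoch,
      prod_range_succ, mul_inv, mul_comm (∏ i ∈ range k, _)⁻¹, ← mul_assoc, mul_inv_cancel₀ h0,
      one_mul]

theorem thetaCoeff_succ (hq0 : q ≠ 0) (j : ℤ) :
    thetaCoeff q (j + 1) = -(q ^ j * thetaCoeff q j) := by
  have h : (j + 1) * (j + 1 - 1) / 2 = j + j * (j - 1) / 2 := by
    rw [show (j + 1) * (j + 1 - 1) = j * (j - 1) + j * 2 by ring, Int.add_mul_ediv_right _ _ two_ne_zero]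
    ring
  rw [thetaCoeff, thetaCoeff, h, zpow_add₀ hq0, zpow_add_one₀ (by norm_num)]
  ring

/-- The finite form of the triple product. -/
theorem hasSum_triple_finite (hq : ‖q‖ < 1) (hq0 : q ≠ 0) {y : ℂ} (hy : y ≠ 0) (N : ℕ) :
    HasSum (fun j : ℤ => thetaCoeff q j *
      (qPoch q (2 * N) * qPochInv q (N + j) * qPochInv q (N - j)) * y ^ j)
      (∏ m ∈ range N, ((1 - q ^ m * y) * (1 - q ^ (m + 1) * y⁻¹))) := by
  induction N with
  | zero =>
    have := hasSum_single (f := fun j : ℤ => thetaCoeff q j *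
      (qPoch q (2 * 0) * qPochInv q ((0 : ℕ) + j) * qPochInv q ((0 : ℕ) - j)) * y ^ j) 0 (by
        intro j hj
        rcases lt_or_gt_of_ne hj with h | h
        · simp [qPochInv, not_le.2 h]
        · simp [qPochInv, not_le.2 h])
    simpa [thetaCoeff, qPochInv, qPoch] using this
  | succ N ih =>
    rw [prod_range_succ]
    -- The new factor has three terms: a constant, one in $y$ and one in $y^{-1}$. The last two
    -- shift the summation index by one, hence the reindexed sums `s2` and `s3`.
    have e : ∀ P : ℂ, P * ((1 - q ^ N * y) * (1 - q ^ (N + 1) * y⁻¹)) =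
        (1 + q ^ (2 * N + 1)) * P + (-(q ^ N * y) * P + -(q ^ (N + 1) * y⁻¹) * P) := by
      intro P
      field_simp
      ring
    rw [e]
    have s1 := ih.mul_left (1 + q ^ (2 * N + 1))
    have s2 := (Equiv.subRight (1 : ℤ)).hasSum_iff.2 (ih.mul_left (-(q ^ N * y)))
    have s3 := (Equiv.addRight (1 : ℤ)).hasSum_iff.2 (ih.mul_left (-(q ^ (N + 1) * y⁻¹)))
    refine (s1.add (s2.add s3)).congr_fun ?_
    intro j
    -- All inverse products are expressed through those at $N+1+j$ and $N+1-j$, so that comparing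
    -- coefficients becomes an identity of rational functions in $q$, $q^N$, $q^j$, $y$.
    have i1 : qPochInv q (N + j) = (1 - q ^ ((N : ℤ) + 1 + j)) * qPochInv q (N + 1 + j) := by
      rw [← qPochInv_sub_one hq]; congr 1; ring
    have i2 : qPochInv q (N - j) = (1 - q ^ ((N : ℤ) + 1 - j)) * qPochInv q (N + 1 - j) := by
      rw [← qPochInv_sub_one hq]; congr 1; ring
    have i3 : qPochInv q (N + (j - 1)) = (1 - q ^ ((N : ℤ) + j)) * qPochInv q (N + j) := by
      rw [← qPochInv_sub_one hq]; congr 1; ring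
    have i4 : qPochInv q (N - (j + 1)) = (1 - q ^ ((N : ℤ) - j)) * qPochInv q (N - j) := by
      rw [← qPochInv_sub_one hq]; congr 1; ring
    have t1 : thetaCoeff q (j - 1) = -(thetaCoeff q j * q ^ (1 - j)) := by
      have := thetaCoeff_succ hq0 (j - 1)
      rw [sub_add_cancel] at this
      rw [this, neg_mul, neg_neg, mul_right_comm, ← zpow_add₀ hq0]
      simp
    have t2 := thetaCoeff_succ hq0 j
    have p1 : qPoch q (2 * (N + 1)) =
        qPoch q (2 * N) * (1 - q ^ (2 * N + 1)) * (1 - q ^ (2 * N + 2)) := by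
      rw [mul_add, mul_one, qPoch, prod_range_succ, prod_range_succ, qPoch]
    have v1 : q ^ ((N : ℤ) + 1 + j) = q * (q ^ N * q ^ j) := by
      rw [zpow_add₀ hq0, zpow_add₀ hq0, zpow_one, zpow_natCast]; ring
    have v2 : q ^ ((N : ℤ) + 1 - j) = q * (q ^ N * (q ^ j)⁻¹) := by
      rw [zpow_sub₀ hq0, zpow_add₀ hq0, zpow_one, zpow_natCast]; ring
    have v3 : q ^ ((N : ℤ) + j) = q ^ N * q ^ j := by rw [zpow_add₀ hq0, zpow_natCast]
    have v4 : q ^ ((N : ℤ) - j) = q ^ N * (q ^ j)⁻¹ := by rw [zpow_sub₀ hq0, zpow_natCast]; ring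
    have v5 : q ^ (1 - j) = q * (q ^ j)⁻¹ := by rw [zpow_sub₀ hq0, zpow_one]; ring
    have v6 : y ^ (j - 1) = y ^ j * y⁻¹ := zpow_sub_one₀ hy j
    have v7 : y ^ (j + 1) = y ^ j * y := zpow_add_one₀ hy j
    have v8 : q ^ (2 * N + 1) = q * q ^ N * q ^ N := by ring
    have v9 : q ^ (2 * N + 2) = q * q * q ^ N * q ^ N := by ring
    have v10 : q ^ (N + 1) = q * q ^ N := by ring
    have hj : q ^ j * (q ^ j)⁻¹ = 1 := mul_inv_cancel₀ (zpow_ne_zero j hq0)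
    have hyy : y * y⁻¹ = 1 := mul_inv_cancel₀ hy
    have c1 : ((N : ℤ) - (j - 1)) = N + 1 - j := by ring
    have c2 : ((N : ℤ) + (j + 1)) = N + 1 + j := by ring
    simp only [Function.comp_apply, Equiv.subRight_apply, Equiv.coe_addRight, Nat.cast_add,
      Nat.cast_one, i3, i4, c1, c2, i1, i2, t1, t2, p1, v1, v2, v3, v4, v5, v6, v7, v8, v9, v10]
    generalize qPochInv q ((N : ℤ) + 1 + j) = I1
    generalize qPochInv q ((N : ℤ) + 1 - j) = I2
    generalize thetaCoeff q j = E
    generalize qPoch q (2 * N) = B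
    generalize q ^ N = Q
    generalize y ^ j = Y
    have hz : q ^ j ≠ 0 := zpow_ne_zero j hq0
    generalize q ^ j = z at hz ⊢
    field_simp
    ring

theorem multipliable_one_sub_pow_succ (hq : ‖q‖ < 1) :
    Multipliable fun i : ℕ => 1 - q ^ (i + 1) := ModularForm.multipliable_one_sub_pow hq

theorem tprod_one_sub_pow_ne_zero (hq : ‖q‖ < 1) : ∏' i : ℕ, (1 - q ^ (i + 1)) ≠ 0 := by
  simp only [sub_eq_add_neg]
  refine tprod_one_add_ne_zero_of_summable (fun i => ?_) ?_
  · simpa [sub_eq_add_neg] using one_sub_pow_ne_zero hq i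
  · simpa using (summable_nat_add_iff 1).mpr (summable_geometric_of_lt_one (norm_nonneg q) hq)

theorem tendsto_qPoch (hq : ‖q‖ < 1) :
    Tendsto (qPoch q) atTop (𝓝 (∏' i : ℕ, (1 - q ^ (i + 1)))) :=
  (multipliable_one_sub_pow_succ hq).hasProd.tendsto_prod_nat

theorem tendsto_qPochInv (hq : ‖q‖ < 1) :
    Tendsto (qPochInv q) atTop (𝓝 (∏' i : ℕ, (1 - q ^ (i + 1)))⁻¹) := by
  have h : Tendsto Int.toNat atTop atTop := by
    refine tendsto_atTop.2 fun b => ?_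
    filter_upwards [eventually_ge_atTop (b : ℤ)] with a ha
    omega
  refine (((tendsto_qPoch hq).inv₀ (tprod_one_sub_pow_ne_zero hq)).comp h).congr' ?_
  filter_upwards [eventually_ge_atTop 0] with m hm
  simp [qPochInv, hm]

theorem exists_bound_qPochInv (hq : ‖q‖ < 1) : ∃ C, ∀ m, ‖qPochInv q m‖ ≤ C := by
  obtain ⟨C, hC⟩ := (Metric.isBounded_range_of_tendsto _
    ((tendsto_qPoch hq).inv₀ (tprod_one_sub_pow_ne_zero hq))).exists_norm_le
  refine ⟨C, fun m => ?_⟩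
  rw [qPochInv]
  split_ifs
  · exact hC _ ⟨_, rfl⟩
  · simpa using (norm_nonneg _).trans (hC _ ⟨0, rfl⟩)

/-- The triple product as a limit of finite products. -/
theorem tendsto_triple (hq : ‖q‖ < 1) (hq0 : q ≠ 0) {y : ℂ} (hy : y ≠ 0)
    (hs : Summable fun j : ℤ => thetaCoeff q j * y ^ j) :
    Tendsto (fun N => ∏ m ∈ range N, ((1 - q ^ m * y) * (1 - q ^ (m + 1) * y⁻¹))) atTop
      (𝓝 ((∏' i : ℕ, (1 - q ^ (i + 1)))⁻¹ * ∑' j : ℤ, thetaCoeff q j * y ^ j)) := by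
  obtain ⟨C, hC⟩ := exists_bound_qPochInv hq
  obtain ⟨C', hC'⟩ := (Metric.isBounded_range_of_tendsto _ (tendsto_qPoch hq)).exists_norm_le
  simp only [← fun N => (hasSum_triple_finite hq hq0 hy N).tsum_eq]
  -- The Gaussian binomials are bounded uniformly in $N$ and $j$ and tend to $\prod(1-q^i)^{-1}$ for
  -- fixed $j$, so dominated convergence applies.
  rw [← tsum_mul_left]
  refine tendsto_tsum_of_dominated_convergence
    (bound := fun j => C' * C * C * ‖thetaCoeff q j * y ^ j‖) (hs.norm.mul_left _) ?_ ?_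
  · intro j
    have l1 : Tendsto (fun N : ℕ => qPoch q (2 * N)) atTop (𝓝 (∏' i : ℕ, (1 - q ^ (i + 1)))) :=
      (tendsto_qPoch hq).comp (tendsto_id.const_mul_atTop' two_pos)
    have l2 : Tendsto (fun N : ℕ => qPochInv q (N + j)) atTop _ :=
      (tendsto_qPochInv hq).comp (tendsto_natCast_atTop_atTop.atTop_add tendsto_const_nhds)
    have l3 : Tendsto (fun N : ℕ => qPochInv q (N - j)) atTop _ :=
      (tendsto_qPochInv hq).comp
        (tendsto_atTop_add_const_right _ (-j) tendsto_natCast_atTop_atTop)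
    have := ((((l1.mul l2).mul l3).const_mul (thetaCoeff q j)).mul_const (y ^ j))
    rw [mul_inv_cancel₀ (tprod_one_sub_pow_ne_zero hq), one_mul] at this
    convert this using 2
    ring
  · refine Eventually.of_forall fun N j => ?_
    have e : thetaCoeff q j * (qPoch q (2 * N) * qPochInv q (N + j) * qPochInv q (N - j)) * y ^ j =
      qPoch q (2 * N) * qPochInv q (N + j) * qPochInv q (N - j) * (thetaCoeff q j * y ^ j) := by
      ring
    rw [e, norm_mul, norm_mul, norm_mul]
    have hC0 : 0 ≤ C := (norm_nonneg _).trans (hC 0)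
    have hC0' : 0 ≤ C' := (norm_nonneg _).trans (hC' _ ⟨0, rfl⟩)
    have := hC' _ ⟨2 * N, rfl⟩
    gcongr
    · exact hC _
    · exact hC _

end TripleProduct

/-! ### Zeros of the theta function -/

section ThetaZeros

open Finset Filter Topology Complex

/-- The function `e(z) = exp(2πiz)`. -/
def expTwoPi (z : ℂ) : ℂ := Complex.exp (2 * Real.pi * Complex.I * z)

theorem expTwoPi_add (z w : ℂ) : expTwoPi (z + w) = expTwoPi z * expTwoPi w := by
  rw [expTwoPi, mul_add, Complex.exp_add]; rfl

theorem expTwoPi_neg (z : ℂ) : expTwoPi (-z) = (expTwoPi z)⁻¹ := by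
  rw [expTwoPi, mul_neg, Complex.exp_neg]; rfl

theorem expTwoPi_ne_zero (z : ℂ) : expTwoPi z ≠ 0 := Complex.exp_ne_zero _

theorem expTwoPi_int_mul (m : ℤ) (z : ℂ) : expTwoPi (m * z) = expTwoPi z ^ m := by
  rw [expTwoPi, expTwoPi, ← Complex.exp_int_mul]; congr 1; ring

theorem expTwoPi_nat_mul (m : ℕ) (z : ℂ) : expTwoPi (m * z) = expTwoPi z ^ m := by
  rw [expTwoPi, expTwoPi, ← Complex.exp_nat_mul]; congr 1; ring

theorem expTwoPi_eq_one_iff (z : ℂ) : expTwoPi z = 1 ↔ ∃ a : ℤ, z = a := by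
  rw [expTwoPi, Complex.exp_eq_one_iff]
  have h : (2 * Real.pi * Complex.I : ℂ) ≠ 0 := Complex.two_pi_I_ne_zero
  refine exists_congr fun a => ⟨fun e => ?_, fun e => by rw [e]; ring⟩
  rw [mul_comm (a : ℂ)] at e
  exact mul_left_cancel₀ h e

theorem norm_expTwoPi_lt_one {τ : ℂ} (hτ : 0 < τ.im) : ‖expTwoPi τ‖ < 1 := by
  rw [expTwoPi, Complex.norm_exp]
  simp only [Real.exp_lt_one_iff]
  have : (2 * Real.pi * I * τ).re = -(2 * Real.pi * τ.im) := by simp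
  rw [this]
  have := mul_pos Real.two_pi_pos hτ
  linarith

theorem norm_expTwoPi_ofReal (x : ℝ) : ‖expTwoPi x‖ = 1 := by
  rw [expTwoPi, Complex.norm_exp]; simp

theorem thetaCoeff_mul_zpow (τ z : ℂ) (α : ℤ) :
    thetaCoeff (expTwoPi τ) α * expTwoPi z ^ α = (-1 : ℂ) ^ α *
      Complex.exp (2 * Real.pi * Complex.I * (α * z + (α * (α - 1) : ℂ) / 2 * τ)) := by
  have h : ((α * (α - 1) / 2 : ℤ) : ℂ) = (α * (α - 1) : ℂ) / 2 := by
    rw [Int.cast_div (Int.even_mul_pred_self α).two_dvd (by norm_num)]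
    push_cast
    rfl
  rw [thetaCoeff, ← expTwoPi_int_mul, ← expTwoPi_int_mul, h, mul_assoc, ← expTwoPi_add, expTwoPi,
    add_comm (_ * τ)]

theorem theta_eq_tsum (τ z : ℂ) :
    theta τ z = ∑' α : ℤ, thetaCoeff (expTwoPi τ) α * expTwoPi z ^ α :=
  tsum_congr fun α => (thetaCoeff_mul_zpow τ z α).symm

/-- Completing the square identifies the series with Jacobi's, translated by $1/2-\tau/2$;
convergence and holomorphy are inherited from there. -/
theorem thetaCoeff_mul_zpow_eq_jacobi (τ z : ℂ) (α : ℤ) :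
    thetaCoeff (expTwoPi τ) α * expTwoPi z ^ α =
      jacobiTheta₂_term α (z + 1 / 2 - τ / 2) τ := by
  have h : (-1 : ℂ) ^ α = Complex.exp (α * (Real.pi * Complex.I)) := by
    rw [Complex.exp_int_mul, Complex.exp_pi_mul_I]
  rw [thetaCoeff_mul_zpow, jacobiTheta₂_term, h, ← Complex.exp_add]
  congr 1
  ring

theorem theta_eq_jacobiTheta₂ (τ z : ℂ) : theta τ z = jacobiTheta₂ (z + 1 / 2 - τ / 2) τ := by
  rw [theta_eq_tsum]
  exact tsum_congr fun α => thetaCoeff_mul_zpow_eq_jacobi τ z α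

variable {τ : ℂ}

theorem summable_thetaCoeff (hτ : 0 < τ.im) (z : ℂ) :
    Summable fun α : ℤ => thetaCoeff (expTwoPi τ) α * expTwoPi z ^ α := by
  simp only [thetaCoeff_mul_zpow_eq_jacobi]
  exact (summable_jacobiTheta₂_term_iff _ _).2 hτ

theorem differentiable_theta (hτ : 0 < τ.im) : Differentiable ℂ (theta τ) := by
  intro z
  have e : theta τ = fun z => jacobiTheta₂ (z + 1 / 2 - τ / 2) τ :=
    funext (theta_eq_jacobiTheta₂ τ)
  rw [e]
  exact (differentiableAt_jacobiTheta₂_fst _ hτ).comp z (by fun_prop)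

/-- The factors of the triple product. -/
def thetaFactor (q y : ℂ) (m : ℕ) : ℂ := (1 - q ^ m * y) * (1 - q ^ (m + 1) * y⁻¹)

theorem summable_thetaFactor_sub_one {q : ℂ} (hq : ‖q‖ < 1) (y : ℂ) :
    Summable fun m => ‖thetaFactor q y m - 1‖ := by
  have h : Summable fun m : ℕ => ‖q‖ ^ m := summable_geometric_of_lt_one (norm_nonneg q) hq
  refine .of_nonneg_of_le (fun _ => norm_nonneg _) (fun m => ?_)
    ((h.mul_right ‖y‖).add ((h.mul_right ‖y⁻¹‖).add h))
  have e : thetaFactor q y m - 1 =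
      -(q ^ m * y) + (-(q ^ (m + 1) * y⁻¹) + q ^ m * (q ^ (m + 1) * (y * y⁻¹))) := by
    rw [thetaFactor]; ring
  have h1 : ‖q ^ (m + 1)‖ ≤ ‖q‖ ^ m := by
    rw [norm_pow]
    exact pow_le_pow_of_le_one (norm_nonneg q) hq.le (Nat.le_succ m)
  have h2 : ‖y * y⁻¹‖ ≤ 1 := by
    rcases eq_or_ne y 0 with rfl | hy
    · simp
    · rw [mul_inv_cancel₀ hy, norm_one]
  have h3 : ‖q ^ (m + 1)‖ ≤ 1 := by
    rw [norm_pow]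
    exact pow_le_one₀ (norm_nonneg q) hq.le
  rw [e]
  refine (norm_add_le _ _).trans (add_le_add ?_ ((norm_add_le _ _).trans (add_le_add ?_ ?_)))
  · simp
  · rw [norm_neg, norm_mul]
    gcongr
  · rw [norm_mul, norm_mul, norm_pow]
    exact mul_le_of_le_one_right (by positivity) (mul_le_one₀ h3 (norm_nonneg _) h2)

theorem multipliable_thetaFactor {q : ℂ} (hq : ‖q‖ < 1) (y : ℂ) :
    Multipliable (thetaFactor q y) := by
  simpa using multipliable_one_add_of_summable (summable_thetaFactor_sub_one hq y)

/-- The Jacobi triple product. -/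
theorem theta_eq_tprod (hτ : 0 < τ.im) (z : ℂ) :
    theta τ z = (∏' i : ℕ, (1 - expTwoPi τ ^ (i + 1))) *
      ∏' m, thetaFactor (expTwoPi τ) (expTwoPi z) m := by
  have hq := norm_expTwoPi_lt_one hτ
  have h := tendsto_nhds_unique
    (tendsto_triple hq (expTwoPi_ne_zero τ) (expTwoPi_ne_zero z) (summable_thetaCoeff hτ z))
    (multipliable_thetaFactor hq _).hasProd.tendsto_prod_nat
  rw [← h, theta_eq_tsum, mul_inv_cancel_left₀ (tprod_one_sub_pow_ne_zero hq)]

/-- An absolutely convergent product vanishes only if a factor does, and a factor vanishes only when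
$z$ differs from an integer by a multiple of $\tau$. -/
theorem theta_ne_zero (hτ : 0 < τ.im) {z : ℂ} (hz : ∀ a b : ℤ, z ≠ a + b * τ) : theta τ z ≠ 0 := by
  have hq := norm_expTwoPi_lt_one hτ
  rw [theta_eq_tprod hτ]
  refine mul_ne_zero (tprod_one_sub_pow_ne_zero hq) ?_
  have h : ∀ m, 1 + (thetaFactor (expTwoPi τ) (expTwoPi z) m - 1) ≠ 0 := by
    intro m
    rw [add_sub_cancel]
    refine mul_ne_zero (fun h0 => ?_) (fun h0 => ?_)
    · rw [← expTwoPi_nat_mul, ← expTwoPi_add] at h0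
      obtain ⟨a, ha⟩ := (expTwoPi_eq_one_iff _).1 (sub_eq_zero.1 h0).symm
      exact hz a (-m) (by push_cast; linear_combination ha)
    · rw [← expTwoPi_nat_mul, ← expTwoPi_neg, ← expTwoPi_add] at h0
      obtain ⟨a, ha⟩ := (expTwoPi_eq_one_iff _).1 (sub_eq_zero.1 h0).symm
      exact hz (-a) (m + 1) (by push_cast at ha ⊢; linear_combination -ha)
  simpa using tprod_one_add_ne_zero_of_summable h (summable_thetaFactor_sub_one hq _)

theorem theta_zero (hτ : 0 < τ.im) : theta τ 0 = 0 := by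
  rw [theta_eq_tprod hτ]
  have : thetaFactor (expTwoPi τ) (expTwoPi 0) 0 = 0 := by simp [thetaFactor, expTwoPi]
  rw [tprod_of_exists_eq_zero ⟨0, this⟩, mul_zero]

/-- A lower bound for `θ` on the real axis. -/
theorem exists_lower_bound_theta (hτ : 0 < τ.im) :
    ∃ c > 0, ∀ x : ℝ, c * ‖1 - expTwoPi x‖ ≤ ‖theta τ x‖ := by
  have hq := norm_expTwoPi_lt_one hτ
  set q := expTwoPi τ with hqd
  have hr : ‖((‖q‖ : ℝ) : ℂ)‖ < 1 := by simpa using hq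
  set ρ := ‖∏' i : ℕ, (1 - ((‖q‖ : ℝ) : ℂ) ^ (i + 1))‖ with hρ
  have hρ0 : 0 < ρ := norm_pos_iff.2 (tprod_one_sub_pow_ne_zero hr)
  refine ⟨‖∏' i : ℕ, (1 - q ^ (i + 1))‖ * (ρ * ρ),
    mul_pos (norm_pos_iff.2 (tprod_one_sub_pow_ne_zero hq)) (mul_pos hρ0 hρ0), fun x => ?_⟩
  rw [theta_eq_tprod hτ, norm_mul, mul_assoc]
  refine mul_le_mul_of_nonneg_left ?_ (norm_nonneg _)
  have l1 := (multipliable_thetaFactor hq (expTwoPi x)).hasProd.tendsto_prod_nat.norm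
  have l2 := (tendsto_qPoch hr).norm
  -- Of the first $N+1$ factors of each kind, the factor $1-e(x)$ is split off, which leaves $N$ of
  -- one kind and $N+1$ of the other; this explains the two different shifts.
  have l3 := (((l2.comp (tendsto_add_atTop_nat 0)).mul (l2.comp (tendsto_add_atTop_nat 1))).mul_const
    ‖1 - expTwoPi x‖)
  refine le_of_tendsto_of_tendsto l3 (l1.comp (tendsto_add_atTop_nat 1)) (.of_forall fun N => ?_)
  have hy := norm_expTwoPi_ofReal x
  -- For real $x$ both $e(x)$ and its inverse lie on the unit circle, so each remaining factor is at
  -- least $1-|q|^{i+1}$ in absolute value.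
  have fac : ∀ (i : ℕ) (y : ℂ), ‖y‖ = 1 →
      ‖1 - ((‖q‖ : ℝ) : ℂ) ^ (i + 1)‖ ≤ ‖1 - q ^ (i + 1) * y‖ := by
    intro i y hy
    have h1 : ‖q‖ ^ (i + 1) ≤ 1 := pow_le_one₀ (norm_nonneg q) hq.le
    have : (1 - ((‖q‖ : ℝ) : ℂ) ^ (i + 1)) = ((1 - ‖q‖ ^ (i + 1) : ℝ) : ℂ) := by push_cast; rfl
    rw [this, Complex.norm_real, Real.norm_of_nonneg (by linarith)]
    have := norm_sub_norm_le (1 : ℂ) (q ^ (i + 1) * y)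
    rwa [norm_one, norm_mul, norm_pow, hy, mul_one] at this
  have e : ∏ i ∈ range (N + 1), thetaFactor q (expTwoPi x) i =
      (∏ i ∈ range N, (1 - q ^ (i + 1) * expTwoPi x)) *
        (∏ i ∈ range (N + 1), (1 - q ^ (i + 1) * (expTwoPi x)⁻¹)) * (1 - expTwoPi x) := by
    simp only [thetaFactor]
    rw [prod_mul_distrib, prod_range_succ']
    ring
  simp only [Function.comp_apply, add_zero, qPoch]
  rw [e, norm_mul, norm_mul]
  refine mul_le_mul_of_nonneg_right (mul_le_mul ?_ ?_ (norm_nonneg _) (norm_nonneg _))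
    (norm_nonneg _)
  · rw [norm_prod, norm_prod]
    exact prod_le_prod (fun _ _ => norm_nonneg _) fun i _ => fac i _ hy
  · rw [norm_prod, norm_prod]
    exact prod_le_prod (fun _ _ => norm_nonneg _) fun i _ => fac i _ (by rw [norm_inv, hy, inv_one])

/-- Along the real axis $|\theta(x)|\ge c\,|1-e(x)|$, and $1-e(x)$ has nonzero derivative at $0$.
Difference quotients of $\theta$ thus stay away from zero, and no infinite product has to be
differentiated. -/
theorem deriv_theta_zero_ne_zero (hτ : 0 < τ.im) : deriv (theta τ) 0 ≠ 0 := by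
  intro h0
  obtain ⟨c, hc, hb⟩ := exists_lower_bound_theta hτ
  have h1 : HasDerivAt (theta τ) (deriv (theta τ) 0) 0 := (differentiable_theta hτ 0).hasDerivAt
  have h2 : HasDerivAt (fun z : ℂ => 1 - expTwoPi z) (-(2 * Real.pi * I)) 0 := by
    have : HasDerivAt (fun z : ℂ => 2 * Real.pi * I * z) (2 * Real.pi * I) 0 := by
      simpa using (hasDerivAt_id (0 : ℂ)).const_mul (2 * Real.pi * I)
    simpa [expTwoPi] using this.cexp.const_sub 1
  rw [h0] at h1
  have hr : Tendsto (fun x : ℝ => (x : ℂ)) (𝓝[≠] 0) (𝓝[≠] 0) := by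
    refine tendsto_nhdsWithin_iff.2 ⟨?_, ?_⟩
    · exact (Complex.continuous_ofReal.tendsto' 0 0 (by simp)).mono_left nhdsWithin_le_nhds
    · filter_upwards [self_mem_nhdsWithin] with x hx
      simpa using hx
  have l1 := ((hasDerivAt_iff_tendsto_slope_zero.1 h1).comp hr).norm
  have l2 := (((hasDerivAt_iff_tendsto_slope_zero.1 h2).comp hr).norm).const_mul c
  have := le_of_tendsto_of_tendsto l2 l1 (.of_forall fun x => ?_)
  · rw [norm_zero, norm_neg] at this
    have h3 : 0 < ‖(2 * Real.pi * I : ℂ)‖ := norm_pos_iff.2 Complex.two_pi_I_ne_zero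
    exact absurd this (not_le.2 (mul_pos hc h3))
  · have e : (1 : ℂ) - expTwoPi 0 = 0 := by simp [expTwoPi]
    simp only [Function.comp_apply, zero_add, theta_zero hτ, e, sub_zero, norm_smul]
    rw [mul_left_comm]
    exact mul_le_mul_of_nonneg_left (hb x) (norm_nonneg _)

/-- The reflection $\alpha\mapsto1-\alpha$ preserves $\alpha(\alpha-1)$ and changes the sign
$(-1)^\alpha$. -/
theorem theta_neg (τ z : ℂ) : theta τ (-z) = -(expTwoPi (-z) * theta τ z) := by
  rw [theta_eq_tsum, theta_eq_tsum, ← tsum_mul_left, ← tsum_neg,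
    ← (Equiv.subLeft (1 : ℤ)).tsum_eq]
  refine tsum_congr fun α => ?_
  have h0 := expTwoPi_ne_zero z
  have e : (1 - α) * (1 - α - 1) = α * (α - 1) := by ring
  have s : (-1 : ℂ) ^ (1 - α) = -(-1) ^ α := by
    rw [zpow_sub₀ (by norm_num), zpow_one, div_eq_mul_inv, ← inv_zpow]
    norm_num
  simp only [Equiv.subLeft_apply, thetaCoeff, e, s, expTwoPi_neg]
  rw [inv_zpow, ← zpow_neg, show -(1 - α) = α - 1 by ring, zpow_sub_one₀ h0]
  ring

theorem theta_add_tau (τ z : ℂ) :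
    theta τ (z + τ) = -(expTwoPi (-z) * theta τ z) := by
  have hq := expTwoPi_ne_zero τ
  have h0 := expTwoPi_ne_zero z
  rw [theta_eq_tsum, theta_eq_tsum, ← tsum_mul_left, ← tsum_neg,
    ← (Equiv.addRight (1 : ℤ)).tsum_eq (fun α => -(expTwoPi (-z) * _))]
  refine tsum_congr fun α => ?_
  rw [Equiv.coe_addRight, thetaCoeff_succ hq, expTwoPi_add, mul_zpow, expTwoPi_neg,
    zpow_add_one₀ h0]
  field_simp

/-- Multiplication of the period by `n`. -/
theorem exists_prod_theta_eq (hτ : 0 < τ.im) (n : ℕ) (hn : 0 < n) :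
    ∃ C : ℂ, C ≠ 0 ∧ ∀ w, ∏ s ∈ range n, theta τ (w + s / n) = C * theta (n * τ) (n * w) := by
  have hn' : (n : ℂ) ≠ 0 := by exact_mod_cast hn.ne'
  have hnτ : 0 < ((n : ℂ) * τ).im := by
    have : 0 < (n : ℝ) := by exact_mod_cast hn
    simpa using mul_pos this hτ
  have hq := norm_expTwoPi_lt_one hτ
  have hq' := norm_expTwoPi_lt_one hnτ
  have d := tprod_one_sub_pow_ne_zero hq
  have d' := tprod_one_sub_pow_ne_zero hq'
  set D := ∏' i : ℕ, (1 - expTwoPi τ ^ (i + 1))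
  set D' := ∏' i : ℕ, (1 - expTwoPi (n * τ) ^ (i + 1))
  refine ⟨D ^ n * D'⁻¹, mul_ne_zero (pow_ne_zero n d) (inv_ne_zero d'), fun w => ?_⟩
  have hprim : IsPrimitiveRoot (expTwoPi (1 / n)) n := by
    have := Complex.isPrimitiveRoot_exp n hn.ne'
    rwa [show expTwoPi (1 / n) = Complex.exp (2 * Real.pi * I / n) by
      rw [expTwoPi, mul_one_div]]
  -- The numbers $e(s/n)$ run through the $n$-th roots of unity, so the product over $s$ turns each
  -- factor in $q,y$ into the same factor in $q^n,y^n$. Only the prefactors differ, and they make up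
  -- the constant.
  have key : ∀ {ζ : ℂ}, IsPrimitiveRoot ζ n → ∀ t : ℂ,
      ∏ s ∈ range n, (1 - t * ζ ^ s) = 1 - t ^ n := by
    intro ζ hζ t
    rw [← one_pow n, hζ.pow_sub_pow_eq_prod_sub_mul 1 t hn, one_pow]
    refine prod_nbij (fun s => ζ ^ s) (fun s _ => ?_) (fun s hs r hr h => ?_) (fun x hx => ?_)
      (fun s _ => by rw [mul_comm])
    · rw [Polynomial.mem_nthRootsFinset hn, ← pow_mul, mul_comm, pow_mul, hζ.pow_eq_one, one_pow]
    · exact hζ.pow_inj (mem_range.1 hs) (mem_range.1 hr) h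
    · have : NeZero n := ⟨hn.ne'⟩
      obtain ⟨i, hi, e⟩ := hζ.eq_pow_of_pow_eq_one
        ((Polynomial.mem_nthRootsFinset hn _).1 (mem_coe.1 hx))
      exact ⟨i, by simpa using hi, e⟩
  have e0 : ∏ s ∈ range n, theta τ (w + s / n) =
      ∏ s ∈ range n, (D * ∏' m, thetaFactor (expTwoPi τ) (expTwoPi (w + s / n)) m) :=
    prod_congr rfl fun s _ => theta_eq_tprod hτ _
  rw [e0, theta_eq_tprod hnτ, prod_mul_distrib, prod_const, card_range,
    ← Multipliable.tprod_finsetProd fun s _ => multipliable_thetaFactor hq _]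
  rw [mul_assoc, inv_mul_cancel_left₀ d']
  congr 1
  refine tprod_congr fun m => ?_
  simp only [thetaFactor]
  rw [prod_mul_distrib, expTwoPi_nat_mul, expTwoPi_nat_mul, ← inv_pow, ← pow_mul, ← pow_mul,
    mul_comm n m, mul_comm n (m + 1), pow_mul, pow_mul, ← mul_pow, ← mul_pow, ← key hprim,
    ← key hprim.inv]
  have e : ∀ s : ℕ, expTwoPi (w + s / n) = expTwoPi w * expTwoPi (1 / n) ^ s := by
    intro s
    rw [expTwoPi_add, ← expTwoPi_nat_mul, mul_one_div]
  simp only [e, mul_inv, inv_pow, mul_assoc]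

end ThetaZeros

/-! ### The addition formula, and theta functions with characteristics -/

section ThetaAddition

open Finset Filter Topology Complex

variable {τ : ℂ}

/-- Pairs of integers, by the parity of the sum: `(a + b, a - b)` and `(a + b + 1, a - b)`. -/
def paritySplit : (ℤ × ℤ) ⊕ (ℤ × ℤ) ≃ ℤ × ℤ :=
  Equiv.ofBijective
    (Sum.elim (fun p => (p.1 + p.2, p.1 - p.2)) fun p => (p.1 + p.2 + 1, p.1 - p.2)) <| by
    constructor
    · rintro (⟨a, b⟩ | ⟨a, b⟩) (⟨c, d⟩ | ⟨c, d⟩) h <;>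
        simp only [Sum.elim_inl, Sum.elim_inr, Prod.mk.injEq, Sum.inl.injEq, Sum.inr.injEq,
          reduceCtorEq] at h ⊢ <;> omega
    · rintro ⟨a, b⟩
      rcases Int.even_or_odd' (a + b) with ⟨m, h | h⟩
      · exact ⟨.inl (m, a - m), by simp only [Sum.elim_inl, Prod.mk.injEq]; omega⟩
      · exact ⟨.inr (m, a - m - 1), by simp only [Sum.elim_inr, Prod.mk.injEq]; omega⟩

theorem paritySplit_inl (a b : ℤ) : paritySplit (.inl (a, b)) = (a + b, a - b) := rfl

theorem paritySplit_inr (a b : ℤ) : paritySplit (.inr (a, b)) = (a + b + 1, a - b) := rfl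

/-- In the double series substitute $(a+b,a-b)$ or $(a+b+1,a-b)$ according to parity. As
$(a+b)^2+(a-b)^2=2a^2+2b^2$, the variables separate and the period doubles. -/
theorem theta_add_mul_theta_sub (hτ : 0 < τ.im) (x y : ℂ) :
    theta τ (x + y) * theta τ (x - y) =
      jacobiTheta₂ (2 * x - τ) (2 * τ) * jacobiTheta₂ (2 * y) (2 * τ) -
      expTwoPi (x + y) * (jacobiTheta₂ (2 * x) (2 * τ) * jacobiTheta₂ (2 * y + τ) (2 * τ)) := by
  have h2 : 0 < (2 * τ).im := by simpa using hτ
  have sJ : ∀ z, Summable fun a => ‖jacobiTheta₂_term a z (2 * τ)‖ := fun z =>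
    ((summable_jacobiTheta₂_term_iff z (2 * τ)).2 h2).norm
  have sT : ∀ z, Summable fun a => ‖jacobiTheta₂_term a (z + 1 / 2 - τ / 2) τ‖ := fun z =>
    ((summable_jacobiTheta₂_term_iff _ τ).2 hτ).norm
  have p1 := (summable_mul_of_summable_norm (sJ (2 * x - τ)) (sJ (2 * y))).hasSum
  have p2 := ((summable_mul_of_summable_norm (sJ (2 * x)) (sJ (2 * y + τ))).hasSum).mul_left
    (-expTwoPi (x + y))
  rw [theta_eq_jacobiTheta₂, theta_eq_jacobiTheta₂, jacobiTheta₂, jacobiTheta₂,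
    tsum_mul_tsum_of_summable_norm (sT _) (sT _), ← paritySplit.tsum_eq, sub_eq_add_neg (_ * _),
    ← neg_mul]
  simp only [jacobiTheta₂]
  rw [tsum_mul_tsum_of_summable_norm (sJ _) (sJ _), tsum_mul_tsum_of_summable_norm (sJ _) (sJ _)]
  refine (HasSum.sum (p1.congr_fun ?_) (p2.congr_fun ?_)).tsum_eq
  · rintro ⟨a, b⟩
    simp only [Function.comp_apply, paritySplit_inl,
      jacobiTheta₂_term, ← Complex.exp_add]
    refine Complex.exp_eq_exp_iff_exists_int.2 ⟨a, ?_⟩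
    push_cast
    ring
  · rintro ⟨a, b⟩
    have e : -expTwoPi (x + y) = Complex.exp (Real.pi * I + 2 * Real.pi * I * (x + y)) := by
      rw [Complex.exp_add, Complex.exp_pi_mul_I, expTwoPi]; ring
    simp only [Function.comp_apply, paritySplit_inr,
      jacobiTheta₂_term, e, ← Complex.exp_add]
    refine Complex.exp_eq_exp_iff_exists_int.2 ⟨a, ?_⟩
    push_cast
    ring

/-- The addition formula for `θ`. -/
theorem exists_theta_add_mul_sub (hτ : 0 < τ.im) :
    ∃ A B : ℂ → ℂ, ∀ x y, theta τ (x + y) * theta τ (x - y) =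
      expTwoPi x * (A x * B y - B x * A y) := by
  -- The arguments $2x-\tau$ and $2x+\tau$ differ by the period $2\tau$, so quasi-periodicity gives
  -- both products the same pair of functions $A,B$ and makes the difference antisymmetric.
  refine ⟨fun x => expTwoPi x * jacobiTheta₂ (2 * x + τ) (2 * τ),
    fun x => jacobiTheta₂ (2 * x) (2 * τ), fun x y => ?_⟩
  have h := jacobiTheta₂_add_left' (2 * x - τ) (2 * τ)
  have e : Complex.exp (-Real.pi * I * (2 * τ + 2 * (2 * x - τ))) = (expTwoPi x * expTwoPi x)⁻¹ := by
    rw [← expTwoPi_add, ← expTwoPi_neg, expTwoPi]; congr 1; ring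
  rw [show 2 * x - τ + 2 * τ = 2 * x + τ by ring, e] at h
  have h0 := expTwoPi_ne_zero x
  rw [theta_add_mul_theta_sub hτ, expTwoPi_add]
  beta_reduce
  rw [h]
  field_simp

variable (n : ℕ) [NeZero n]

theorem natCast_mul_im_pos (hτ : 0 < τ.im) : 0 < ((n : ℂ) * τ).im := by
  have : 0 < (n : ℝ) := by exact_mod_cast Nat.pos_of_neZero n
  simpa using mul_pos this hτ

/-- A theta function with characteristics in terms of the theta function with `n`-fold period. -/
theorem exists_thetaChar_eq (hτ : 0 < τ.im) :
    ∃ C : ℂ, C ≠ 0 ∧ ∀ (α : ℤ) (z : ℂ), thetaChar n τ α z = C * theta (n * τ) (n * z + α * τ) *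
      Complex.exp (Real.pi * I * ((2 * α - n) * z - α / n + (α * (α - n) : ℂ) / n * τ)) := by
  have hn : (n : ℂ) ≠ 0 := NeZero.ne _
  obtain ⟨C, hC, h⟩ := exists_prod_theta_eq hτ n (Nat.pos_of_neZero n)
  refine ⟨C, hC, fun α z => ?_⟩
  have e : (n * z + α * τ : ℂ) = n * (z + α / n * τ) := by field_simp
  rw [thetaChar, e, ← h]
  congr 1
  refine prod_congr rfl fun s _ => ?_
  congr 1
  ring

theorem differentiable_thetaChar (hτ : 0 < τ.im) (α : ℤ) : Differentiable ℂ (thetaChar n τ α) := by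
  obtain ⟨C, -, h⟩ := exists_thetaChar_eq n hτ
  have hd := differentiable_theta (natCast_mul_im_pos n hτ)
  rw [show thetaChar n τ α = _ from funext (h α)]
  fun_prop

/-- Raising the characteristic by $n$ translates the argument of the merged theta function by its
full period $n\tau$; the exponential prefactor absorbs the multiplier. -/
theorem thetaChar_add_natCast (hτ : 0 < τ.im) (α : ℤ) (z : ℂ) :
    thetaChar n τ (α + n) z = thetaChar n τ α z := by
  have hn : (n : ℂ) ≠ 0 := NeZero.ne _
  obtain ⟨C, -, h⟩ := exists_thetaChar_eq n hτ
  have e : (n * z + ((α + n : ℤ) : ℂ) * τ : ℂ) = n * z + α * τ + n * τ := by push_cast; ring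
  have e2 : -expTwoPi (-(n * z + α * τ)) =
      Complex.exp (Real.pi * I + 2 * Real.pi * I * (-(n * z + α * τ))) := by
    rw [Complex.exp_add, Complex.exp_pi_mul_I, expTwoPi]; ring
  have e3 : -expTwoPi (-(n * z + α * τ)) * Complex.exp (Real.pi * I * ((2 * (α + n : ℤ) - n) * z -
      (α + n : ℤ) / n + ((α + n : ℤ) * ((α + n : ℤ) - n) : ℂ) / n * τ)) =
      Complex.exp (Real.pi * I * ((2 * α - n) * z - α / n + (α * (α - n) : ℂ) / n * τ)) := by
    rw [e2, ← Complex.exp_add]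
    congr 1
    push_cast
    field_simp
    ring
  rw [h, h, e, theta_add_tau, ← e3]
  ring

theorem thetaChar_add_mul_natCast (hτ : 0 < τ.im) (α m : ℤ) (z : ℂ) :
    thetaChar n τ (α + m * n) z = thetaChar n τ α z := by
  induction m using Int.induction_on with
  | zero => simp
  | succ m ih => rw [← ih, ← thetaChar_add_natCast n hτ (α + m * n)]; congr 1; ring
  | pred m ih =>
    rw [← ih, ← thetaChar_add_natCast n hτ (α + (-m - 1) * n)]; congr 1; ring

theorem thetaChar_eq_shift (α : ℤ) (z : ℂ) : thetaChar n τ α z =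
    Complex.exp (Real.pi * I * (2 * α * z - α / n + α ^ 2 / n * τ)) *
      thetaChar n τ 0 (z + α / n * τ) := by
  have hn : (n : ℂ) ≠ 0 := NeZero.ne _
  rw [thetaChar, thetaChar, mul_left_comm, ← Complex.exp_add]
  congr 1
  · refine prod_congr rfl fun s _ => ?_
    congr 1
    push_cast
    ring
  · congr 1
    push_cast
    field_simp
    ring

/-- The factor $e^{-\pi inz}$ is exactly the square root of the multiplier in the reflection formula
for $\theta$, so $\theta_0$ is odd. -/
theorem thetaChar_zero_neg (hτ : 0 < τ.im) (z : ℂ) :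
    thetaChar n τ 0 (-z) = -thetaChar n τ 0 z := by
  obtain ⟨C, -, h⟩ := exists_thetaChar_eq n hτ
  have e : (n * -z + ((0 : ℤ) : ℂ) * τ : ℂ) = -(n * z + ((0 : ℤ) : ℂ) * τ) := by push_cast; ring
  rw [h, h, e, theta_neg, expTwoPi, mul_neg, neg_mul, mul_comm (Complex.exp _), ← mul_assoc,
    mul_assoc _ (Complex.exp _), ← Complex.exp_add]
  congr 3
  push_cast
  ring

theorem thetaChar_zero_zero (hτ : 0 < τ.im) : thetaChar n τ 0 0 = 0 := by
  have := thetaChar_zero_neg n hτ 0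
  rw [neg_zero] at this
  exact self_eq_neg.1 this

/-- The relevant point is $\alpha\tau$ and the period lattice is $\mathbb Z+n\tau\mathbb Z$;
comparing imaginary parts, membership forces $n\mid\alpha$. -/
theorem thetaChar_apply_zero_ne_zero (hτ : 0 < τ.im) {α : ℤ} (hα : ¬ (n : ℤ) ∣ α) :
    thetaChar n τ α 0 ≠ 0 := by
  obtain ⟨C, hC, h⟩ := exists_thetaChar_eq n hτ
  rw [h]
  refine mul_ne_zero (mul_ne_zero hC (theta_ne_zero (natCast_mul_im_pos n hτ) fun a b e => ?_))
    (Complex.exp_ne_zero _)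
  refine hα ⟨b, ?_⟩
  have := congrArg Complex.im e
  simp at this
  rw [← mul_assoc, mul_comm (b : ℝ)] at this
  exact_mod_cast mul_right_cancel₀ hτ.ne' this

theorem deriv_thetaChar_zero_ne_zero (hτ : 0 < τ.im) : deriv (thetaChar n τ 0) 0 ≠ 0 := by
  have hn : (n : ℂ) ≠ 0 := NeZero.ne _
  obtain ⟨C, hC, h⟩ := exists_thetaChar_eq n hτ
  have hT := natCast_mul_im_pos n hτ
  have d1 : HasDerivAt (theta (n * τ)) (deriv (theta (n * τ)) 0) (n * 0) := by
    rw [mul_zero]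
    exact (differentiable_theta hT 0).hasDerivAt
  have d2 := (d1.comp (0 : ℂ) ((hasDerivAt_id (0 : ℂ)).const_mul (n : ℂ))).const_mul C
  have d3 : HasDerivAt (fun z : ℂ => Complex.exp (Real.pi * I * (-n * z)))
      (Complex.exp (Real.pi * I * (-n * 0)) * (Real.pi * I * (-n * 1))) 0 :=
    (((hasDerivAt_id (0 : ℂ)).const_mul (-n : ℂ)).const_mul (Real.pi * I)).cexp
  have e : thetaChar n τ 0 = fun z => C * theta (n * τ) (n * z) *
      Complex.exp (Real.pi * I * (-n * z)) := by
    funext z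
    rw [h]
    push_cast
    simp
  have d4 : HasDerivAt (thetaChar n τ 0) _ 0 :=
    (d2.mul d3).congr_of_eventuallyEq (.of_forall fun z => by rw [e]; rfl)
  rw [d4.deriv]
  simp [theta_zero hT, hC, hn, deriv_theta_zero_ne_zero hT]

/-- The addition formula for `θ_0`. -/
theorem exists_thetaChar_add_mul_sub (hτ : 0 < τ.im) :
    ∃ A B : ℂ → ℂ, ∀ x y, thetaChar n τ 0 (x + y) * thetaChar n τ 0 (x - y) =
      A x * B y - B x * A y := by
  obtain ⟨C, -, h⟩ := exists_thetaChar_eq n hτ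
  obtain ⟨A, B, hAB⟩ := exists_theta_add_mul_sub (natCast_mul_im_pos n hτ)
  refine ⟨fun x => C ^ 2 * A (n * x), fun x => B (n * x), fun x y => ?_⟩
  have e : ∀ z, thetaChar n τ 0 z = C * theta (n * τ) (n * z) *
      Complex.exp (Real.pi * I * (-n * z)) := by
    intro z
    rw [h]
    push_cast
    simp
  have e2 : Complex.exp (Real.pi * I * (-n * (x + y))) * Complex.exp (Real.pi * I * (-n * (x - y))) *
      expTwoPi (n * x) = 1 := by
    rw [expTwoPi, ← Complex.exp_add, ← Complex.exp_add, ← Complex.exp_zero]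
    congr 1
    ring
  have := hAB (n * x) (n * y)
  rw [e, e, mul_add, mul_sub]
  linear_combination C ^ 2 * Complex.exp (Real.pi * I * (-n * (x + y))) *
    Complex.exp (Real.pi * I * (-n * (x - y))) * this +
    C ^ 2 * (A (n * x) * B (n * y) - B (n * x) * A (n * y)) * e2

end ThetaAddition

/-! ### Second-order expansions -/

section Jets

open Filter Topology

/-- The expansion `f(ε) = a + bε + cε² + o(ε²)` as `ε → 0`, `ε ≠ 0`. -/
def HasJet (f : ℂ → ℂ) (a b c : ℂ) : Prop :=
  ∃ s : ℂ → ℂ, Tendsto s (𝓝[≠] 0) (𝓝 c) ∧ ∀ᶠ ε in 𝓝[≠] 0, f ε = a + b * ε + s ε * ε ^ 2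

variable {f g : ℂ → ℂ} {a b c a' b' c' : ℂ}

theorem tendsto_id_punctured : Tendsto (fun ε : ℂ => ε) (𝓝[≠] 0) (𝓝 0) := nhdsWithin_le_nhds

theorem HasJet.congr (hf : HasJet f a b c) (h : ∀ᶠ ε in 𝓝[≠] 0, g ε = f ε) : HasJet g a b c := by
  obtain ⟨s, hs, e⟩ := hf
  exact ⟨s, hs, by filter_upwards [e, h] with ε h1 h2; rw [h2, h1]⟩

theorem hasJet_const (a : ℂ) : HasJet (fun _ => a) a 0 0 :=
  ⟨fun _ => 0, tendsto_const_nhds, .of_forall fun ε => by ring⟩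

theorem hasJet_id : HasJet (fun ε => ε) 0 1 0 :=
  ⟨fun _ => 0, tendsto_const_nhds, .of_forall fun ε => by ring⟩

theorem HasJet.tendsto (hf : HasJet f a b c) : Tendsto f (𝓝[≠] 0) (𝓝 a) := by
  obtain ⟨s, hs, e⟩ := hf
  have h := tendsto_id_punctured
  have := (tendsto_const_nhds (x := a)).add ((h.const_mul b).add (hs.mul (h.pow 2)))
  rw [mul_zero, zero_pow two_ne_zero, mul_zero, add_zero, add_zero] at this
  exact this.congr' (by filter_upwards [e] with ε h1; rw [h1, add_assoc])

theorem HasJet.add (hf : HasJet f a b c) (hg : HasJet g a' b' c') :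
    HasJet (fun ε => f ε + g ε) (a + a') (b + b') (c + c') := by
  obtain ⟨s, hs, e⟩ := hf
  obtain ⟨s', hs', e'⟩ := hg
  refine ⟨fun ε => s ε + s' ε, hs.add hs', ?_⟩
  filter_upwards [e, e'] with ε h1 h2
  rw [h1, h2]
  ring

theorem HasJet.mul (hf : HasJet f a b c) (hg : HasJet g a' b' c') :
    HasJet (fun ε => f ε * g ε) (a * a') (a * b' + b * a') (a * c' + b * b' + c * a') := by
  obtain ⟨s, hs, e⟩ := hf
  obtain ⟨s', hs', e'⟩ := hg
  have h := tendsto_id_punctured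
  refine ⟨fun ε => a * s' ε + b * b' + s ε * a' + (b * s' ε + s ε * b') * ε + s ε * s' ε * ε ^ 2,
    ?_, ?_⟩
  · have := ((((hs'.const_mul a).add_const (b * b')).add (hs.mul_const a')).add
      (((hs'.const_mul b).add (hs.mul_const b')).mul h)).add ((hs.mul hs').mul (h.pow 2))
    simpa using this
  · filter_upwards [e, e'] with ε h1 h2
    rw [h1, h2]
    ring

theorem HasJet.eventually_ne_zero (hf : HasJet f a b c) (ha : a ≠ 0) : ∀ᶠ ε in 𝓝[≠] 0, f ε ≠ 0 :=
  hf.tendsto.eventually_ne ha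

theorem HasJet.inv (hf : HasJet f a b c) (ha : a ≠ 0) :
    HasJet (fun ε => (f ε)⁻¹) a⁻¹ (-b / a ^ 2) ((b ^ 2 - a * c) / a ^ 3) := by
  have h0 := hf.eventually_ne_zero ha
  have ht := hf.tendsto
  obtain ⟨s, hs, e⟩ := hf
  have h := tendsto_id_punctured
  refine ⟨fun ε => (b ^ 2 - a * s ε + b * s ε * ε) / (a ^ 2 * f ε), ?_, ?_⟩
  · have := (((hs.const_mul a).const_sub (b ^ 2)).add ((hs.const_mul b).mul h)).div
      (ht.const_mul (a ^ 2)) (mul_ne_zero (pow_ne_zero 2 ha) ha)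
    simpa [pow_succ, Pi.div_def] using this
  · filter_upwards [e, h0] with ε h1 h2
    field_simp
    rw [h1]
    ring

theorem HasJet.eq_zero (hf : HasJet f a b c) (h0 : ∀ᶠ ε in 𝓝[≠] 0, f ε = 0) :
    a = 0 ∧ b = 0 ∧ c = 0 := by
  have ha : a = 0 := tendsto_nhds_unique hf.tendsto
    (tendsto_const_nhds.congr' (by filter_upwards [h0] with ε h; exact h.symm))
  obtain ⟨s, hs, e⟩ := hf
  have hne : ∀ᶠ ε : ℂ in 𝓝[≠] 0, ε ≠ 0 := self_mem_nhdsWithin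
  have hb : b = 0 := by
    have l := (hs.mul tendsto_id_punctured).const_add b
    rw [mul_zero, add_zero] at l
    refine tendsto_nhds_unique l (tendsto_const_nhds.congr' ?_)
    filter_upwards [h0, e, hne] with ε h1 h2 h3
    rw [h1, ha] at h2
    exact mul_left_cancel₀ h3 (by linear_combination h2)
  refine ⟨ha, hb, tendsto_nhds_unique hs (tendsto_const_nhds.congr' ?_)⟩
  filter_upwards [h0, e, hne] with ε h1 h2 h3
  rw [h1, ha, hb] at h2
  exact mul_right_cancel₀ (pow_ne_zero 2 h3) (by linear_combination h2)

theorem HasJet.unique (hf : HasJet f a b c) (hf' : HasJet f a' b' c') :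
    a = a' ∧ b = b' ∧ c = c' := by
  have h := (hf.add ((hasJet_const (-1)).mul hf')).eq_zero (.of_forall fun ε => by ring)
  exact ⟨by linear_combination h.1, by linear_combination h.2.1, by linear_combination h.2.2⟩

theorem HasJet.comp_mul (hf : HasJet f a b c) {x : ℂ} (hx : x ≠ 0) :
    HasJet (fun ε => f (x * ε)) a (b * x) (c * x ^ 2) := by
  obtain ⟨s, hs, e⟩ := hf
  have h : Tendsto (fun ε : ℂ => x * ε) (𝓝[≠] 0) (𝓝[≠] 0) := by
    refine tendsto_nhdsWithin_iff.2 ⟨?_, ?_⟩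
    · simpa using tendsto_id_punctured.const_mul x
    · filter_upwards [self_mem_nhdsWithin] with ε hε
      exact mul_ne_zero hx hε
  refine ⟨fun ε => s (x * ε) * x ^ 2, (hs.comp h).mul_const _, ?_⟩
  filter_upwards [h.eventually e] with ε h1
  rw [h1]
  ring

theorem differentiable_dslope (hf : Differentiable ℂ f) : Differentiable ℂ (dslope f 0) := by
  rw [← differentiableOn_univ] at hf ⊢
  exact (Complex.differentiableOn_dslope Filter.univ_mem).2 hf

theorem eq_add_mul_dslope (f : ℂ → ℂ) (z : ℂ) : f z = f 0 + z * dslope f 0 z := by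
  have := sub_smul_dslope f 0 z
  rw [sub_zero, smul_eq_mul] at this
  rw [this]
  ring

/-- Divided differences of an entire function are entire (removable singularity), so two of them
supply the remainder; the quadratic coefficient is the derivative of the first. -/
theorem hasJet_of_differentiable (hf : Differentiable ℂ f) :
    HasJet f (f 0) (deriv f 0) (deriv (dslope f 0) 0) := by
  have h1 := differentiable_dslope hf
  have h2 := differentiable_dslope h1
  refine ⟨dslope (dslope f 0) 0, ?_, .of_forall fun z => ?_⟩
  · have := h2.continuous.tendsto 0
    rw [dslope_same] at this
    exact this.mono_left nhdsWithin_le_nhds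
  · rw [eq_add_mul_dslope f z, eq_add_mul_dslope (dslope f 0) z, dslope_same]
    ring

end Jets

/-! ### The Kronecker function -/

section Kronecker

open Filter Topology Complex

/-- The three-term identity for a function with an addition formula. -/
theorem three_term_of_addition {G A B : ℂ → ℂ}
    (hadd : ∀ x y, G (x + y) * G (x - y) = A x * B y - B x * A y) (X Y P Q : ℂ) :
    G (X + P) * G (X + Y + Q) * G Y * G (P + Q) - G (Y + Q) * G (X + P + Q) * G (X + Y) * G P +
      G (X + Y + P + Q) * G (P - Y) * G X * G Q = 0 := by
  -- The Plücker relation between the six $2\times2$ minors of the four vectors $(A,B)$ at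
  -- $a,b,c,d$.
  have h := fun a b c d : ℂ => show
      (G (a + d) * G (a - d)) * (G (b + c) * G (b - c)) -
      (G (b + d) * G (b - d)) * (G (a + c) * G (a - c)) +
      (G (a + b) * G (a - b)) * (G (c + d) * G (c - d)) = 0 by
    simp only [hadd]; ring
  -- The four points are solved for from $a+d=X+P$, $a-d=X+Y+Q$, $b+c=P+Q$, $b-c=Y$; the other sums
  -- and differences then come out as required.
  have := h (X + (Y + P + Q) / 2) ((Y + P + Q) / 2) ((Q + P - Y) / 2) ((P - Y - Q) / 2)
  ring_nf at this ⊢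
  linear_combination this

/-- The associative Yang-Baxter equation for the Kronecker function of an odd function with an
addition formula. -/
theorem kronecker_of_addition {G A B : ℂ → ℂ} (hodd : ∀ z, G (-z) = -G z)
    (hadd : ∀ x y, G (x + y) * G (x - y) = A x * B y - B x * A y) {X Y Z P Q S : ℂ}
    (hXYZ : X + Y + Z = 0) (hPQS : P + Q + S = 0) (hX : G X ≠ 0) (hY : G Y ≠ 0) (hZ : G Z ≠ 0)
    (hP : G P ≠ 0) (hQ : G Q ≠ 0) (hS : G S ≠ 0) :
    G (X + P) / (G X * G P) * (G (-Z + Q) / (G (-Z) * G Q)) +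
    G (Y + Q) / (G Y * G Q) * (G (-X + S) / (G (-X) * G S)) +
    G (Z + S) / (G Z * G S) * (G (-Y + P) / (G (-Y) * G P)) = 0 := by
  obtain rfl : Z = -(X + Y) := by linear_combination hXYZ
  obtain rfl : S = -(P + Q) := by linear_combination hPQS
  have h := three_term_of_addition hadd X Y P Q
  rw [show -(-(X + Y)) + Q = X + Y + Q by ring, show -X + -(P + Q) = -(X + P + Q) by ring,
    show -(X + Y) + -(P + Q) = -(X + Y + P + Q) by ring, show -Y + P = P - Y by ring]
  rw [hodd] at hZ hS
  simp only [hodd, neg_neg] at hZ hS ⊢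
  rw [neg_ne_zero] at hZ hS
  field_simp
  linear_combination h

variable (n : ℕ) [NeZero n] (τ : ℂ)

/-- The theta function with characteristic `α ∈ ℤ/n`. -/
def thFun (α : ZMod n) : ℂ → ℂ := thetaChar n τ α.val

variable {τ}

theorem thetaChar_eq_thFun (hτ : 0 < τ.im) (a : ℤ) : thetaChar n τ a = thFun n τ (a : ZMod n) := by
  funext z
  have h : ((a : ZMod n).val : ℤ) = a % n := ZMod.val_intCast a
  rw [thFun, h, ← thetaChar_add_mul_natCast n hτ (a % n) (a / n), mul_comm (a / n),
    Int.emod_add_mul_ediv]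

theorem thFun_zero : thFun n τ 0 = thetaChar n τ 0 := by simp [thFun]

/-- The Kronecker function `θ_0'(0) θ_{α+β}(x+y) / (θ_α(x) θ_β(y))`. -/
def kron (α β : ZMod n) (x y : ℂ) : ℂ :=
  thD n τ 0 * thFun n τ (α + β) (x + y) / (thFun n τ α x * thFun n τ β y)

theorem thFun_intCast (hτ : 0 < τ.im) (a : ℤ) (z : ℂ) : thFun n τ a z =
    Complex.exp (Real.pi * I * (2 * a * z - a / n + a ^ 2 / n * τ)) * thFun n τ 0 (z + a / n * τ) := by
  rw [← thetaChar_eq_thFun n hτ, thetaChar_eq_shift, thFun_zero]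

/-- The characteristics translate the arguments by $a\tau/n$ and $b\tau/n$. Of the quadratic
exponents only the polarization survives in the quotient, a bilinear form in $(x,a)$ and $(y,b)$. -/
theorem kron_intCast (hτ : 0 < τ.im) (a b : ℤ) (x y : ℂ) : kron n (τ := τ) a b x y =
    thD n τ 0 * expTwoPi (a * y + b * x + a * b / n * τ) *
      (thFun n τ 0 ((x + a / n * τ) + (y + b / n * τ)) /
        (thFun n τ 0 (x + a / n * τ) * thFun n τ 0 (y + b / n * τ))) := by
  have e : Complex.exp (Real.pi * I * (2 * (a + b : ℤ) * (x + y) - (a + b : ℤ) / n +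
      (a + b : ℤ) ^ 2 / n * τ)) = expTwoPi (a * y + b * x + a * b / n * τ) *
      (Complex.exp (Real.pi * I * (2 * a * x - a / n + a ^ 2 / n * τ)) *
      Complex.exp (Real.pi * I * (2 * b * y - b / n + b ^ 2 / n * τ))) := by
    rw [expTwoPi, ← Complex.exp_add, ← Complex.exp_add]
    congr 1
    push_cast
    ring
  have e2 : (x + y) + ((a + b : ℤ) : ℂ) / n * τ = (x + a / n * τ) + (y + b / n * τ) := by
    push_cast; ring
  rw [kron, ← Int.cast_add, thFun_intCast n hτ, thFun_intCast n hτ, thFun_intCast n hτ, e, e2]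
  have h1 := Complex.exp_ne_zero (Real.pi * I * (2 * a * x - a / n + a ^ 2 / n * τ))
  have h2 := Complex.exp_ne_zero (Real.pi * I * (2 * b * y - b / n + b ^ 2 / n * τ))
  generalize Complex.exp (Real.pi * I * (2 * a * x - a / n + a ^ 2 / n * τ)) = E1 at *
  generalize Complex.exp (Real.pi * I * (2 * b * y - b / n + b ^ 2 / n * τ)) = E2 at *
  field_simp

theorem thFun_zero_neg (hτ : 0 < τ.im) (z : ℂ) : thFun n τ 0 (-z) = -thFun n τ 0 z := by
  simpa [thFun_zero] using thetaChar_zero_neg n hτ z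

theorem kron_comm (α β : ZMod n) (x y : ℂ) : kron n (τ := τ) α β x y = kron n (τ := τ) β α y x := by
  rw [kron, kron, add_comm α, add_comm x, mul_comm (thFun n τ α x)]

theorem kron_neg (hτ : 0 < τ.im) (α β : ZMod n) (x y : ℂ) :
    kron n (τ := τ) (-α) (-β) (-x) (-y) = -kron n (τ := τ) α β x y := by
  obtain ⟨a, rfl⟩ := ZMod.intCast_surjective α
  obtain ⟨b, rfl⟩ := ZMod.intCast_surjective β
  rw [← Int.cast_neg, ← Int.cast_neg, kron_intCast n hτ, kron_intCast n hτ]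
  rw [show -x + ((-a : ℤ) : ℂ) / n * τ = -(x + a / n * τ) by push_cast; ring,
    show -y + ((-b : ℤ) : ℂ) / n * τ = -(y + b / n * τ) by push_cast; ring, ← neg_add,
    thFun_zero_neg n hτ, thFun_zero_neg n hτ, thFun_zero_neg n hτ, neg_mul_neg, neg_div, mul_neg]
  congr 4
  push_cast
  ring

/-- For the translated arguments this is the equation for the odd function $\theta_0$. The three
products carry the same exponential, because for a bilinear form $\langle\cdot,\cdot\rangle$ the
sums $\langle X,P\rangle-\langle Z,Q\rangle$, $\langle Y,Q\rangle-\langle X,S\rangle$, $\langle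
Z,S\rangle-\langle Y,P\rangle$ agree when $X+Y+Z=P+Q+S=0$. -/
theorem kron_yang_baxter (hτ : 0 < τ.im) {X Y Z P Q S : ZMod n} {x y z p q s : ℂ}
    (hXYZ : X + Y + Z = 0) (hPQS : P + Q + S = 0) (hxyz : x + y + z = 0) (hpqs : p + q + s = 0)
    (hX : thFun n τ X x ≠ 0) (hY : thFun n τ Y y ≠ 0) (hZ : thFun n τ Z z ≠ 0)
    (hP : thFun n τ P p ≠ 0) (hQ : thFun n τ Q q ≠ 0) (hS : thFun n τ S s ≠ 0) :
    kron n (τ := τ) X P x p * kron n (τ := τ) (-Z) Q (-z) q +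
    kron n (τ := τ) Y Q y q * kron n (τ := τ) (-X) S (-x) s +
    kron n (τ := τ) Z S z s * kron n (τ := τ) (-Y) P (-y) p = 0 := by
  obtain ⟨A, B, hadd⟩ := exists_thetaChar_add_mul_sub n hτ
  rw [← thFun_zero] at hadd
  obtain rfl : Z = -(X + Y) := by linear_combination hXYZ
  obtain rfl : S = -(P + Q) := by linear_combination hPQS
  obtain rfl : z = -(x + y) := by linear_combination hxyz
  obtain rfl : s = -(p + q) := by linear_combination hpqs
  obtain ⟨X, rfl⟩ := ZMod.intCast_surjective X
  obtain ⟨Y, rfl⟩ := ZMod.intCast_surjective Y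
  obtain ⟨P, rfl⟩ := ZMod.intCast_surjective P
  obtain ⟨Q, rfl⟩ := ZMod.intCast_surjective Q
  simp only [← Int.cast_neg, ← Int.cast_add] at *
  rw [thFun_intCast n hτ] at hX hY hZ hP hQ hS
  have h := kronecker_of_addition (thFun_zero_neg n hτ) hadd
    (X := x + X / n * τ) (Y := y + Y / n * τ) (Z := -(x + y) + ((-(X + Y) : ℤ) : ℂ) / n * τ)
    (P := p + P / n * τ) (Q := q + Q / n * τ) (S := -(p + q) + ((-(P + Q) : ℤ) : ℂ) / n * τ)
    (by push_cast; ring) (by push_cast; ring) (right_ne_zero_of_mul hX) (right_ne_zero_of_mul hY)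
    (right_ne_zero_of_mul hZ) (right_ne_zero_of_mul hP) (right_ne_zero_of_mul hQ)
    (right_ne_zero_of_mul hS)
  simp only [kron_intCast n hτ]
  rw [show - -(x + y) + ((- -(X + Y) : ℤ) : ℂ) / n * τ =
      -(-(x + y) + ((-(X + Y) : ℤ) : ℂ) / n * τ) by push_cast; ring,
    show -x + ((-X : ℤ) : ℂ) / n * τ = -(x + X / n * τ) by push_cast; ring,
    show -y + ((-Y : ℤ) : ℂ) / n * τ = -(y + Y / n * τ) by push_cast; ring]
  have e1 : expTwoPi (X * p + P * x + X * P / n * τ) *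
      expTwoPi ((- -(X + Y) : ℤ) * q + Q * - -(x + y) + (- -(X + Y) : ℤ) * Q / n * τ) =
      expTwoPi (Y * q + Q * y + Y * Q / n * τ) *
      expTwoPi ((-X : ℤ) * -(p + q) + (-(P + Q) : ℤ) * -x + (-X : ℤ) * (-(P + Q) : ℤ) / n * τ) := by
    rw [← expTwoPi_add, ← expTwoPi_add]
    congr 1
    push_cast
    ring
  have e2 : expTwoPi (X * p + P * x + X * P / n * τ) *
      expTwoPi ((- -(X + Y) : ℤ) * q + Q * - -(x + y) + (- -(X + Y) : ℤ) * Q / n * τ) =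
      expTwoPi ((-(X + Y) : ℤ) * -(p + q) + (-(P + Q) : ℤ) * -(x + y) +
        (-(X + Y) : ℤ) * (-(P + Q) : ℤ) / n * τ) *
      expTwoPi ((-Y : ℤ) * p + P * -y + (-Y : ℤ) * P / n * τ) := by
    rw [← expTwoPi_add, ← expTwoPi_add]
    congr 1
    push_cast
    ring
  have f : ∀ d a b u v : ℂ, (d * a * u) * (d * b * v) = d ^ 2 * (a * b) * (u * v) := by
    intros; ring
  rw [f, f, f, ← e1, ← e2, ← mul_add, ← mul_add, h, mul_zero]

end Kronecker

/-! ### The coefficients and the quadratic relation between them -/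

section Coefficients

open Filter Topology Complex

variable (n : ℕ) [NeZero n] (τ : ℂ)

/-- The quadratic Taylor coefficient of `θ_α` at zero. -/
def thTwo (α : ZMod n) : ℂ := deriv (dslope (thFun n τ α) 0) 0

/-- The cubic Taylor coefficient of `θ_0` at zero. -/
def thThree : ℂ := deriv (dslope (dslope (thFun n τ 0) 0) 0) 0

/-- The constant term of the Kronecker function at the point `(α, β)`. -/
def kronConst (α β : ZMod n) : ℂ :=
  if α = 0 then (if β = 0 then 0 else thD n τ β / th n τ β)
  else if β = 0 then thD n τ α / th n τ α
  else thD n τ 0 * th n τ (α + β) / (th n τ α * th n τ β)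

/-- The first partial derivative of the Kronecker function at the point `(α, β)`, with the polar
part removed. -/
def kronDeriv (α β : ZMod n) : ℂ :=
  if α = 0 then
    (if β = 0 then 2 * (thThree n τ / thD n τ 0)
    else thTwo n τ β / th n τ β - thThree n τ / thD n τ 0)
  else if β = 0 then 2 * (thTwo n τ α / th n τ α) - (thD n τ α / th n τ α) ^ 2
  else thD n τ 0 * (thD n τ (α + β) / (th n τ α * th n τ β) -
    th n τ (α + β) * thD n τ α / (th n τ α ^ 2 * th n τ β))

/-- The indicator of zero. -/
def atZero (α : ZMod n) : ℂ := if α = 0 then 1 else 0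

variable {τ}

theorem differentiable_thFun (hτ : 0 < τ.im) (α : ZMod n) : Differentiable ℂ (thFun n τ α) :=
  differentiable_thetaChar n hτ _

theorem hasJet_thFun (hτ : 0 < τ.im) (α : ZMod n) :
    HasJet (thFun n τ α) (th n τ α) (thD n τ α) (thTwo n τ α) :=
  hasJet_of_differentiable (differentiable_thFun n hτ α)

theorem th_ne_zero (hτ : 0 < τ.im) {α : ZMod n} (hα : α ≠ 0) : th n τ α ≠ 0 := by
  refine thetaChar_apply_zero_ne_zero n hτ fun h => hα ?_
  have := (ZMod.natCast_eq_zero_iff α.val n).2 (by exact_mod_cast h)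
  rwa [ZMod.natCast_zmod_val] at this

theorem thD_zero_ne_zero (hτ : 0 < τ.im) : thD n τ 0 ≠ 0 := by
  simpa [thD] using deriv_thetaChar_zero_ne_zero n hτ

theorem thFun_zero_eq_mul (hτ : 0 < τ.im) (z : ℂ) :
    thFun n τ 0 z = z * dslope (thFun n τ 0) 0 z := by
  have h : thFun n τ 0 0 = 0 := by rw [thFun_zero]; exact thetaChar_zero_zero n hτ
  conv_lhs => rw [eq_add_mul_dslope (thFun n τ 0) z, h, zero_add]

theorem thTwo_zero (hτ : 0 < τ.im) : thTwo n τ 0 = 0 := by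
  have h := (hasJet_thFun n hτ 0).comp_mul (x := -1) (by norm_num)
  have h2 := ((hasJet_const (-1)).mul (hasJet_thFun n hτ 0)).congr (g := fun ε => thFun n τ 0 (-1 * ε))
    (.of_forall fun ε => by rw [neg_one_mul, neg_one_mul, thFun_zero_neg n hτ])
  have := (h.unique h2).2.2
  linear_combination this / 2

theorem hasJet_dslope_thFun_zero (hτ : 0 < τ.im) :
    HasJet (dslope (thFun n τ 0) 0) (thD n τ 0) 0 (thThree n τ) := by
  have := hasJet_of_differentiable (differentiable_dslope (differentiable_thFun n hτ 0))
  rw [dslope_same, show deriv (dslope (thFun n τ 0) 0) 0 = 0 from thTwo_zero n hτ] at this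
  exact this

theorem eventually_thFun_ne_zero (hτ : 0 < τ.im) (α : ZMod n) {x : ℂ} (hx : x ≠ 0) :
    ∀ᶠ ε in 𝓝[≠] 0, thFun n τ α (x * ε) ≠ 0 := by
  by_cases hα : α = 0
  · subst hα
    have h := ((hasJet_dslope_thFun_zero n hτ).comp_mul hx).eventually_ne_zero
      (thD_zero_ne_zero n hτ)
    filter_upwards [h, self_mem_nhdsWithin] with ε h1 h2
    rw [thFun_zero_eq_mul n hτ]
    exact mul_ne_zero (mul_ne_zero hx h2) h1
  · exact ((hasJet_thFun n hτ α).comp_mul hx).eventually_ne_zero (th_ne_zero n hτ hα)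

/-- The factor $\varepsilon$ cancels the simple pole, since $\theta_0(z)$ is $z$ times a function
that does not vanish at $0$. -/
theorem hasJet_kron_left (hτ : 0 < τ.im) {α : ZMod n} (hα : α ≠ 0) {x y : ℂ} (hx : x ≠ 0) (hy : y ≠ 0)
    (hxy : x + y ≠ 0) : HasJet (fun ε => ε * kron n (τ := τ) α 0 (x * ε) (y * ε))
      (1 / y) (kronConst n τ α 0) (x * kronDeriv n τ α 0 + y * kronDeriv n τ 0 α) := by
  have hb := thD_zero_ne_zero n hτ
  have ha := th_ne_zero n hτ hα
  have j := ((hasJet_const (thD n τ 0 / y)).mul ((hasJet_thFun n hτ α).comp_mul hxy)).mul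
    ((((hasJet_thFun n hτ α).comp_mul hx).mul
      ((hasJet_dslope_thFun_zero n hτ).comp_mul hy)).inv (mul_ne_zero ha hb))
  have j' := j.congr (g := fun ε => ε * kron n (τ := τ) α 0 (x * ε) (y * ε)) (by
    filter_upwards [self_mem_nhdsWithin] with ε hε
    have hε : ε ≠ 0 := hε
    rw [kron, add_zero, thFun_zero_eq_mul n hτ (y * ε), ← add_mul, div_eq_mul_inv, mul_inv, mul_inv,
      mul_inv, mul_inv]
    field_simp)
  convert j' using 1
  · field_simp
  · simp only [kronConst, hα, if_false, if_true]
    field_simp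
    ring
  · simp only [kronDeriv, hα, if_false, if_true]
    field_simp
    ring

theorem hasJet_kron (hτ : 0 < τ.im) (α β : ZMod n) {x y : ℂ} (hx : x ≠ 0) (hy : y ≠ 0)
    (hxy : x + y ≠ 0) : HasJet (fun ε => ε * kron n (τ := τ) α β (x * ε) (y * ε))
      (atZero n α / x + atZero n β / y) (kronConst n τ α β)
      (x * kronDeriv n τ α β + y * kronDeriv n τ β α) := by
  have hb := thD_zero_ne_zero n hτ
  by_cases hα : α = 0 <;> by_cases hβ : β = 0
  · subst hα hβ
    have u := hasJet_dslope_thFun_zero n hτ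
    have j := ((hasJet_const (thD n τ 0 * (x + y) / (x * y))).mul (u.comp_mul hxy)).mul
      (((u.comp_mul hx).mul (u.comp_mul hy)).inv (mul_ne_zero hb hb))
    have j' := j.congr (g := fun ε => ε * kron n (τ := τ) 0 0 (x * ε) (y * ε)) (by
      filter_upwards [self_mem_nhdsWithin] with ε hε
      have hε : ε ≠ 0 := hε
      rw [kron, add_zero, thFun_zero_eq_mul n hτ (y * ε), thFun_zero_eq_mul n hτ (x * ε), ← add_mul,
        thFun_zero_eq_mul n hτ ((x + y) * ε), div_eq_mul_inv, mul_inv, mul_inv,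
        mul_inv, mul_inv, mul_inv, mul_inv]
      field_simp)
    convert j' using 1
    · simp only [atZero, if_true]
      field_simp
      ring
    · simp [kronConst]
    · simp only [kronDeriv, if_true]
      field_simp
      ring
  · subst hα
    have j := hasJet_kron_left n hτ hβ hy hx (by rwa [add_comm])
    simp only [kron_comm n β 0] at j
    convert j using 1
    · simp [atZero, hβ]
    · simp [kronConst, hβ]
    · ring
  · subst hβ
    have j := hasJet_kron_left n hτ hα hx hy hxy
    convert j using 1
    simp [atZero, hα]
  · have ha := th_ne_zero n hτ hα
    have ha' := th_ne_zero n hτ hβ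
    have j := (hasJet_id.mul ((hasJet_const (thD n τ 0)).mul ((hasJet_thFun n hτ (α + β)).comp_mul hxy))).mul
      ((((hasJet_thFun n hτ α).comp_mul hx).mul
        ((hasJet_thFun n hτ β).comp_mul hy)).inv (mul_ne_zero ha ha'))
    have j' := j.congr (g := fun ε => ε * kron n (τ := τ) α β (x * ε) (y * ε)) (.of_forall fun ε => by
      rw [kron, ← add_mul, div_eq_mul_inv]
      ring)
    convert j' using 1
    · simp [atZero, hα, hβ]
    · simp only [kronConst, hα, hβ, if_false]
      field_simp
      ring
    · simp only [kronDeriv, hα, hβ, if_false]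
      rw [add_comm β α]
      field_simp
      ring

theorem hasJet_kron_neg (hτ : 0 < τ.im) (α β : ZMod n) {x y : ℂ} (hx : x ≠ 0) (hy : y ≠ 0)
    (hxy : x + y ≠ 0) :
    kronConst n τ (-α) (-β) = -kronConst n τ α β ∧
      x * kronDeriv n τ (-α) (-β) + y * kronDeriv n τ (-β) (-α) =
        x * kronDeriv n τ α β + y * kronDeriv n τ β α := by
  have j1 := hasJet_kron n hτ (-α) (-β) (neg_ne_zero.2 hx) (neg_ne_zero.2 hy)
    (by rw [← neg_add]; exact neg_ne_zero.2 hxy)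
  have j2 := ((hasJet_const (-1)).mul (hasJet_kron n hτ α β hx hy hxy)).congr
    (g := fun ε => ε * kron n (τ := τ) (-α) (-β) (-x * ε) (-y * ε)) (.of_forall fun ε => by
      rw [neg_mul, neg_mul, kron_neg n hτ]
      ring)
  obtain ⟨-, h1, h2⟩ := j1.unique j2
  exact ⟨by linear_combination h1, by linear_combination -h2⟩

theorem kronConst_neg (hτ : 0 < τ.im) (α β : ZMod n) :
    kronConst n τ (-α) (-β) = -kronConst n τ α β :=
  (hasJet_kron_neg n hτ α β (one_ne_zero' ℂ) (one_ne_zero' ℂ) (by norm_num)).1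

/-- The expansion along one line sees only a combination of the two partial derivatives; the
directions $(1,1)$ and $(2,1)$ separate them. -/
theorem kronDeriv_neg (hτ : 0 < τ.im) (α β : ZMod n) :
    kronDeriv n τ (-α) (-β) = kronDeriv n τ α β := by
  have h1 := (hasJet_kron_neg n hτ α β (x := 1) (y := 1) (by norm_num) (by norm_num) (by norm_num)).2
  have h2 := (hasJet_kron_neg n hτ α β (x := 2) (y := 1) (by norm_num) (by norm_num) (by norm_num)).2
  linear_combination h2 - h1

theorem atZero_mul_eq_zero {α : ZMod n} {t : ℂ} (h : α = 0 → t = 0) : atZero n α * t = 0 := by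
  by_cases hα : α = 0
  · rw [h hα, mul_zero]
  · simp [atZero, hα]

theorem atZero_neg (α : ZMod n) : atZero n (-α) = atZero n α := by simp [atZero]

/-- The associative Yang-Baxter equation for the constant terms of the Kronecker function. -/
theorem kronConst_yang_baxter (hτ : 0 < τ.im) {X Y Z P Q S : ZMod n}
    (hXYZ : X + Y + Z = 0) (hPQS : P + Q + S = 0) :
    kronConst n τ X P * kronConst n τ (-Z) Q + kronConst n τ Y Q * kronConst n τ (-X) S +
      kronConst n τ Z S * kronConst n τ (-Y) P =
    atZero n P * kronDeriv n τ Q (-Z) + atZero n Q * kronDeriv n τ S (-X) +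
      atZero n S * kronDeriv n τ P (-Y) - atZero n X * kronDeriv n τ Y Q -
      atZero n Y * kronDeriv n τ Z S - atZero n Z * kronDeriv n τ X P := by
  have jet := fun (α β : ZMod n) (x y : ℂ) (hx : x ≠ 0) (hy : y ≠ 0) (hxy : x + y ≠ 0) =>
    hasJet_kron n hτ α β hx hy hxy
  -- The line $(x,y,z)=(1,1,-2)\varepsilon$, $(p,q,s)=(2,1,-3)\varepsilon$ respects both sum
  -- conditions and is generic: no argument and no sum of arguments that occurs is zero.
  have j := ((((jet X P 1 2 (by norm_num) (by norm_num) (by norm_num)).mul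
    (jet (-Z) Q 2 1 (by norm_num) (by norm_num) (by norm_num))).add
    ((jet Y Q 1 1 (by norm_num) (by norm_num) (by norm_num)).mul
    (jet (-X) S (-1) (-3) (by norm_num) (by norm_num) (by norm_num)))).add
    ((jet Z S (-2) (-3) (by norm_num) (by norm_num) (by norm_num)).mul
    (jet (-Y) P (-1) 2 (by norm_num) (by norm_num) (by norm_num)))).eq_zero (by
      filter_upwards [eventually_thFun_ne_zero n hτ X (x := 1) (by norm_num),
        eventually_thFun_ne_zero n hτ Y (x := 1) (by norm_num),
        eventually_thFun_ne_zero n hτ Z (x := -2) (by norm_num),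
        eventually_thFun_ne_zero n hτ P (x := 2) (by norm_num),
        eventually_thFun_ne_zero n hτ Q (x := 1) (by norm_num),
        eventually_thFun_ne_zero n hτ S (x := -3) (by norm_num)] with ε h1 h2 h3 h4 h5 h6
      have := kron_yang_baxter n hτ hXYZ hPQS (by ring) (by ring) h1 h2 h3 h4 h5 h6
      simp only [← neg_mul, neg_neg] at this
      linear_combination ε ^ 2 * this)
  -- Only the $\varepsilon^2$ coefficient is needed: products of constant terms, plus polar parts
  -- times first derivatives.
  obtain ⟨-, -, j⟩ := j
  have hn := kronDeriv_neg n hτ (τ := τ)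
  -- If one characteristic of a triple is zero, the other two are opposite, so the derivatives
  -- attached to that polar part coincide, up to the symmetry `kronDeriv_neg`. The twelve resulting
  -- relations fold the polar contributions into six terms; their weights in the final combination
  -- reflect the chosen directions.
  have hP : P = 0 → S = -Q := fun h => by rw [h] at hPQS; linear_combination hPQS
  have hQ : Q = 0 → S = -P := fun h => by rw [h] at hPQS; linear_combination hPQS
  have hS : S = 0 → P = -Q := fun h => by rw [h] at hPQS; linear_combination hPQS
  have hX : X = 0 → Z = -Y := fun h => by rw [h] at hXYZ; linear_combination hXYZ
  have hY : Y = 0 → Z = -X := fun h => by rw [h] at hXYZ; linear_combination hXYZ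
  have hZ : Z = 0 → Y = -X := fun h => by rw [h] at hXYZ; linear_combination hXYZ
  have P1 := atZero_mul_eq_zero n (α := P) (t := kronDeriv n τ Z S - kronDeriv n τ (-Z) Q)
    fun h => by rw [hP h, ← hn Z, neg_neg, sub_self]
  have P2 := atZero_mul_eq_zero n (α := P) (t := kronDeriv n τ S Z - kronDeriv n τ Q (-Z))
    fun h => by rw [hP h, ← hn (-Q), neg_neg, sub_self]
  have Q1 := atZero_mul_eq_zero n (α := Q) (t := kronDeriv n τ (-X) S - kronDeriv n τ X P)
    fun h => by rw [hQ h, hn, sub_self]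
  have Q2 := atZero_mul_eq_zero n (α := Q) (t := kronDeriv n τ S (-X) - kronDeriv n τ P X)
    fun h => by rw [hQ h, hn, sub_self]
  have S1 := atZero_mul_eq_zero n (α := S) (t := kronDeriv n τ (-Y) P - kronDeriv n τ Y Q)
    fun h => by rw [hS h, hn, sub_self]
  have S2 := atZero_mul_eq_zero n (α := S) (t := kronDeriv n τ P (-Y) - kronDeriv n τ Q Y)
    fun h => by rw [hS h, hn, sub_self]
  have X1 := atZero_mul_eq_zero n (α := X) (t := kronDeriv n τ (-Z) Q - kronDeriv n τ Y Q)
    fun h => by rw [hX h, neg_neg, sub_self]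
  have X2 := atZero_mul_eq_zero n (α := X) (t := kronDeriv n τ Q (-Z) - kronDeriv n τ Q Y)
    fun h => by rw [hX h, neg_neg, sub_self]
  have Y1 := atZero_mul_eq_zero n (α := Y) (t := kronDeriv n τ (-X) S - kronDeriv n τ Z S)
    fun h => by rw [hY h, sub_self]
  have Y2 := atZero_mul_eq_zero n (α := Y) (t := kronDeriv n τ S (-X) - kronDeriv n τ S Z)
    fun h => by rw [hY h, sub_self]
  have Z1 := atZero_mul_eq_zero n (α := Z) (t := kronDeriv n τ (-Y) P - kronDeriv n τ X P)
    fun h => by rw [hZ h, neg_neg, sub_self]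
  have Z2 := atZero_mul_eq_zero n (α := Z) (t := kronDeriv n τ P (-Y) - kronDeriv n τ P X)
    fun h => by rw [hZ h, neg_neg, sub_self]
  simp only [atZero_neg] at j
  linear_combination j + P1 + 3 / 2 * P2 + Q1 + 2 * Q2 - 1 / 3 * S1 - 1 / 3 * S2 - 2 * X1 - X2 + Y1 +
    3 * Y2 - 1 / 2 * Z1 + Z2

end Coefficients

/-! ### The Jacobi identity for quadratic brackets -/

section General

variable {R S : Type*} [Ring R] [Algebra ℂ R] [Ring S] [Algebra ℂ S]

theorem tr_mul_comm (a b : R) : tr (a * b) = tr (b * a) :=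
  (Submodule.Quotient.eq _).2 (Submodule.subset_span ⟨a, b, rfl⟩)

theorem tr_surjective : Function.Surjective (tr : R → Cyc R) := Submodule.mkQ_surjective _

theorem Cyc.lift_tr {M : Type*} [AddCommGroup M] [Module ℂ M] (φ : R →ₗ[ℂ] M)
    (h : ∀ a b, φ (a * b) = φ (b * a)) (a : R) : Cyc.lift φ h (tr a) = φ a :=
  Submodule.liftQ_apply _ _ _

theorem Cyc.map_tr (φ : R →ₐ[ℂ] S) (a : R) : Cyc.map φ (tr a) = tr (φ a) := Cyc.lift_tr _ _ a

/-- A derivation maps a commutator to a sum of commutators, hence acts on $R/[R,R]$. -/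
theorem IsDer.tr_eq {D : R →ₗ[ℂ] R} (hD : IsDer D) {a b : R} (h : tr a = tr b) :
    tr (D a) = tr (D b) := by
  have hl : ∀ a b, (tr ∘ₗ D) (a * b) = (tr ∘ₗ D) (b * a) := fun a b => by
    simp only [LinearMap.comp_apply, hD a b, hD b a, map_add]
    rw [tr_mul_comm (D a), tr_mul_comm a, add_comm]
  have := congrArg (Cyc.lift (tr ∘ₗ D) hl) h
  rwa [Cyc.lift_tr, Cyc.lift_tr] at this

theorem IsDer.commutator {D D' : R →ₗ[ℂ] R} (hD : IsDer D) (hD' : IsDer D') :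
    IsDer (D ∘ₗ D' - D' ∘ₗ D) := by
  intro a b
  simp only [LinearMap.sub_apply, LinearMap.comp_apply, hD a b, hD' a b, map_add, hD _ _, hD' _ _]
  noncomm_ring

end General

/-! ### Quadratic brackets and their Hamiltonian vector fields. -/

section Quadratic

variable {n : ℕ} [NeZero n] {R : Type*} [Ring R] [Algebra ℂ R]

/-- The linear map `z ↦ ∑ c_{i-j,r} x_{i-r} z_j x_{j+r}`. -/
def quadFlow (c : ZMod n → ZMod n → ℂ) (x z : ZMod n → R) (i : ZMod n) : R :=
  ∑ j, ∑ r, c (i - j) r • (x (i - r) * z j * x (j + r))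

/-- The bilinear form `∑ c_{i-j,r} tr(y_i x_{i-r} z_j x_{j+r})`. -/
def quadForm (c : ZMod n → ZMod n → ℂ) (x y z : ZMod n → R) : Cyc R :=
  ∑ i, ∑ j, ∑ r, c (i - j) r • tr (y i * x (i - r) * z j * x (j + r))

/-- The form `∑ c_{i-j,r} tr(y_i x_{i-r} z_j ξ_{j+r})`. -/
def quadVar (c : ZMod n → ZMod n → ℂ) (x y z ξ : ZMod n → R) : Cyc R :=
  ∑ i, ∑ j, ∑ r, c (i - j) r • tr (y i * x (i - r) * z j * ξ (j + r))

/-- The trilinear form `∑ κ_{i,j,l,u,v} tr(y_i x_{i-u} z_j x_{j-v} t_l x_{l+u+v})`. -/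
def triForm (κ : ZMod n → ZMod n → ZMod n → ZMod n → ZMod n → ℂ) (x y z t : ZMod n → R) : Cyc R :=
  ∑ i, ∑ j, ∑ l, ∑ u, ∑ v,
    κ i j l u v • tr (y i * x (i - u) * z j * x (j - v) * t l * x (l + (u + v)))

variable {c : ZMod n → ZMod n → ℂ} (x : ZMod n → R)

theorem quadBracket_eq (p : ZMod n → Cyc R →ₗ[ℂ] R) (f g : Cyc R) :
    quadBracket c x p f g = quadForm c x (fun i => p i f) (fun i => p i g) := by
  simp only [quadBracket, LinearMap.mk₂_apply, quadForm, map_sum, map_smul]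

theorem quadForm_eq_flow (y z : ZMod n → R) :
    quadForm c x y z = ∑ i, tr (y i * quadFlow c x z i) := by
  simp only [quadForm, quadFlow, Finset.mul_sum, map_sum, mul_smul_comm, map_smul, mul_assoc]

/-- The other variation of the quadratic form. -/
theorem quadVar_swap (hc : ∀ i r, c (-i) (-r) = -c i r) (y z ξ : ZMod n → R) :
    ∑ i, ∑ j, ∑ r, c (i - j) r • tr (y i * ξ (i - r) * z j * x (j + r)) =
      -quadVar c x z y ξ := by
  rw [quadVar, Finset.sum_comm, ← Finset.sum_neg_distrib]
  refine Finset.sum_congr rfl fun i _ => ?_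
  rw [← Finset.sum_neg_distrib]
  refine Finset.sum_congr rfl fun j _ => ?_
  rw [← Finset.sum_neg_distrib]
  refine Fintype.sum_equiv (Equiv.neg _) _ _ fun r => ?_
  have h := hc (i - j) (-r)
  rw [neg_sub, neg_neg] at h
  rw [Equiv.neg_apply, h, neg_smul, mul_assoc, tr_mul_comm, sub_neg_eq_add, ← sub_eq_add_neg,
    ← mul_assoc]

theorem quadForm_antisymm (hc : ∀ i r, c (-i) (-r) = -c i r) (y z : ZMod n → R) :
    quadForm c x y z = -quadForm c x z y := quadVar_swap x hc y z x

theorem quadVar_sub_mul (y z ξ : ZMod n → R) (a : R) :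
    quadVar c x y z (fun i => ξ i - a * x i) =
      quadVar c x y z ξ - quadForm c x y fun i => z i * a := by
  simp only [quadVar, quadForm, mul_sub, map_sub, smul_sub, Finset.sum_sub_distrib, mul_assoc]

/-- By the Leibniz rule the derivation hits $y$, $z$ or one of the two coordinates; antisymmetry of
$c$ turns the variation of the inner coordinate into that of the outer one with $y,z$ exchanged. -/
theorem tr_derivation_quad (hc : ∀ i r, c (-i) (-r) = -c i r) {D : R →ₗ[ℂ] R} (hD : IsDer D)
    (y z : ZMod n → R) :
    tr (D (∑ i, ∑ j, ∑ r, c (i - j) r • (y i * x (i - r) * z j * x (j + r)))) =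
      quadForm c x (fun i => D (y i)) z + quadForm c x y (fun i => D (z i)) +
        quadVar c x y z (fun i => D (x i)) - quadVar c x z y (fun i => D (x i)) := by
  rw [sub_eq_add_neg, ← quadVar_swap x hc]
  simp only [quadForm, quadVar, map_sum, map_smul, hD _ _, ← Finset.sum_add_distrib, ← smul_add,
    ← map_add]
  refine Finset.sum_congr rfl fun i _ => Finset.sum_congr rfl fun j _ =>
    Finset.sum_congr rfl fun r _ => ?_
  congr 2
  noncomm_ring

/-- The data of a quadratic bracket whose Hamiltonian vector fields exist. -/
structure IsHamiltonian (c : ZMod n → ZMod n → ℂ) (x : ZMod n → R) (p : ZMod n → Cyc R →ₗ[ℂ] R) :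
    Prop where
  antisymm : ∀ i r, c (-i) (-r) = -c i r
  chain : ∀ D : R →ₗ[ℂ] R, IsDer D → ∀ a, tr (D a) = ∑ i, tr (p i (tr a) * D (x i))
  field : ∀ g, ∃ D : R →ₗ[ℂ] R, IsDer D ∧ ∃ a : R,
    (∀ i, D (x i) = quadFlow c x (fun j => p j g) i - a * x i) ∧
      (a = 0 ∨ ∀ f, ∑ i, x i * p i f = 0)

variable {x} {p : ZMod n → Cyc R →ₗ[ℂ] R}

/-- Apply the chain rule to $D$, $D'$ and the derivation $[D,D']$: the terms with second-order
action on the coordinates cancel, and what remains is the symmetry of second derivatives. -/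
theorem hessian_symm (hch : ∀ D : R →ₗ[ℂ] R, IsDer D → ∀ a, tr (D a) = ∑ i, tr (p i (tr a) * D (x i)))
    {D D' : R →ₗ[ℂ] R} (hD : IsDer D) (hD' : IsDer D') (f : Cyc R) :
    ∑ i, tr (D (p i f) * D' (x i)) = ∑ i, tr (D' (p i f) * D (x i)) := by
  obtain ⟨a, rfl⟩ := tr_surjective f
  have h1 := hch _ (hD.commutator hD') a
  have e : ∀ {D D' : R →ₗ[ℂ] R}, IsDer D → IsDer D' → tr (D (D' a)) =
      ∑ i, tr (D (p i (tr a)) * D' (x i)) + ∑ i, tr (p i (tr a) * D (D' (x i))) := by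
    intro D D' hD hD'
    have : tr (D' a) = tr (∑ i, p i (tr a) * D' (x i)) := by rw [hch D' hD', map_sum]
    rw [hD.tr_eq this]
    simp only [map_sum, hD _ _, map_add, Finset.sum_add_distrib]
  simp only [LinearMap.sub_apply, LinearMap.comp_apply, map_sub, e hD hD', e hD' hD, mul_sub,
    Finset.sum_sub_distrib] at h1
  rw [← sub_eq_zero, ← sub_eq_zero.2 h1]
  abel

/-- On a chart the normalization $x_j=1$ forces the correction $-ax_i$ in the Hamiltonian field.
Applying $D$ to the identity $\sum x_ip_i(f)=0$ trades its effect on second derivatives for a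
first-order term. -/
theorem euler_term {a : R} (ha : a = 0 ∨ ∀ f, ∑ i, x i * p i f = 0) {D : R →ₗ[ℂ] R} (hD : IsDer D)
    {ξ : ZMod n → R} {b : R} (hξ : ∀ i, D (x i) = ξ i - b * x i) (f : Cyc R) :
    ∑ i, tr (D (p i f) * (a * x i)) = -∑ i, tr (p i f * a * ξ i) := by
  rcases ha with rfl | h
  · simp
  have h1 : ∑ i, (ξ i * p i f + x i * D (p i f)) = 0 := by
    have := congrArg D (h f)
    simp only [map_sum, hD _ _, hξ, sub_mul, map_zero] at this
    have h2 : ∑ i, b * x i * p i f = 0 := by simp only [mul_assoc, ← Finset.mul_sum, h f, mul_zero]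
    simp only [Finset.sum_add_distrib, Finset.sum_sub_distrib, h2, sub_zero] at this ⊢
    exact this
  have h2 := congrArg (fun z => tr (a * z)) h1
  simp only [Finset.mul_sum, map_sum, mul_add, map_add, Finset.sum_add_distrib, mul_zero,
    map_zero] at h2
  rw [eq_neg_iff_add_eq_zero, add_comm, ← h2]
  congr 1
  · refine Finset.sum_congr rfl fun i _ => ?_
    rw [mul_assoc, tr_mul_comm, mul_assoc]
  · refine Finset.sum_congr rfl fun i _ => ?_
    rw [tr_mul_comm, mul_assoc]

/-- The correction contributes $\mathrm{tr}(a\sum x_ip_i)$, which is zero either because $a=0$ or by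
the left Euler identity. -/
theorem IsHamiltonian.bracket_eq (h : IsHamiltonian c x p) {g : Cyc R} {D : R →ₗ[ℂ] R} (hD : IsDer D)
    {a : R} (hx : ∀ i, D (x i) = quadFlow c x (fun j => p j g) i - a * x i)
    (ha : a = 0 ∨ ∀ f, ∑ i, x i * p i f = 0) (b : R) :
    quadBracket c x p (tr b) g = tr (D b) := by
  rw [quadBracket_eq, quadForm_eq_flow, h.chain D hD]
  simp only [hx, mul_sub, map_sub, Finset.sum_sub_distrib]
  rw [eq_comm, sub_eq_self]
  rcases ha with rfl | h
  · simp
  · have : ∑ i, tr (a * (x i * p i (tr b))) = 0 := by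
      rw [← map_sum, ← Finset.mul_sum, h, mul_zero, map_zero]
    rw [← this]
    refine Finset.sum_congr rfl fun i _ => ?_
    rw [tr_mul_comm, mul_assoc]

theorem IsHamiltonian.isNCBivector (h : IsHamiltonian c x p) : IsNCBivector (quadBracket c x p) := by
  have anti : ∀ f g, quadBracket c x p f g = -quadBracket c x p g f := fun f g => by
    rw [quadBracket_eq, quadBracket_eq, quadForm_antisymm x h.antisymm]
  have left : ∀ g, IsNCVectorField ((quadBracket c x p).flip g) := fun g => by
    obtain ⟨D, hD, a, hx, ha⟩ := h.field g
    exact ⟨D, hD, fun b => h.bracket_eq hD hx ha b⟩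
  refine ⟨anti, left, fun f => ?_⟩
  obtain ⟨D, hD, h1⟩ := left f
  refine ⟨-D, fun a b => ?_, fun a => ?_⟩
  · simp only [LinearMap.neg_apply, hD a b, neg_add, neg_mul, mul_neg]
  · rw [anti, LinearMap.neg_apply, map_neg, ← h1, LinearMap.flip_apply]

/-- The cyclic sum `{{f, g}, h} + {{g, h}, f} + {{h, f}, g}`. -/
def jacobiator (β : Cyc R →ₗ[ℂ] Cyc R →ₗ[ℂ] Cyc R) (f g h : Cyc R) : Cyc R :=
  β (β f g) h + β (β g h) f + β (β h f) g

/-- The cyclic sum of the trilinear forms in which a Hamiltonian vector field acts on a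
coordinate. -/
def cycVar (c : ZMod n → ZMod n → ℂ) (x : ZMod n → R) (y z t : ZMod n → R) : Cyc R :=
  quadVar c x y z (quadFlow c x t) + quadVar c x z t (quadFlow c x y) +
    quadVar c x t y (quadFlow c x z)

/-- Write the outer bracket as the action of a Hamiltonian field on the inner one. Terms where it
acts on first derivatives are Hessian terms and cancel in pairs over the cyclic sum, and so do all
terms containing a correction $a$. The action on the coordinates remains. -/
theorem IsHamiltonian.jacobiator_eq (H : IsHamiltonian c x p) (f g h : Cyc R) :
    jacobiator (quadBracket c x p) f g h =
      cycVar c x (fun i => p i f) (fun i => p i g) (fun i => p i h) -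
      cycVar c x (fun i => p i g) (fun i => p i f) (fun i => p i h) := by
  have hc := H.antisymm
  have main : ∀ (f g h : Cyc R) (Df Dg Dh : R →ₗ[ℂ] R) (af ag ah : R), IsDer Df → IsDer Dg →
      IsDer Dh → (∀ i, Df (x i) = quadFlow c x (fun j => p j f) i - af * x i) →
      (∀ i, Dg (x i) = quadFlow c x (fun j => p j g) i - ag * x i) →
      (∀ i, Dh (x i) = quadFlow c x (fun j => p j h) i - ah * x i) →
      (af = 0 ∨ ∀ f, ∑ i, x i * p i f = 0) → (ag = 0 ∨ ∀ f, ∑ i, x i * p i f = 0) →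
      (ah = 0 ∨ ∀ f, ∑ i, x i * p i f = 0) →
      quadBracket c x p (quadBracket c x p f g) h =
        ∑ i, tr (Dh (p i f) * Dg (x i)) - quadForm c x (fun i => p i f * ag) (fun i => p i h) -
        (∑ i, tr (Dh (p i g) * Df (x i)) - quadForm c x (fun i => p i g * af) (fun i => p i h)) +
        (quadVar c x (fun i => p i f) (fun i => p i g) (quadFlow c x fun i => p i h) +
          quadForm c x (fun i => p i g * ah) (fun i => p i f)) -
        (quadVar c x (fun i => p i g) (fun i => p i f) (quadFlow c x fun i => p i h) +
          quadForm c x (fun i => p i f * ah) (fun i => p i g)) := by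
    intro f g h Df Dg Dh af ag ah hDf hDg hDh hf hg hh haf hag hah
    have e0 : quadBracket c x p f g = tr (∑ i, ∑ j, ∑ r,
      c (i - j) r • (p i f * x (i - r) * p j g * x (j + r))) := rfl
    have key : ∀ (f g : Cyc R) (Dg : R →ₗ[ℂ] R) (ag : R),
        (∀ i, Dg (x i) = quadFlow c x (fun j => p j g) i - ag * x i) →
        (ag = 0 ∨ ∀ f, ∑ i, x i * p i f = 0) →
        quadForm c x (fun i => Dh (p i f)) (fun i => p i g) =
        ∑ i, tr (Dh (p i f) * Dg (x i)) -
          quadForm c x (fun i => p i f * ag) (fun i => p i h) := by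
      intro f g Dg ag hg hag
      have := euler_term hag hDh hh f
      rw [quadForm_eq_flow, quadForm_eq_flow, sub_eq_add_neg, ← this, ← Finset.sum_add_distrib]
      refine Finset.sum_congr rfl fun i _ => ?_
      rw [← map_add, hg, ← mul_add, sub_add_cancel]
    rw [e0, H.bracket_eq hDh hh hah, tr_derivation_quad x hc hDh, key f g Dg ag hg hag,
      quadForm_antisymm x hc (fun i => p i f) (fun i => Dh (p i g)), key g f Df af hf haf]
    simp only [hh]
    rw [quadVar_sub_mul, quadVar_sub_mul,
      quadForm_antisymm x hc (fun i => p i f) (fun i => p i g * ah),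
      quadForm_antisymm x hc (fun i => p i g) (fun i => p i f * ah)]
    abel
  obtain ⟨Df, hDf, af, hf, haf⟩ := H.field f
  obtain ⟨Dg, hDg, ag, hg, hag⟩ := H.field g
  obtain ⟨Dh, hDh, ah, hh, hah⟩ := H.field h
  rw [jacobiator, main f g h Df Dg Dh af ag ah hDf hDg hDh hf hg hh haf hag hah,
    main g h f Dg Dh Df ag ah af hDg hDh hDf hg hh hf hag hah haf,
    main h f g Dh Df Dg ah af ag hDh hDf hDg hh hf hg hah haf hag,
    hessian_symm H.chain hDh hDg f, hessian_symm H.chain hDh hDf g,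
    hessian_symm H.chain hDf hDg h, cycVar, cycVar]
  abel

/-- By antisymmetry the six permutations give each cyclic term twice, and the Schouten bracket adds
two equal sums; hence the factor 4. -/
theorem schouten_eq_jacobiator {β : Cyc R →ₗ[ℂ] Cyc R →ₗ[ℂ] Cyc R}
    (hβ : ∀ f g, β f g = -β g f) (v : Fin 3 → Cyc R) :
    schouten β β v = (4 : ℂ) • jacobiator β (v 0) (v 1) (v 2) := by
  have e : ∑ σ : Equiv.Perm (Fin 3), (Equiv.Perm.sign σ : ℤ) • β (β (v (σ 0)) (v (σ 1))) (v (σ 2)) =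
      (2 : ℂ) • jacobiator β (v 0) (v 1) (v 2) := by
    have hu : (Finset.univ : Finset (Equiv.Perm (Fin 3))) =
        {1, Equiv.swap 0 1, Equiv.swap 0 2, Equiv.swap 1 2, Equiv.swap 0 1 * Equiv.swap 1 2,
          Equiv.swap 1 2 * Equiv.swap 0 1} := by decide
    have s1 : (Equiv.swap 0 1 : Equiv.Perm (Fin 3)) 2 = 2 := by decide
    have s2 : (Equiv.swap 0 2 : Equiv.Perm (Fin 3)) 1 = 1 := by decide
    have s3 : (Equiv.swap 1 2 : Equiv.Perm (Fin 3)) 0 = 0 := by decide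
    rw [hu, Finset.sum_insert (by decide), Finset.sum_insert (by decide),
      Finset.sum_insert (by decide), Finset.sum_insert (by decide), Finset.sum_insert (by decide),
      Finset.sum_singleton]
    simp only [Equiv.Perm.sign_one, Equiv.Perm.sign_mul,
      Equiv.Perm.sign_swap (show (0 : Fin 3) ≠ 1 by decide),
      Equiv.Perm.sign_swap (show (0 : Fin 3) ≠ 2 by decide),
      Equiv.Perm.sign_swap (show (1 : Fin 3) ≠ 2 by decide), Equiv.Perm.one_apply,
      Equiv.Perm.mul_apply, Equiv.swap_apply_left, Equiv.swap_apply_right, s1, s2, s3,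
      Units.val_one, Units.val_neg, mul_neg, neg_neg, mul_one, one_smul, neg_smul, jacobiator]
    rw [hβ (v 1) (v 0), hβ (v 2) (v 1), hβ (v 0) (v 2)]
    simp only [map_neg, LinearMap.neg_apply, neg_neg, two_smul]
    abel
  rw [schouten, e, ← add_smul]
  norm_num

end Quadratic

/-! ### Reduction of the Jacobi identity to the Euler relations -/

section Euler

variable {n : ℕ} [NeZero n] {R : Type*} [Ring R] [Algebra ℂ R]
variable {c d e : ZMod n → ZMod n → ℂ} (x : ZMod n → R)

/-- The shifts $u$, $v$, $-u-v$ of the three coordinates add up to zero, and cyclic invariance of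
the trace permutes the pairs $(i,u)$, $(j,v)$, $(l,-u-v)$. -/
theorem triForm_rotate (κ : ZMod n → ZMod n → ZMod n → ZMod n → ZMod n → ℂ) (y z t : ZMod n → R) :
    triForm κ x z t y = triForm (fun i j l u v => κ j l i v (-u - v)) x y z t := by
  simp only [triForm]
  rw [Finset.sum_congr rfl fun j _ => Finset.sum_comm, Finset.sum_comm]
  refine Finset.sum_congr rfl fun i _ => Finset.sum_congr rfl fun j _ =>
    Finset.sum_congr rfl fun l _ => ?_
  conv_rhs => rw [Finset.sum_comm]
  refine Finset.sum_congr rfl fun v _ => ?_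
  refine (Fintype.sum_equiv (Equiv.subLeft (-v)) _ _ fun u => ?_).symm
  have e := tr_mul_comm (y i * x (i - u)) (z j * x (j - v) * t l * x (l + (u + v)))
  rw [Equiv.subLeft_apply, show v + (-v - u) = -u by ring, show -v - u = -u - v by ring,
    ← sub_eq_add_neg, show l - (-u - v) = l + (u + v) by ring]
  simp only [mul_assoc] at e ⊢
  rw [e]

theorem triForm_add (κ κ' : ZMod n → ZMod n → ZMod n → ZMod n → ZMod n → ℂ) (y z t : ZMod n → R) :
    triForm κ x y z t + triForm κ' x y z t =
      triForm (fun i j l u v => κ i j l u v + κ' i j l u v) x y z t := by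
  simp only [triForm, add_smul, Finset.sum_add_distrib]

/-- The coefficients of the quadratic terms in the Jacobi identity. -/
def jacobiCoeff (c : ZMod n → ZMod n → ℂ) (i j l u v : ZMod n) : ℂ :=
  c (i - j) u * c (j + u - l) (u + v)

/-- Coefficients that produce Euler operators. -/
def eulerCoeff (d e : ZMod n → ZMod n → ℂ) (i j l u v : ZMod n) : ℂ :=
  atZero n (i - j - u) * e (u + v) (j - v - l) - atZero n u * d v (j - v - l)

/-- The sum of a coefficient over the cyclic permutations. -/
def cycCoeff (κ : ZMod n → ZMod n → ZMod n → ZMod n → ZMod n → ℂ) (i j l u v : ZMod n) : ℂ :=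
  κ i j l u v + κ j l i v (-u - v) + κ l i j (-u - v) u

/-- The flow replaces $x_{j+u}$ by terms with a second shift $s$; setting $s=u+v$ brings them to the
cyclic normal form. -/
theorem quadVar_flow (y z t : ZMod n → R) :
    quadVar c x y z (quadFlow c x t) = triForm (jacobiCoeff c) x y z t := by
  simp only [quadVar, quadFlow, triForm, Finset.mul_sum, map_sum, Finset.smul_sum]
  refine Finset.sum_congr rfl fun i _ => Finset.sum_congr rfl fun j _ => ?_
  rw [Finset.sum_comm]
  refine Finset.sum_congr rfl fun l _ => Finset.sum_congr rfl fun u _ => ?_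
  refine (Fintype.sum_equiv (Equiv.addLeft u) _ _ fun v => ?_).symm
  rw [Equiv.coe_addLeft, jacobiCoeff, mul_smul, mul_smul_comm, map_smul,
    show j + u - (u + v) = j - v by ring]
  simp only [mul_assoc]

theorem triForm_cyc (κ : ZMod n → ZMod n → ZMod n → ZMod n → ZMod n → ℂ) (y z t : ZMod n → R) :
    triForm κ x y z t + triForm κ x z t y + triForm κ x t y z = triForm (cycCoeff κ) x y z t := by
  rw [triForm_rotate x κ y z t, triForm_rotate x κ z t y, triForm_rotate x _ y z t, triForm_add,
    triForm_add]
  have h : ∀ u v : ZMod n, -v - (-u - v) = u := fun u v => by ring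
  simp only [h]
  rfl

/-- The trilinear expressions that contain an Euler operator: `L` stands for `∑ x_i z_i` and `E`
for `∑ y_i x_i`. -/
def eulerForm (d e : ZMod n → ZMod n → ℂ) (x y z t : ZMod n → R) (L E : R) : Cyc R :=
  ∑ l, ∑ b, ∑ a, e (a - l) (b - l) • tr (y (b + a - l) * L * x b * t l * x a) -
  ∑ j, ∑ l, ∑ v, d v (j - v - l) • tr (E * z j * x (j - v) * t l * x (l + v))

/-- The delta at $i-j=u$ makes $x_{i-u}z_j$ equal to $x_jz_j$, and in terms of $b=j-v$ the
coefficient no longer depends on $j$, so the sum over $j$ is a left Euler operator. The delta at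
$u=0$ gives $y_ix_i$ with a coefficient free of $i$, a right Euler operator. -/
theorem triForm_eulerCoeff (y z t : ZMod n → R) :
    triForm (eulerCoeff d e) x y z t =
      eulerForm d e x y z t (∑ i, x i * z i) (∑ i, y i * x i) := by
  simp only [triForm, eulerCoeff, sub_smul, Finset.sum_sub_distrib, eulerForm]
  congr 1
  · have h1 : ∀ i j l : ZMod n, ∑ u, ∑ v, (atZero n (i - j - u) * e (u + v) (j - v - l)) •
        tr (y i * x (i - u) * z j * x (j - v) * t l * x (l + (u + v))) =
        ∑ v, e (i - j + v) (j - v - l) •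
        tr (y i * x j * z j * x (j - v) * t l * x (l + (i - j + v))) := by
      intro i j l
      rw [Finset.sum_eq_single (i - j)]
      · simp [atZero]
      · intro u _ hu
        simp [atZero, sub_eq_zero, Ne.symm hu]
      · simp
    simp only [h1]
    have h2 : ∀ i j l : ZMod n, ∑ v, e (i - j + v) (j - v - l) •
        tr (y i * x j * z j * x (j - v) * t l * x (l + (i - j + v))) =
        ∑ b, e (i - b) (b - l) • tr (y i * x j * z j * x b * t l * x (l + (i - b))) := by
      intro i j l
      refine Fintype.sum_equiv (Equiv.subLeft j) _ _ fun v => ?_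
      rw [Equiv.subLeft_apply, show i - (j - v) = i - j + v by ring]
    simp only [h2]
    have h3 : ∀ i, ∑ j, ∑ l, ∑ b, e (i - b) (b - l) •
        tr (y i * x j * z j * x b * t l * x (l + (i - b))) =
        ∑ l, ∑ b, e (i - b) (b - l) • tr (y i * (∑ j, x j * z j) * x b * t l * x (l + (i - b))) := by
      intro i
      simp only [Finset.mul_sum, Finset.sum_mul, map_sum, Finset.smul_sum]
      rw [Finset.sum_comm]
      refine Finset.sum_congr rfl fun l _ => ?_
      rw [Finset.sum_comm]
      simp only [mul_assoc]
    simp only [h3]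
    rw [Finset.sum_comm]
    refine Finset.sum_congr rfl fun l _ => ?_
    rw [Finset.sum_comm]
    refine Finset.sum_congr rfl fun b _ => ?_
    refine Fintype.sum_equiv (Equiv.addRight (l - b)) _ _ fun i => ?_
    simp only [Equiv.coe_addRight]
    rw [show b + (i + (l - b)) - l = i by ring,
      show i + (l - b) - l = i - b by ring, show i + (l - b) = l + (i - b) by ring]
  · have h1 : ∀ i j l : ZMod n, ∑ u, ∑ v, (atZero n u * d v (j - v - l)) •
        tr (y i * x (i - u) * z j * x (j - v) * t l * x (l + (u + v))) =
        ∑ v, d v (j - v - l) • tr (y i * x i * z j * x (j - v) * t l * x (l + v)) := by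
      intro i j l
      rw [Finset.sum_eq_single 0]
      · simp [atZero]
      · intro u _ hu
        simp [atZero, hu]
      · simp
    simp only [h1, Finset.sum_mul, map_sum, Finset.smul_sum]
    rw [Finset.sum_comm]
    refine Finset.sum_congr rfl fun j _ => ?_
    rw [Finset.sum_comm]
    refine Finset.sum_congr rfl fun l _ => ?_
    rw [Finset.sum_comm]

/-- The cyclic sum of the Euler expressions. -/
def cycEuler (d e : ZMod n → ZMod n → ℂ) (x : ZMod n → R) (y z t : ZMod n → R) : Cyc R :=
  eulerForm d e x y z t (∑ i, x i * z i) (∑ i, y i * x i) +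
  eulerForm d e x z t y (∑ i, x i * t i) (∑ i, z i * x i) +
  eulerForm d e x t y z (∑ i, x i * y i) (∑ i, t i * x i)

/-- The coefficients themselves need not agree: the cyclic sum of the forms depends only on the
cyclic sum of the coefficients. -/
theorem cycVar_eq_cycEuler
    (hK : ∀ i j l u v, cycCoeff (jacobiCoeff c) i j l u v = cycCoeff (eulerCoeff d e) i j l u v)
    (y z t : ZMod n → R) : cycVar c x y z t = cycEuler d e x y z t := by
  rw [cycVar, quadVar_flow, quadVar_flow, quadVar_flow, triForm_cyc, cycEuler, ← triForm_eulerCoeff,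
    ← triForm_eulerCoeff, ← triForm_eulerCoeff, triForm_cyc]
  simp only [triForm, hK]

end Euler

/-! ### The elliptic coefficients as values of the Kronecker function. -/

section EllipticCoefficients

variable (n : ℕ) [NeZero n] {k : ℕ} {τ : ℂ}

theorem mul_eq_zero_iff_of_coprime (hk : Nat.Coprime k n) (r : ZMod n) : (k : ZMod n) * r = 0 ↔ r = 0 := by
  have : IsUnit (k : ZMod n) := (ZMod.isUnit_iff_coprime k n).2 hk
  exact this.mul_right_eq_zero

/-- Since $kr+(i-r)=i+r(k-1)$, the generic formulas match. Coprimality gives $kr=0\iff r=0$, which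
makes the exceptional cases match as well. -/
theorem ellCoeff_eq (hk : Nat.Coprime k n) (i r : ZMod n) :
    ellCoeff n k τ i r = kronConst n τ (k * r) (i - r) := by
  have e : (k : ZMod n) * r + (i - r) = i + r * (k - 1) := by ring
  rw [ellCoeff, kronConst, e]
  simp only [mul_eq_zero_iff_of_coprime n hk]
  by_cases hr : r = 0
  · simp [hr]
  · by_cases hi : r = i
    · subst hi
      simp [hr]
    · simp [hr, hi, sub_eq_zero, Ne.symm hi]

theorem ellCoeff_neg (hk : Nat.Coprime k n) (hτ : 0 < τ.im) (i r : ZMod n) :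
    ellCoeff n k τ (-i) (-r) = -ellCoeff n k τ i r := by
  rw [ellCoeff_eq n hk, ellCoeff_eq n hk, ← kronConst_neg n hτ]
  congr 1 <;> ring

/-- The coefficients of the right Euler operators. -/
def eulerD (k : ℕ) (τ : ℂ) (u t : ZMod n) : ℂ := kronDeriv n τ (k * u) t

/-- The coefficients of the left Euler operators. -/
def eulerE (k : ℕ) (τ : ℂ) (u t : ZMod n) : ℂ := kronDeriv n τ t (k * u)

theorem eulerD_neg (hτ : 0 < τ.im) (u t : ZMod n) : eulerD n k τ (-u) (-t) = eulerD n k τ u t := by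
  rw [eulerD, eulerD, ← kronDeriv_neg n hτ, mul_neg, neg_neg, neg_neg]

theorem eulerE_neg (hτ : 0 < τ.im) (u t : ZMod n) : eulerE n k τ (-u) (-t) = eulerE n k τ u t := by
  rw [eulerE, eulerE, ← kronDeriv_neg n hτ, mul_neg, neg_neg, neg_neg]

theorem atZero_mul_left (hk : Nat.Coprime k n) (r : ZMod n) : atZero n (k * r) = atZero n r := by
  simp only [atZero, mul_eq_zero_iff_of_coprime n hk]

/-- This is the Yang-Baxter relation with first triple $k$ times the shifts $(u,v,-u-v)$ and second
triple $(i-j-u,\ j-l-v,\ l-i+u+v)$. Three deltas of its defect produce left Euler operators, the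
other three right ones. -/
theorem cycCoeff_ellCoeff (hk : Nat.Coprime k n) (hτ : 0 < τ.im) (i j l u v : ZMod n) :
    cycCoeff (jacobiCoeff (ellCoeff n k τ)) i j l u v =
      cycCoeff (eulerCoeff (eulerD n k τ) (eulerE n k τ)) i j l u v := by
  have h := kronConst_yang_baxter n hτ (X := k * u) (Y := k * v) (Z := k * (-u - v))
    (P := i - j - u) (Q := j - l - v) (S := l - i - (-u - v)) (by ring) (by ring)
  simp only [cycCoeff, jacobiCoeff, eulerCoeff, ellCoeff_eq n hk, eulerD, eulerE]
  simp only [atZero_mul_left n hk, ← mul_neg] at h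
  rw [show -(-u - v) = u + v by ring] at h
  rw [show j + u - l - (u + v) = j - l - v by ring, show v + (-u - v) = -u by ring,
    show l + v - i - -u = l - i - (-u - v) by ring, show -u - v + u = -v by ring,
    show i + (-u - v) - j - -v = i - j - u by ring, show j - v - l = j - l - v by ring,
    show l - (-u - v) - i = l - i - (-u - v) by ring, show i - u - j = i - j - u by ring, h]
  ring

end EllipticCoefficients

/-! ### Double derivations and coordinates -/

section DoubleDerivations

variable {R S : Type*} [Ring R] [Algebra ℂ R] [Ring S] [Algebra ℂ S]

/-- The linear map `a ⊗ b ↦ b w a`. -/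
def outerInsert (w : R) : R ⊗[ℂ] R →ₗ[ℂ] R :=
  revMul R ∘ₗ TensorProduct.map LinearMap.id (LinearMap.mulRight ℂ w)

/-- The linear map `a ⊗ b ↦ a z b`. -/
def innerInsert (z : R) : R ⊗[ℂ] R →ₗ[ℂ] R :=
  LinearMap.mul' ℂ R ∘ₗ TensorProduct.map (LinearMap.mulRight ℂ z) LinearMap.id

@[simp] theorem outerInsert_tmul (w a b : R) : outerInsert w (a ⊗ₜ[ℂ] b) = b * w * a := by
  simp [outerInsert, revMul]

@[simp] theorem innerInsert_tmul (z a b : R) : innerInsert z (a ⊗ₜ[ℂ] b) = a * z * b := by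
  simp [innerInsert]

@[simp] theorem outerInsert_one_apply (w : R) : outerInsert w (1 : R ⊗[ℂ] R) = w := by
  simp [Algebra.TensorProduct.one_def]

@[simp] theorem innerInsert_one_apply (z : R) : innerInsert z (1 : R ⊗[ℂ] R) = z := by
  simp [Algebra.TensorProduct.one_def]

theorem outerInsert_one (t : R ⊗[ℂ] R) : outerInsert 1 t = revMul R t := by
  induction t using TensorProduct.induction_on with
  | zero => simp
  | tmul a b => simp [revMul]
  | add s t hs ht => simp only [map_add, hs, ht]

theorem outerInsert_add (w w' : R) (t : R ⊗[ℂ] R) :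
    outerInsert (w + w') t = outerInsert w t + outerInsert w' t := by
  induction t using TensorProduct.induction_on with
  | zero => simp
  | tmul a b => simp [mul_add, add_mul]
  | add s t hs ht => simp only [map_add, hs, ht]; abel

@[simp] theorem outerInsert_zero (t : R ⊗[ℂ] R) : outerInsert 0 t = 0 := by
  have := outerInsert_add 0 0 t
  rwa [add_zero, left_eq_add] at this

theorem outerInsert_left_mul (w f : R) (t : R ⊗[ℂ] R) :
    outerInsert w ((f ⊗ₜ[ℂ] (1 : R)) * t) = outerInsert (w * f) t := by
  induction t using TensorProduct.induction_on with
  | zero => simp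
  | tmul a b => simp [mul_assoc]
  | add s t hs ht => simp only [mul_add, map_add, hs, ht]

theorem outerInsert_mul_right (w f : R) (t : R ⊗[ℂ] R) :
    outerInsert w (t * ((1 : R) ⊗ₜ[ℂ] f)) = outerInsert (f * w) t := by
  induction t using TensorProduct.induction_on with
  | zero => simp
  | tmul a b => simp [mul_assoc]
  | add s t hs ht => simp only [add_mul, map_add, hs, ht]

theorem innerInsert_left_mul (z f : R) (t : R ⊗[ℂ] R) :
    innerInsert z ((f ⊗ₜ[ℂ] (1 : R)) * t) = f * innerInsert z t := by
  induction t using TensorProduct.induction_on with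
  | zero => simp
  | tmul a b => simp [mul_assoc]
  | add s t hs ht => simp only [mul_add, map_add, hs, ht]

theorem innerInsert_mul_right (z f : R) (t : R ⊗[ℂ] R) :
    innerInsert z (t * ((1 : R) ⊗ₜ[ℂ] f)) = innerInsert z t * f := by
  induction t using TensorProduct.induction_on with
  | zero => simp
  | tmul a b => simp [mul_assoc]
  | add s t hs ht => simp only [add_mul, map_add, hs, ht]

theorem tr_innerInsert (z : R) (t : R ⊗[ℂ] R) :
    tr (innerInsert z t) = tr (revMul R t * z) := by
  induction t using TensorProduct.induction_on with
  | zero => simp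
  | tmul a b => simp [revMul, mul_assoc, tr_mul_comm b]
  | add s t hs ht => simp only [map_add, add_mul, hs, ht]

variable {Φ : R →ₐ[ℂ] Matrix (Fin 2) (Fin 2) (R ⊗[ℂ] R)}

theorem IsDoubleDer.apply_mul (h : IsDoubleDer Φ) (f g : R) :
    Φ (f * g) 0 1 = (f ⊗ₜ[ℂ] (1 : R)) * Φ g 0 1 + Φ f 0 1 * ((1 : R) ⊗ₜ[ℂ] g) := by
  simp [Matrix.mul_apply, Fin.sum_univ_two, (h f).1, (h g).2.2]

theorem doubleDer_algebraMap (Φ : R →ₐ[ℂ] Matrix (Fin 2) (Fin 2) (R ⊗[ℂ] R)) (r : ℂ) :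
    Φ (algebraMap ℂ R r) 0 1 = 0 := by
  rw [AlgHom.commutes]
  simp [Matrix.algebraMap_matrix_apply]

/-- The polarization `w ↦ ∑ b w a` of the cyclic derivative, for `Δ f = ∑ a ⊗ b`. -/
def polar (Φ : R →ₐ[ℂ] Matrix (Fin 2) (Fin 2) (R ⊗[ℂ] R)) (f w : R) : R := outerInsert w (Φ f 0 1)

/-- The extra argument $w$ closes the recursion: a product rule for the cyclic derivative alone
would already involve $w\ne1$. -/
theorem polar_mul (h : IsDoubleDer Φ) (f g w : R) :
    polar Φ (f * g) w = polar Φ f (g * w) + polar Φ g (w * f) := by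
  rw [polar, h.apply_mul, map_add, outerInsert_left_mul, outerInsert_mul_right, add_comm]
  rfl

theorem polar_add (f g w : R) : polar Φ (f + g) w = polar Φ f w + polar Φ g w := by
  simp [polar]

theorem polar_algebraMap (r : ℂ) (w : R) : polar Φ (algebraMap ℂ R r) w = 0 := by
  rw [polar, doubleDer_algebraMap, map_zero]

theorem cycDeriv_tr (h : IsDoubleDer Φ) (f : R) : cycDeriv Φ h (tr f) = polar Φ f 1 := by
  rw [cycDeriv, Cyc.lift_tr, polar, outerInsert_one]
  rfl

variable {X : Type*} [Fintype X] [DecidableEq X]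

/-- Elements `u_i` and double derivations `D/Du_i` that behave like coordinates and partial
derivatives: `D u_j / D u_i = δ_ij 1 ⊗ 1`, and the algebra is generated by the `u_i` and
inverses. -/
structure IsCoordinates (u : X → R) (Φ : X → R →ₐ[ℂ] Matrix (Fin 2) (Fin 2) (R ⊗[ℂ] R)) : Prop where
  doubleDer : ∀ i, IsDoubleDer (Φ i)
  apply_coord : ∀ i j, Φ i (u j) 0 1 = if j = i then 1 else 0
  generate : ∀ A : Subalgebra ℂ R, (∀ i, u i ∈ A) →
    (∀ a b, a ∈ A → a * b = 1 → b * a = 1 → b ∈ A) → A = ⊤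

variable {u : X → R} {Ψ : X → R →ₐ[ℂ] Matrix (Fin 2) (Fin 2) (R ⊗[ℂ] R)}

theorem IsDer.map_one {D : R →ₗ[ℂ] R} (hD : IsDer D) : D 1 = 0 := by
  have := hD 1 1
  rwa [mul_one, mul_one, one_mul, left_eq_add] at this

/-- Insert $z_i$ between the two tensor factors of $D a/Du_i$ and sum over $i$; under the trace the
insertion becomes multiplication of the cyclic derivative by $z_i$. -/
theorem IsCoordinates.exists_derivation (h : IsCoordinates u Ψ) (z : X → R) :
    ∃ D : R →ₗ[ℂ] R, IsDer D ∧ (∀ i, D (u i) = z i) ∧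
      ∀ a, tr (D a) = ∑ i, tr (cycDeriv (Ψ i) (h.doubleDer i) (tr a) * z i) := by
  refine ⟨∑ i, innerInsert (z i) ∘ₗ Matrix.entryLinearMap ℂ (R ⊗[ℂ] R) 0 1 ∘ₗ (Ψ i).toLinearMap,
    fun a b => ?_, fun i => ?_, fun a => ?_⟩
  · simp only [LinearMap.sum_apply, LinearMap.comp_apply, AlgHom.toLinearMap_apply,
      Matrix.entryLinearMap_apply, fun i => (h.doubleDer i).apply_mul, map_add,
      innerInsert_left_mul, innerInsert_mul_right, Finset.sum_add_distrib, Finset.mul_sum,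
      Finset.sum_mul]
    rw [add_comm]
  · simp only [LinearMap.sum_apply, LinearMap.comp_apply, AlgHom.toLinearMap_apply,
      Matrix.entryLinearMap_apply, h.apply_coord]
    rw [Finset.sum_eq_single i]
    · simp
    · intro j _ hj
      simp [Ne.symm hj]
    · simp
  · simp only [LinearMap.sum_apply, LinearMap.comp_apply, AlgHom.toLinearMap_apply,
      Matrix.entryLinearMap_apply, map_sum, tr_innerInsert, cycDeriv_tr, polar, outerInsert_one]

theorem IsCoordinates.derivation_ext (h : IsCoordinates u Ψ) {D : R →ₗ[ℂ] R} (hD : IsDer D)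
    (h0 : ∀ i, D (u i) = 0) : D = 0 := by
  let A : Subalgebra ℂ R :=
    { carrier := {a | D a = 0}
      mul_mem' := fun {a b} ha hb => by
        have ha : D a = 0 := ha
        have hb : D b = 0 := hb
        show D (a * b) = 0
        rw [hD, ha, hb, zero_mul, mul_zero, add_zero]
      add_mem' := fun {a b} ha hb => by
        have ha : D a = 0 := ha
        have hb : D b = 0 := hb
        show D (a + b) = 0
        rw [map_add, ha, hb, add_zero]
      algebraMap_mem' := fun r => by
        show D (algebraMap ℂ R r) = 0
        rw [Algebra.algebraMap_eq_smul_one, map_smul, hD.map_one, smul_zero] }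
  have hA : A = ⊤ := h.generate A h0 fun a b ha hab hba => by
    have ha : D a = 0 := ha
    show D b = 0
    have h1 := hD a b
    rw [hab, hD.map_one, ha, zero_mul, zero_add] at h1
    rw [← one_mul (D b), ← hba, mul_assoc, ← h1, mul_zero]
  ext a
  have : a ∈ A := hA ▸ Algebra.mem_top
  exact this

theorem IsCoordinates.tr_derivation (h : IsCoordinates u Ψ) {D : R →ₗ[ℂ] R} (hD : IsDer D) (a : R) :
    tr (D a) = ∑ i, tr (cycDeriv (Ψ i) (h.doubleDer i) (tr a) * D (u i)) := by
  obtain ⟨D', hD', h1, h2⟩ := h.exists_derivation fun i => D (u i)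
  have e : D - D' = 0 := h.derivation_ext
    (fun a b => by simp only [LinearMap.sub_apply, hD a b, hD' a b]; noncomm_ring)
    fun i => by rw [LinearMap.sub_apply, h1, sub_self]
  rw [← h2, sub_eq_zero.1 e]

/-- The claim telescopes on products, $(gwf-fgw)+(wfg-gwf)=wfg-fgw$, so the elements satisfying it
form a subalgebra containing the coordinates. For $w=1$ it says that the commutators $[\partial
f/\partial u_i,u_i]$ sum to zero. -/
theorem IsCoordinates.polar_commutator (h : IsCoordinates u Ψ) (f w : R) :
    ∑ i, (polar (Ψ i) f w * u i - u i * polar (Ψ i) f w) = w * f - f * w := by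
  have hdd := h.doubleDer
  have hmul : ∀ f g w, ∑ i, (polar (Ψ i) (f * g) w * u i - u i * polar (Ψ i) (f * g) w) =
      ∑ i, (polar (Ψ i) f (g * w) * u i - u i * polar (Ψ i) f (g * w)) +
      ∑ i, (polar (Ψ i) g (w * f) * u i - u i * polar (Ψ i) g (w * f)) := by
    intro f g w
    rw [← Finset.sum_add_distrib]
    refine Finset.sum_congr rfl fun i _ => ?_
    rw [polar_mul (hdd i)]
    noncomm_ring
  let A : Subalgebra ℂ R :=
    { carrier := {f | ∀ w, ∑ i, (polar (Ψ i) f w * u i - u i * polar (Ψ i) f w) = w * f - f * w}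
      mul_mem' := fun {a b} ha hb w => by
        rw [hmul, ha, hb]
        noncomm_ring
      add_mem' := fun {a b} ha hb w => by
        have := congrArg₂ (· + ·) (ha w) (hb w)
        rw [← Finset.sum_add_distrib] at this
        rw [show w * (a + b) - (a + b) * w = (w * a - a * w) + (w * b - b * w) by noncomm_ring,
          ← this]
        refine Finset.sum_congr rfl fun i _ => ?_
        rw [polar_add]
        noncomm_ring
      algebraMap_mem' := fun r w => by
        simp [polar_algebraMap, Algebra.commutes] }
  have hA : A = ⊤ := by
    refine h.generate A (fun j w => ?_) fun a b ha hab hba w => ?_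
    · simp only [polar, h.apply_coord]
      rw [Finset.sum_eq_single j]
      · simp
      · intro i _ hi
        simp [Ne.symm hi]
      · simp
    · have h1 := hmul a b (w * b)
      have h0 : ∀ i, polar (Ψ i) 1 (w * b) = 0 := fun i => by
        simpa using polar_algebraMap (Φ := Ψ i) 1 (w * b)
      rw [hab, ha, mul_assoc w b a, hba, mul_one] at h1
      simp only [h0, zero_mul, mul_zero, sub_zero, Finset.sum_const_zero] at h1
      have e : b * (w * b) * a - a * (b * (w * b)) = b * w - w * b := by
        rw [mul_assoc, mul_assoc, hba, mul_one, ← mul_assoc a, hab, one_mul]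
      rw [e] at h1
      rw [← sub_eq_zero, h1]
      noncomm_ring
  have : f ∈ A := hA ▸ Algebra.mem_top
  exact this w

theorem IsCoordinates.sum_commutator (h : IsCoordinates u Ψ) (f : Cyc R) :
    ∑ i, (cycDeriv (Ψ i) (h.doubleDer i) f * u i - u i * cycDeriv (Ψ i) (h.doubleDer i) f) = 0 := by
  obtain ⟨a, rfl⟩ := tr_surjective f
  simp only [cycDeriv_tr]
  rw [h.polar_commutator, one_mul, mul_one, sub_self]

theorem isCoordinates_free : IsCoordinates (FreeAlgebra.ι ℂ) (freeDD (X := X)) := by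
  refine ⟨isDoubleDer_freeDD, fun i j => by simp [freeDD], fun A hA _ => ?_⟩
  rw [← top_le_iff, ← FreeAlgebra.adjoin_range_ι]
  exact Algebra.adjoin_le (Set.range_subset_iff.2 hA)

/-- The chain rule for a homomorphism from a free algebra. -/
theorem polar_chain {Θ : S →ₐ[ℂ] Matrix (Fin 2) (Fin 2) (S ⊗[ℂ] S)} (hΘ : IsDoubleDer Θ)
    (φ : FreeAlgebra ℂ X →ₐ[ℂ] S) (f w : FreeAlgebra ℂ X) :
    polar Θ (φ f) (φ w) =
      ∑ i, outerInsert (φ (polar (freeDD i) f w)) (Θ (φ (FreeAlgebra.ι ℂ i)) 0 1) := by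
  induction f using FreeAlgebra.induction generalizing w with
  | grade0 r =>
    simp only [polar_algebraMap, AlgHom.commutes, map_zero, outerInsert_zero, Finset.sum_const_zero]
  | grade1 j =>
    have : ∀ i, polar (freeDD i) (FreeAlgebra.ι ℂ j) w = if j = i then w else 0 := fun i => by
      rw [polar, isCoordinates_free.apply_coord]
      split_ifs <;> simp
    rw [Finset.sum_eq_single j]
    · rw [this, if_pos rfl, polar]
    · intro i _ hi
      rw [this, if_neg (Ne.symm hi), map_zero, outerInsert_zero]
    · simp
  | mul a b ha hb =>
    rw [map_mul, polar_mul hΘ, ← map_mul, ← map_mul, ha, hb, ← Finset.sum_add_distrib]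
    refine Finset.sum_congr rfl fun i _ => ?_
    rw [polar_mul (isDoubleDer_freeDD i), map_add, outerInsert_add]
  | add a b ha hb =>
    rw [map_add, polar_add, ha, hb, ← Finset.sum_add_distrib]
    refine Finset.sum_congr rfl fun i _ => ?_
    rw [polar_add, map_add, outerInsert_add]

theorem cycDeriv_chain {Θ : S →ₐ[ℂ] Matrix (Fin 2) (Fin 2) (S ⊗[ℂ] S)} (hΘ : IsDoubleDer Θ)
    (φ : FreeAlgebra ℂ X →ₐ[ℂ] S) (f : Cyc (FreeAlgebra ℂ X)) :
    cycDeriv Θ hΘ (Cyc.map φ f) =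
      ∑ i, outerInsert (φ (freePartial i f)) (Θ (φ (FreeAlgebra.ι ℂ i)) 0 1) := by
  obtain ⟨a, rfl⟩ := tr_surjective f
  have := polar_chain hΘ φ a 1
  rw [map_one] at this
  rw [Cyc.map_tr, cycDeriv_tr, this]
  simp only [freePartial, cycDeriv_tr]

end DoubleDerivations

/-! ### Affine and projective coordinates -/

section Affine

variable {n : ℕ} [NeZero n] {R S : Type*} [Ring R] [Algebra ℂ R] [Ring S] [Algebra ℂ S]
variable {c d e : ZMod n → ZMod n → ℂ}

theorem isHamiltonian_free (hc : ∀ i r, c (-i) (-r) = -c i r) :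
    IsHamiltonian c (FreeAlgebra.ι ℂ) (freePartial (X := ZMod n)) := by
  refine ⟨hc, fun D hD a => isCoordinates_free.tr_derivation hD a, fun g => ?_⟩
  obtain ⟨D, hD, h1, -⟩ := (isCoordinates_free (X := ZMod n)).exists_derivation
    (quadFlow c (FreeAlgebra.ι ℂ) fun j => freePartial j g)
  exact ⟨D, hD, 0, fun i => by rw [h1, zero_mul, sub_zero], .inl rfl⟩

theorem eulerForm_zero (x y z t : ZMod n → R) : eulerForm d e x y z t 0 0 = 0 := by
  simp [eulerForm]

theorem IsHamiltonian.isNCPoisson {x : ZMod n → R} {p : ZMod n → Cyc R →ₗ[ℂ] R}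
    (H : IsHamiltonian c x p)
    (hK : ∀ i j l u v, cycCoeff (jacobiCoeff c) i j l u v = cycCoeff (eulerCoeff d e) i j l u v)
    (hl : ∀ f, ∑ i, x i * p i f = 0) (hr : ∀ f, ∑ i, p i f * x i = 0) :
    IsNCPoisson (quadBracket c x p) := by
  refine ⟨H.isNCBivector, fun v => ?_⟩
  rw [schouten_eq_jacobiator H.isNCBivector.antisymm, H.jacobiator_eq, cycVar_eq_cycEuler x hK,
    cycVar_eq_cycEuler x hK]
  simp only [cycEuler, hl, hr, eulerForm_zero, add_zero, sub_zero, smul_zero]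

/-- The partial derivatives with respect to the homogeneous coordinates `u_i`, `u_j = 1`: the
derivative with respect to `u_j` is determined by the Euler relation. -/
def homPartial (j : ZMod n) (u : ZMod n → R) (P : {i : ZMod n // i ≠ j} → Cyc R →ₗ[ℂ] R)
    (i : ZMod n) : Cyc R →ₗ[ℂ] R :=
  if h : i = j then -∑ i' : {i : ZMod n // i ≠ j}, LinearMap.mulLeft ℂ (u i') ∘ₗ P i' else P ⟨i, h⟩

variable {j : ZMod n} {u : ZMod n → R} {P : {i : ZMod n // i ≠ j} → Cyc R →ₗ[ℂ] R}

theorem homPartial_of_ne {i : ZMod n} (h : i ≠ j) : homPartial j u P i = P ⟨i, h⟩ := dif_neg h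

theorem homPartial_coe (i : {i : ZMod n // i ≠ j}) : homPartial j u P i = P i := dif_neg i.2

theorem homPartial_self (f : Cyc R) : homPartial j u P j f = -∑ i' : {i : ZMod n // i ≠ j}, u i' * P i' f := by
  simp [homPartial]

theorem sum_eq_add_subtype {M : Type*} [AddCommMonoid M] (j : ZMod n) (F : ZMod n → M) :
    ∑ i, F i = F j + ∑ i : {i : ZMod n // i ≠ j}, F i := by
  rw [Fintype.sum_eq_add_sum_subtype_ne F j]

theorem euler_left_homPartial (hu : u j = 1) (f : Cyc R) :
    ∑ i, u i * homPartial j u P i f = 0 := by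
  rw [sum_eq_add_subtype j, homPartial_self, hu, one_mul]
  simp only [homPartial_coe, neg_add_cancel]

variable {Ψ : {i : ZMod n // i ≠ j} → R →ₐ[ℂ] Matrix (Fin 2) (Fin 2) (R ⊗[ℂ] R)}

/-- The derivative in the direction $u_j$ was chosen to satisfy the left identity; the difference of
the two identities is the vanishing sum of commutators. -/
theorem euler_right_homPartial (hu : u j = 1)
    (h : IsCoordinates (fun i : {i : ZMod n // i ≠ j} => u i) Ψ) (f : Cyc R) :
    ∑ i, homPartial j u (fun i => cycDeriv (Ψ i) (h.doubleDer i)) i f * u i = 0 := by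
  rw [sum_eq_add_subtype j, homPartial_self, hu, mul_one]
  simp only [homPartial_coe]
  rw [neg_add_eq_sub, ← Finset.sum_sub_distrib]
  exact h.sum_commutator f

/-- A derivation must kill $u_j=1$. Subtracting $z_ju_i$ from the $i$-th component of the flow $z$
achieves this, so the correction is $a=z_j$. -/
theorem isHamiltonian_homPartial (hc : ∀ i r, c (-i) (-r) = -c i r) (hu : u j = 1)
    (h : IsCoordinates (fun i : {i : ZMod n // i ≠ j} => u i) Ψ) :
    IsHamiltonian c u (homPartial j u fun i => cycDeriv (Ψ i) (h.doubleDer i)) := by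
  refine ⟨hc, fun D hD a => ?_, fun g => ?_⟩
  · rw [h.tr_derivation hD, sum_eq_add_subtype j, hu, hD.map_one, mul_zero, map_zero, zero_add]
    simp only [homPartial_coe]
  · set z := quadFlow c u fun i =>
      homPartial j u (fun i => cycDeriv (Ψ i) (h.doubleDer i)) i g with hz
    obtain ⟨D, hD, h1, -⟩ := h.exists_derivation fun i => z i - z j * u i
    refine ⟨D, hD, z j, fun i => ?_, .inr (euler_left_homPartial hu)⟩
    by_cases hi : i = j
    · subst hi
      rw [hu, hD.map_one, mul_one, sub_self]
    · exact h1 ⟨i, hi⟩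

theorem isNCPoisson_homPartial (hc : ∀ i r, c (-i) (-r) = -c i r)
    (hK : ∀ i j l u v, cycCoeff (jacobiCoeff c) i j l u v = cycCoeff (eulerCoeff d e) i j l u v)
    (hu : u j = 1) (h : IsCoordinates (fun i : {i : ZMod n // i ≠ j} => u i) Ψ) :
    IsNCPoisson (quadBracket c u (homPartial j u fun i => cycDeriv (Ψ i) (h.doubleDer i))) :=
  (isHamiltonian_homPartial hc hu h).isNCPoisson hK (euler_left_homPartial hu)
    (euler_right_homPartial hu h)

/-- A homomorphism that rescales the coordinates by a common factor `a` is compatible with the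
quadratic brackets. -/
theorem quadBracket_map (φ : R →ₐ[ℂ] S) {x : ZMod n → R} {y : ZMod n → S}
    {p : ZMod n → Cyc R →ₗ[ℂ] R} {q : ZMod n → Cyc S →ₗ[ℂ] S} {a : S}
    (hx : ∀ i, φ (x i) = a * y i) (hp : ∀ i f, q i (Cyc.map φ f) = φ (p i f) * a) (f g : Cyc R) :
    quadBracket c y q (Cyc.map φ f) (Cyc.map φ g) = Cyc.map φ (quadBracket c x p f g) := by
  rw [quadBracket_eq, quadBracket_eq, quadForm, quadForm]
  simp only [map_sum, map_smul, Cyc.map_tr, map_mul, hx, hp, mul_assoc]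

end Affine

/-! ### Homogeneity -/

section Homogeneity

variable {X : Type*} [DecidableEq X]

theorem lauDD_lx (i j : X) : lauDD i (lx j) 0 1 = if j = i then 1 else 0 := by
  simp [lauDD, lauUnit]

theorem lauDD_lxInv (i j : X) :
    lauDD i (lxInv j) 0 1 = if j = i then (-lxInv j) ⊗ₜ[ℂ] lxInv j else 0 := by
  simp [lauDD, lauUnit]

theorem lxInv_mul_lx (i : X) : lxInv i * lx i = 1 := by rw [← map_mul, inv_mul_cancel, map_one]

variable (n : ℕ) [NeZero n]

theorem dilate_inclA_ι (i : ZMod n) :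
    (dilate n).comp (inclA n) (FreeAlgebra.ι ℂ i) = lx none * lx (some i) := by
  rw [← map_mul]
  simp [dilate, inclA]

theorem lauPartial_dilate (i : ZMod n) (f : Cyc (Aff n)) :
    lauPartial (some i) (Cyc.map ((dilate n).comp (inclA n)) f) =
      (dilate n).comp (inclA n) (freePartial i f) * lx none := by
  rw [lauPartial, cycDeriv_chain, Finset.sum_eq_single i]
  · rw [dilate_inclA_ι, (isDoubleDer_lauDD _).apply_mul, lauDD_lx, lauDD_lx]
    simp [-MonoidAlgebra.of_apply]
  · intro j _ hj
    rw [dilate_inclA_ι, (isDoubleDer_lauDD _).apply_mul, lauDD_lx, lauDD_lx]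
    simp [-MonoidAlgebra.of_apply, hj]
  · simp

theorem ellNu_homogeneous (k : ℕ) (τ : ℂ) (f g : Aff n) :
    ellNuA n k τ (tr (dilate n (inclA n f))) (tr (dilate n (inclA n g))) =
      Cyc.map (dilate n) (Cyc.map (inclA n) (ellNu n k τ (tr f) (tr g))) := by
  have h := quadBracket_map (c := ellCoeff n k τ) ((dilate n).comp (inclA n))
    (y := fun i => lx (some i)) (dilate_inclA_ι n) (lauPartial_dilate n) (tr f) (tr g)
  rw [Cyc.map_tr, Cyc.map_tr] at h
  have e : ∀ w, Cyc.map ((dilate n).comp (inclA n)) w = Cyc.map (dilate n) (Cyc.map (inclA n) w) := by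
    intro w
    obtain ⟨a, rfl⟩ := tr_surjective w
    simp only [Cyc.map_tr, AlgHom.comp_apply]
  rw [e] at h
  exact h

end Homogeneity

/-! ### Charts and overlaps -/

section Charts

variable (n : ℕ) [NeZero n]

/-- The homogeneous coordinates on a chart: `u_{i,j}` for `i ≠ j`, and `u_{j,j} = 1`. -/
def chartU (j i : ZMod n) : Chart n j := if h : i = j then 1 else FreeAlgebra.ι ℂ ⟨i, h⟩

theorem chartU_self (j : ZMod n) : chartU n j j = 1 := dif_pos rfl

theorem chartU_coe (j : ZMod n) (i : {i : ZMod n // i ≠ j}) :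
    chartU n j i = FreeAlgebra.ι ℂ i := dif_neg i.2

theorem isCoordinates_chart (j : ZMod n) :
    IsCoordinates (fun i : {i : ZMod n // i ≠ j} => chartU n j i) freeDD := by
  have := isCoordinates_free (X := {i : ZMod n // i ≠ j})
  simp only [chartU_coe]
  exact this

/-- The partial derivatives with respect to the homogeneous coordinates on a chart. -/
def chartPartial (j : ZMod n) : ZMod n → Cyc (Chart n j) →ₗ[ℂ] Chart n j :=
  homPartial j (chartU n j) freePartial

/-- The nonabelian Poisson structure on a chart. -/
def chartBracket (k : ℕ) (τ : ℂ) (j : ZMod n) :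
    Cyc (Chart n j) →ₗ[ℂ] Cyc (Chart n j) →ₗ[ℂ] Cyc (Chart n j) :=
  quadBracket (ellCoeff n k τ) (chartU n j) (chartPartial n j)

theorem chartEmb_chartU (j i : ZMod n) : chartEmb n j (chartU n j i) = lxInv j * lx i := by
  by_cases h : i = j
  · subst h
    rw [chartU_self, map_one, lxInv_mul_lx]
  · rw [chartU_coe n j ⟨i, h⟩, chartEmb, FreeAlgebra.lift_ι_apply]

/-- From $d(x_j^{-1}x_i)=x_j^{-1}dx_i-x_j^{-1}dx_j\,x_j^{-1}x_i$: the derivative in $x_j$ collects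
$-\sum u_i\,\partial f/\partial u_i$, which is the homogeneous partial derivative in the direction
$u_j$. -/
theorem lauPartial_chartEmb (j i : ZMod n) (f : Cyc (Chart n j)) :
    lauPartial i (Cyc.map (chartEmb n j) f) = chartEmb n j (chartPartial n j i f) * lxInv j := by
  have hΔ : ∀ i' : {i : ZMod n // i ≠ j}, lauDD i (chartEmb n j (FreeAlgebra.ι ℂ i')) 0 1 =
      (lxInv j ⊗ₜ[ℂ] 1) * (if (i' : ZMod n) = i then 1 else 0) +
      (if j = i then (-lxInv j) ⊗ₜ[ℂ] lxInv j else 0) * (1 ⊗ₜ[ℂ] lx (i' : ZMod n)) := by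
    intro i'
    rw [← chartU_coe, chartEmb_chartU, (isDoubleDer_lauDD _).apply_mul, lauDD_lx, lauDD_lxInv]
  rw [lauPartial, cycDeriv_chain]
  simp only [hΔ, map_add, outerInsert_left_mul, outerInsert_mul_right]
  by_cases h : i = j
  · subst h
    have hne : ∀ i' : {i' : ZMod n // i' ≠ i}, ((i' : ZMod n) = i) = False := fun i' =>
      eq_false i'.2
    rw [chartPartial, homPartial_self]
    simp only [if_true, hne, if_false, map_zero, zero_add,
      outerInsert_tmul, map_neg, map_sum, map_mul, chartEmb_chartU, neg_mul, Finset.sum_mul, mul_neg,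
      Finset.sum_neg_distrib, mul_assoc]
  · rw [chartPartial, homPartial_of_ne h]
    simp only [if_neg (Ne.symm h), map_zero, add_zero]
    rw [Finset.sum_eq_single ⟨i, h⟩]
    · simp [-MonoidAlgebra.of_apply]
    · intro i' _ hi'
      have : (i' : ZMod n) ≠ i := fun e => hi' (Subtype.ext e)
      rw [if_neg this, map_zero]
    · simp

theorem chartBracket_chartEmb (k : ℕ) (τ : ℂ) (j : ZMod n) (f g : Cyc (Chart n j)) :
    Cyc.map (chartEmb n j) (chartBracket n k τ j f g) =
      ellNuLaurent n k τ (Cyc.map (chartEmb n j) f) (Cyc.map (chartEmb n j) g) :=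
  (quadBracket_map (chartEmb n j) (chartEmb_chartU n j) (lauPartial_chartEmb n j) f g).symm

/-! ### Coordinates and partial derivatives on the overlap of two charts. -/

variable (j k : ZMod n) (h : k ≠ j)

theorem ovU_self : ovU n j k h j = 1 := dif_pos rfl

theorem ovU_of_ne {i : ZMod n} (hi : i ≠ j) : ovU n j k h i =
    RingQuot.mkAlgHom ℂ (OverlapRel n j k h) (FreeAlgebra.ι ℂ (some ⟨i, hi⟩)) := dif_neg hi

theorem ovU_mul_ovInv : ovU n j k h k * ovInv n j k h = 1 := by
  rw [ovU_of_ne n j k h h, ovInv, ← map_mul, ← map_one (RingQuot.mkAlgHom ℂ (OverlapRel n j k h))]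
  exact RingQuot.mkAlgHom_rel ℂ .mul_inv

theorem ovInv_mul_ovU : ovInv n j k h * ovU n j k h k = 1 := by
  rw [ovU_of_ne n j k h h, ovInv, ← map_mul, ← map_one (RingQuot.mkAlgHom ℂ (OverlapRel n j k h))]
  exact RingQuot.mkAlgHom_rel ℂ .inv_mul

theorem tmul_mul_neg_tmul_add {R : Type*} [Ring R] [Algebra ℂ R] {u w : R} (e : u * w = 1) :
    (u ⊗ₜ[ℂ] (1 : R)) * -(w ⊗ₜ[ℂ] w) + 1 ⊗ₜ[ℂ] w = 0 := by
  simp [e]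

theorem tmul_add_neg_tmul_mul {R : Type*} [Ring R] [Algebra ℂ R] {u w : R} (e : w * u = 1) :
    w ⊗ₜ[ℂ] (1 : R) + -(w ⊗ₜ[ℂ] w) * (1 ⊗ₜ[ℂ] u) = 0 := by
  simp [e]

theorem neg_sum_mul {R ι : Type*} [Ring R] (s : Finset ι) (F : ι → R) (w : R) :
    -∑ i ∈ s, F i * w = (-∑ i ∈ s, F i) * w := by
  rw [neg_mul, Finset.sum_mul]

/-- The matrices that define the double derivation `D/Du_i` on the overlap. -/
def ovMatrix (i : {i : ZMod n // i ≠ j}) : Option {i : ZMod n // i ≠ j} →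
    Matrix (Fin 2) (Fin 2) (Overlap n j k h ⊗[ℂ] Overlap n j k h)
  | some i' => !![ovU n j k h i' ⊗ₜ[ℂ] 1, if i' = i then 1 else 0; 0, 1 ⊗ₜ[ℂ] ovU n j k h i']
  | none => !![ovInv n j k h ⊗ₜ[ℂ] 1,
      if ⟨k, h⟩ = i then -(ovInv n j k h ⊗ₜ[ℂ] ovInv n j k h) else 0; 0, 1 ⊗ₜ[ℂ] ovInv n j k h]

/-- The double derivation `D/Du_i` on the overlap. -/
def ovDD (i : {i : ZMod n // i ≠ j}) : Overlap n j k h →ₐ[ℂ]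
    Matrix (Fin 2) (Fin 2) (Overlap n j k h ⊗[ℂ] Overlap n j k h) :=
  RingQuot.liftAlgHom ℂ ⟨FreeAlgebra.lift ℂ (ovMatrix n j k h i), by
    have h1 := ovU_mul_ovInv n j k h
    have h2 := ovInv_mul_ovU n j k h
    rintro _ _ (_ | _)
    · rw [map_mul, map_one, FreeAlgebra.lift_ι_apply, FreeAlgebra.lift_ι_apply, ovMatrix, ovMatrix,
        Matrix.mul_fin_two, Matrix.one_fin_two]
      split_ifs
      · simp [h1, Algebra.TensorProduct.one_def]
        exact tmul_mul_neg_tmul_add h1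
      · simp [h1, Algebra.TensorProduct.one_def]
    · rw [map_mul, map_one, FreeAlgebra.lift_ι_apply, FreeAlgebra.lift_ι_apply, ovMatrix, ovMatrix,
        Matrix.mul_fin_two, Matrix.one_fin_two]
      split_ifs
      · simp [h2, Algebra.TensorProduct.one_def]
        exact tmul_add_neg_tmul_mul h2
      · simp [h2, Algebra.TensorProduct.one_def]⟩

theorem ovDD_mk (i : {i : ZMod n // i ≠ j}) (a : FreeAlgebra ℂ (Option {i : ZMod n // i ≠ j})) :
    ovDD n j k h i (RingQuot.mkAlgHom ℂ _ a) = FreeAlgebra.lift ℂ (ovMatrix n j k h i) a :=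
  RingQuot.liftAlgHom_mkAlgHom_apply ℂ _ _ _

theorem mk_ι_some (i : {i : ZMod n // i ≠ j}) :
    RingQuot.mkAlgHom ℂ (OverlapRel n j k h) (FreeAlgebra.ι ℂ (some i)) = ovU n j k h i :=
  (ovU_of_ne n j k h i.2).symm

theorem isDoubleDer_ovDD (i : {i : ZMod n // i ≠ j}) : IsDoubleDer (ovDD n j k h i) := by
  intro f
  obtain ⟨a, rfl⟩ := RingQuot.mkAlgHom_surjective ℂ _ f
  rw [ovDD_mk]
  induction a using FreeAlgebra.induction with
  | grade0 r =>
    simp [Algebra.algebraMap_eq_smul_one, Algebra.TensorProduct.one_def, TensorProduct.smul_tmul']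
  | grade1 x =>
    cases x with
    | none => rw [FreeAlgebra.lift_ι_apply, ← ovInv]; simp [ovMatrix]
    | some i' => rw [FreeAlgebra.lift_ι_apply, mk_ι_some]; simp [ovMatrix]
  | mul a b ha hb =>
    simp [Matrix.mul_apply, Fin.sum_univ_two, ha.1, ha.2.1, ha.2.2, hb.1, hb.2.1, hb.2.2]
  | add a b ha hb =>
    simp [ha.1, ha.2.1, ha.2.2, hb.1, hb.2.1, hb.2.2, TensorProduct.add_tmul,
      TensorProduct.tmul_add]

theorem ovDD_ovU (i i' : {i : ZMod n // i ≠ j}) :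
    ovDD n j k h i (ovU n j k h i') 0 1 = if i' = i then 1 else 0 := by
  rw [← mk_ι_some, ovDD_mk, FreeAlgebra.lift_ι_apply, ovMatrix]
  simp

theorem ovDD_ovInv (i : {i : ZMod n // i ≠ j}) : ovDD n j k h i (ovInv n j k h) 0 1 =
    if ⟨k, h⟩ = i then -(ovInv n j k h ⊗ₜ[ℂ] ovInv n j k h) else 0 := by
  rw [ovInv, ovDD_mk, FreeAlgebra.lift_ι_apply, ovMatrix]
  simp [ovInv]

theorem isCoordinates_overlap :
    IsCoordinates (fun i : {i : ZMod n // i ≠ j} => ovU n j k h i) (ovDD n j k h) := by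
  refine ⟨isDoubleDer_ovDD n j k h, ovDD_ovU n j k h, fun A hA hinv => ?_⟩
  have hle : (⊤ : Subalgebra ℂ (FreeAlgebra ℂ (Option {i : ZMod n // i ≠ j}))) ≤
      A.comap (RingQuot.mkAlgHom ℂ (OverlapRel n j k h)) := by
    rw [← FreeAlgebra.adjoin_range_ι]
    refine Algebra.adjoin_le (Set.range_subset_iff.2 fun o => ?_)
    cases o with
    | some i =>
      show RingQuot.mkAlgHom ℂ (OverlapRel n j k h) _ ∈ A
      rw [mk_ι_some]
      exact hA i
    | none => exact hinv _ _ (hA ⟨k, h⟩) (ovU_mul_ovInv n j k h) (ovInv_mul_ovU n j k h)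
  rw [← top_le_iff]
  intro f _
  obtain ⟨a, rfl⟩ := RingQuot.mkAlgHom_surjective ℂ _ f
  exact hle Algebra.mem_top

/-- The partial derivatives with respect to the homogeneous coordinates on the overlap. -/
def ovPartial : ZMod n → Cyc (Overlap n j k h) →ₗ[ℂ] Overlap n j k h :=
  homPartial j (ovU n j k h) fun i => cycDeriv (ovDD n j k h i) (isDoubleDer_ovDD n j k h i)

theorem resFst_chartU (i : ZMod n) : resFst n j k h (chartU n j i) = 1 * ovU n j k h i := by
  rw [one_mul]
  by_cases hi : i = j
  · subst hi
    rw [chartU_self, map_one, ovU_self]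
  · rw [chartU_coe n j ⟨i, hi⟩, resFst, FreeAlgebra.lift_ι_apply]

theorem ovPartial_resFst (i : ZMod n) (f : Cyc (Chart n j)) :
    ovPartial n j k h i (Cyc.map (resFst n j k h) f) =
      resFst n j k h (chartPartial n j i f) * 1 := by
  have key : ∀ i : {i : ZMod n // i ≠ j}, cycDeriv (ovDD n j k h i) (isDoubleDer_ovDD n j k h i)
      (Cyc.map (resFst n j k h) f) = resFst n j k h (freePartial i f) := by
    intro i
    rw [cycDeriv_chain, Finset.sum_eq_single i]
    · rw [← chartU_coe, resFst_chartU, one_mul, ovDD_ovU, if_pos rfl, outerInsert_one_apply]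
    · intro i' _ hi'
      rw [← chartU_coe, resFst_chartU, one_mul, ovDD_ovU, if_neg hi', map_zero]
    · simp
  rw [mul_one, ovPartial, chartPartial]
  by_cases hi : i = j
  · subst hi
    rw [homPartial_self, homPartial_self]
    simp only [key, map_neg, map_sum, map_mul, resFst_chartU, one_mul]
  · rw [homPartial_of_ne hi, homPartial_of_ne hi, key]

theorem resSnd_chartU (i : ZMod n) :
    resSnd n j k h (chartU n k i) = ovInv n j k h * ovU n j k h i := by
  by_cases hi : i = k
  · subst hi
    rw [chartU_self, map_one, ovInv_mul_ovU]
  · rw [chartU_coe n k ⟨i, hi⟩, resSnd, FreeAlgebra.lift_ι_apply]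

theorem ovDD_ovU' (i : {i : ZMod n // i ≠ j}) (i' : ZMod n) :
    ovDD n j k h i (ovU n j k h i') 0 1 = if i' = i then 1 else 0 := by
  by_cases hi : i' = j
  · subst hi
    have := doubleDer_algebraMap (ovDD n i' k h i) 1
    rw [map_one] at this
    rw [ovU_self, this, if_neg (Ne.symm i.2)]
  · rw [ovDD_ovU n j k h i ⟨i', hi⟩]
    simp only [Subtype.ext_iff]

/-- The homogeneous coordinates of the second chart are those of the first times $u_{k,j}^{-1}$ on
the left, so the computation is that of `lauPartial_chartEmb` with $u_{k,j}$ in place of the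
denominator. -/
theorem ovPartial_resSnd (i : ZMod n) (f : Cyc (Chart n k)) :
    ovPartial n j k h i (Cyc.map (resSnd n j k h) f) =
      resSnd n j k h (chartPartial n k i f) * ovInv n j k h := by
  have key : ∀ i : {i : ZMod n // i ≠ j}, cycDeriv (ovDD n j k h i) (isDoubleDer_ovDD n j k h i)
      (Cyc.map (resSnd n j k h) f) =
      resSnd n j k h (chartPartial n k i f) * ovInv n j k h := by
    intro i
    have hΔ : ∀ i' : {i : ZMod n // i ≠ k},
        ovDD n j k h i (resSnd n j k h (FreeAlgebra.ι ℂ i')) 0 1 =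
        (ovInv n j k h ⊗ₜ[ℂ] 1) * (if (i' : ZMod n) = i then 1 else 0) +
        (if ⟨k, h⟩ = i then -(ovInv n j k h ⊗ₜ[ℂ] ovInv n j k h) else 0) *
          (1 ⊗ₜ[ℂ] ovU n j k h i') := by
      intro i'
      rw [← chartU_coe, resSnd_chartU, (isDoubleDer_ovDD n j k h i).apply_mul, ovDD_ovU', ovDD_ovInv]
    rw [cycDeriv_chain]
    simp only [hΔ, map_add, outerInsert_left_mul, outerInsert_mul_right]
    obtain ⟨i, hij⟩ := i
    by_cases hik : i = k
    · subst hik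
      have hne : ∀ i' : {i' : ZMod n // i' ≠ i}, ((i' : ZMod n) = i) = False := fun i' =>
        eq_false i'.2
      rw [chartPartial, homPartial_self]
      simp only [if_true, hne, if_false, map_zero, zero_add, map_neg, outerInsert_tmul, map_sum,
        map_mul, resSnd_chartU, Finset.sum_neg_distrib, mul_assoc]
      simpa only [mul_assoc] using neg_sum_mul Finset.univ (fun x : {i' : ZMod n // i' ≠ i} =>
        ovInv n j i h * (ovU n j i h x * resSnd n j i h (freePartial x f))) (ovInv n j i h)
    · have hne : ¬ ((⟨k, h⟩ : {i : ZMod n // i ≠ j}) = ⟨i, hij⟩) := fun e =>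
        hik (congrArg Subtype.val e).symm
      rw [chartPartial, homPartial_of_ne hik]
      simp only [if_neg hne, map_zero, add_zero]
      rw [Finset.sum_eq_single ⟨i, hik⟩]
      · simp
      · intro i' _ hi'
        have : (i' : ZMod n) ≠ i := fun e => hi' (Subtype.ext e)
        rw [if_neg this, map_zero]
      · simp
  by_cases hi : i = j
  · subst hi
    -- The index with $u=1$ is not a free coordinate on the overlap. Its derivative is found from
    -- the left Euler identity of the second chart, multiplied by $u_k$ on the left and $u_k^{-1}$
    -- on the right.
    have he := congrArg (fun z => ovU n i k h k * resSnd n i k h z * ovInv n i k h)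
      (euler_left_homPartial (P := freePartial) (chartU_self n k) f)
    simp only [map_sum, map_mul, resSnd_chartU, Finset.mul_sum, map_zero, mul_zero, zero_mul,
      ← mul_assoc, ovU_mul_ovInv, one_mul] at he
    rw [Finset.sum_mul, sum_eq_add_subtype i, ovU_self, one_mul, ← eq_neg_iff_add_eq_zero] at he
    rw [ovPartial, homPartial_self, chartPartial, he]
    simp only [key, mul_assoc]
    rfl
  · rw [ovPartial, homPartial_of_ne hi, key]

end Charts

/-- One formula in homogeneous coordinates serves the charts and the overlaps. The two restriction
maps rescale the coordinates by $1$ and by $u_{l,j}^{-1}$. -/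
theorem isProjPoisson_chartBracket (n k : ℕ) [NeZero n] (hcop : Nat.Coprime k n) {τ : ℂ}
    (hτ : 0 < τ.im) : IsProjPoisson n (chartBracket n k τ) := by
  have hc := ellCoeff_neg n hcop hτ
  have hK := cycCoeff_ellCoeff n hcop hτ
  refine ⟨fun j => isNCPoisson_homPartial hc hK (chartU_self n j) (isCoordinates_chart n j),
    fun j l h => ⟨quadBracket (ellCoeff n k τ) (ovU n j l h) (ovPartial n j l h), ?_, ?_, ?_⟩⟩
  · exact isNCPoisson_homPartial hc hK (ovU_self n j l h) (isCoordinates_overlap n j l h)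
  · exact quadBracket_map (resFst n j l h) (resFst_chartU n j l h) (ovPartial_resFst n j l h)
  · exact quadBracket_map (resSnd n j l h) (resSnd_chartU n j l h) (ovPartial_resSnd n j l h)

/-! ### The Schouten square on the free algebra -/

section Schouten

variable (n : ℕ) [NeZero n]

theorem mem_eulerSpan {E : Cyc (Aff n) → Aff n} (hE : E = eulerLeft n ∨ E = eulerRight n)
    (σ : Equiv.Perm (Fin 3)) (a b c : Aff n) (j l : ZMod n) :
    (fun v : Fin 3 → Cyc (Aff n) => tr (a * E (v (σ 0)) * b * freePartial j (v (σ 1)) * c *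
      freePartial l (v (σ 2)))) ∈ eulerSpan n :=
  Submodule.subset_span ⟨σ, E, a, b, c, j, l, hE, rfl⟩

theorem eulerForm_mem_eulerSpan (d e : ZMod n → ZMod n → ℂ) (σ : Equiv.Perm (Fin 3)) :
    (fun v : Fin 3 → Cyc (Aff n) => eulerForm d e (FreeAlgebra.ι ℂ) (fun i => freePartial i (v (σ 0)))
      (fun i => freePartial i (v (σ 1))) (fun i => freePartial i (v (σ 2)))
      (∑ i, FreeAlgebra.ι ℂ i * freePartial i (v (σ 1)))
      (∑ i, freePartial i (v (σ 0)) * FreeAlgebra.ι ℂ i)) ∈ eulerSpan n := by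
  have h1 : ∀ l b a : ZMod n, (fun v : Fin 3 → Cyc (Aff n) =>
      tr (freePartial (b + a - l) (v (σ 0)) * eulerLeft n (v (σ 1)) * FreeAlgebra.ι ℂ b *
        freePartial l (v (σ 2)) * FreeAlgebra.ι ℂ a)) ∈ eulerSpan n := by
    intro l b a
    -- The left Euler operator belongs to the second argument; a cyclic rotation of both the trace
    -- and the arguments brings it to the front.
    convert mem_eulerSpan n (.inl rfl) (σ * finRotate 3) 1 (FreeAlgebra.ι ℂ b)
      (FreeAlgebra.ι ℂ a) l (b + a - l) using 2 with v
    simp only [mul_assoc, one_mul, Equiv.Perm.mul_apply]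
    rw [tr_mul_comm]
    simp only [mul_assoc]
    rfl
  have h2 : ∀ j l v' : ZMod n, (fun v : Fin 3 → Cyc (Aff n) =>
      tr (eulerRight n (v (σ 0)) * freePartial j (v (σ 1)) * FreeAlgebra.ι ℂ (j - v') *
        freePartial l (v (σ 2)) * FreeAlgebra.ι ℂ (l + v'))) ∈ eulerSpan n := by
    intro j l v'
    convert mem_eulerSpan n (.inr rfl) σ (FreeAlgebra.ι ℂ (l + v')) 1
      (FreeAlgebra.ι ℂ (j - v')) j l using 2 with v
    rw [tr_mul_comm, mul_one]
    simp only [mul_assoc]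
  convert Submodule.sub_mem (eulerSpan n)
    (Submodule.sum_mem _ fun l (_ : l ∈ Finset.univ) => Submodule.sum_mem _ fun b
      (_ : b ∈ Finset.univ) => Submodule.sum_mem _ fun a (_ : a ∈ Finset.univ) =>
      Submodule.smul_mem _ (e (a - l) (b - l)) (h1 l b a))
    (Submodule.sum_mem _ fun j (_ : j ∈ Finset.univ) => Submodule.sum_mem _ fun l
      (_ : l ∈ Finset.univ) => Submodule.sum_mem _ fun v' (_ : v' ∈ Finset.univ) =>
      Submodule.smul_mem _ (d v' (j - v' - l)) (h2 j l v')) using 1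
  funext v
  simp only [Pi.sub_apply, Finset.sum_apply, Pi.smul_apply]
  rfl

theorem cycEuler_mem_eulerSpan (d e : ZMod n → ZMod n → ℂ) (σ : Equiv.Perm (Fin 3)) :
    (fun v : Fin 3 → Cyc (Aff n) => cycEuler d e (FreeAlgebra.ι ℂ) (fun i => freePartial i (v (σ 0)))
      (fun i => freePartial i (v (σ 1))) (fun i => freePartial i (v (σ 2)))) ∈ eulerSpan n :=
  Submodule.add_mem _ (Submodule.add_mem _ (eulerForm_mem_eulerSpan n d e σ)
    (eulerForm_mem_eulerSpan n d e (σ * finRotate 3)))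
    (eulerForm_mem_eulerSpan n d e (σ * finRotate 3 * finRotate 3))

variable {k : ℕ} {τ : ℂ}

theorem jacobiator_ellNu (hcop : Nat.Coprime k n) (hτ : 0 < τ.im) (f g h : Cyc (Aff n)) :
    jacobiator (ellNu n k τ) f g h =
      cycEuler (eulerD n k τ) (eulerE n k τ) (FreeAlgebra.ι ℂ) (fun i => freePartial i f)
        (fun i => freePartial i g) (fun i => freePartial i h) -
      cycEuler (eulerD n k τ) (eulerE n k τ) (FreeAlgebra.ι ℂ) (fun i => freePartial i g)
        (fun i => freePartial i f) (fun i => freePartial i h) := by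
  have hK := cycCoeff_ellCoeff n hcop hτ
  rw [ellNu, (isHamiltonian_free (ellCoeff_neg n hcop hτ)).jacobiator_eq, cycVar_eq_cycEuler _ hK,
    cycVar_eq_cycEuler _ hK]

theorem isNCBivector_ellNu (hcop : Nat.Coprime k n) (hτ : 0 < τ.im) :
    IsNCBivector (ellNu n k τ) :=
  (isHamiltonian_free (ellCoeff_neg n hcop hτ)).isNCBivector

theorem schouten_ellNu_mem (hcop : Nat.Coprime k n) (hτ : 0 < τ.im) :
    schouten (ellNu n k τ) (ellNu n k τ) ∈ eulerSpan n := by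
  convert Submodule.smul_mem _ (4 : ℂ) (Submodule.sub_mem _
    (cycEuler_mem_eulerSpan n (eulerD n k τ) (eulerE n k τ) 1)
    (cycEuler_mem_eulerSpan n (eulerD n k τ) (eulerE n k τ) (Equiv.swap 0 1))) using 1
  funext v
  rw [schouten_eq_jacobiator (isNCBivector_ellNu n hcop hτ).antisymm, jacobiator_ellNu n hcop hτ]
  rfl

end Schouten

/-! ### The abelianization -/

section Abelianization

open MvPolynomial

variable (n : ℕ) [NeZero n] {k : ℕ} {τ : ℂ}

/-- The abelianization homomorphism `A → ℂ[x_i]`. -/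
def abelHom : Aff n →ₐ[ℂ] MvPolynomial (ZMod n) ℂ := FreeAlgebra.lift ℂ X

@[simp] theorem abelHom_ι (i : ZMod n) : abelHom n (FreeAlgebra.ι ℂ i) = X i :=
  FreeAlgebra.lift_ι_apply _ _

theorem abel_tr (a : Aff n) : abel n (tr a) = abelHom n a := Cyc.lift_tr _ _ a

/-- In a commutative target $\sum bwa=w\sum ab$, so the polarized derivative becomes $w$ times the
ordinary partial derivative. -/
theorem abelHom_polar (i : ZMod n) (f w : Aff n) :
    abelHom n (polar (freeDD i) f w) = abelHom n w * pderiv i (abelHom n f) := by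
  induction f using FreeAlgebra.induction generalizing w with
  | grade0 r => rw [polar_algebraMap, AlgHom.commutes, algebraMap_eq, pderiv_C, map_zero, mul_zero]
  | grade1 j =>
    rw [polar, isCoordinates_free.apply_coord, abelHom_ι, pderiv_X, Pi.single_apply]
    split_ifs <;> simp
  | mul a b ha hb =>
    rw [polar_mul (isDoubleDer_freeDD i), map_add, ha, hb, map_mul, map_mul, map_mul,
      Derivation.leibniz, smul_eq_mul, smul_eq_mul]
    ring
  | add a b ha hb => rw [polar_add, map_add, ha, hb, map_add, map_add, mul_add]

theorem abelHom_freePartial (i : ZMod n) (f : Cyc (Aff n)) :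
    abelHom n (freePartial i f) = pderiv i (abel n f) := by
  obtain ⟨a, rfl⟩ := tr_surjective f
  rw [freePartial, cycDeriv_tr, abelHom_polar, map_one, one_mul, abel_tr]

theorem abel_surjective : Function.Surjective (abel n) := by
  intro f
  induction f using MvPolynomial.induction_on with
  | C a => exact ⟨tr (algebraMap ℂ _ a), by rw [abel_tr, AlgHom.commutes, algebraMap_eq]⟩
  | add f g hf hg =>
    obtain ⟨a, rfl⟩ := hf
    obtain ⟨b, rfl⟩ := hg
    exact ⟨a + b, map_add _ _ _⟩
  | mul_X f i hf =>
    obtain ⟨a, rfl⟩ := hf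
    obtain ⟨a, rfl⟩ := tr_surjective a
    exact ⟨tr (a * FreeAlgebra.ι ℂ i), by rw [abel_tr, abel_tr, map_mul, abelHom_ι]⟩

/-- The terms $r=0$ and $r=j-i$ of the sum are both multiples of $x_ix_j$ and make up the first
summand of the bracket. For $i=j$ the sum is zero by the substitution $r\mapsto-r$. -/
theorem qGen_eq (hcop : Nat.Coprime k n) (hτ : 0 < τ.im) (i j : ZMod n) :
    qGen n k τ i j = ∑ r, ellCoeff n k τ (j - i) r • (X (j - r) * X (i + r)) := by
  by_cases h : i = j
  · subst h
    rw [qGen, if_pos rfl]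
    have e : ∑ r, ellCoeff n k τ (i - i) r • (X (i - r) * X (i + r) : MvPolynomial (ZMod n) ℂ) =
        -∑ r, ellCoeff n k τ (i - i) r • (X (i - r) * X (i + r)) := by
      rw [← Finset.sum_neg_distrib]
      refine Fintype.sum_equiv (Equiv.neg _) _ _ fun r => ?_
      have := ellCoeff_neg n hcop hτ 0 r
      rw [neg_zero] at this
      rw [Equiv.neg_apply, sub_self, this, neg_smul, neg_neg, sub_neg_eq_add, ← sub_eq_add_neg,
        mul_comm]
    exact (self_eq_neg.1 e).symm
  · have hji : j - i ≠ 0 := sub_ne_zero.2 (Ne.symm h)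
    rw [qGen, if_neg h, ← Finset.add_sum_erase _ _ (Finset.mem_univ 0),
      ← Finset.add_sum_erase _ _ (Finset.mem_erase.2 ⟨hji, Finset.mem_univ (j - i)⟩), ← add_assoc]
    have hs : Finset.univ.filter (fun r : ZMod n => r ≠ 0 ∧ r ≠ j - i) =
        (Finset.univ.erase 0).erase (j - i) := by
      ext r
      simp [and_comm]
    rw [hs]
    congr 1
    · rw [ellCoeff, if_pos rfl, if_neg hji, ellCoeff, if_neg hji, if_pos rfl, sub_zero, add_zero,
        sub_sub_cancel, add_sub_cancel, add_smul, mul_comm (X j)]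
    · refine Finset.sum_congr rfl fun r hr => ?_
      rw [Finset.mem_erase, Finset.mem_erase] at hr
      rw [ellCoeff, if_neg hr.2.1, if_neg hr.1]

theorem qGen_swap (hcop : Nat.Coprime k n) (hτ : 0 < τ.im) (i j : ZMod n) :
    qGen n k τ i j = -∑ r, ellCoeff n k τ (i - j) r • (X (i - r) * X (j + r)) := by
  rw [qGen_eq n hcop hτ, ← Finset.sum_neg_distrib]
  refine Fintype.sum_equiv (Equiv.neg _) _ _ fun r => ?_
  have := ellCoeff_neg n hcop hτ (j - i) r
  rw [neg_sub] at this
  rw [Equiv.neg_apply, this, neg_smul, neg_neg, sub_neg_eq_add, ← sub_eq_add_neg, mul_comm]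

theorem qGen_antisymm (hcop : Nat.Coprime k n) (hτ : 0 < τ.im) (i j : ZMod n) :
    qGen n k τ i j = -qGen n k τ j i := by
  rw [qGen_swap n hcop hτ, qGen_eq n hcop hτ j i]

theorem qBracket_apply (f g : MvPolynomial (ZMod n) ℂ) :
    qBracket n k τ f g = ∑ i, ∑ j, qGen n k τ i j * pderiv i f * pderiv j g := rfl

theorem isAbelianization_ellNu (hcop : Nat.Coprime k n) (hτ : 0 < τ.im) :
    IsAbelianization n (ellNu n k τ) (-qBracket n k τ) := by
  intro f g
  rw [ellNu, quadBracket_eq, quadForm, LinearMap.neg_apply, LinearMap.neg_apply, qBracket_apply,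
    map_sum, ← Finset.sum_neg_distrib]
  refine Finset.sum_congr rfl fun i _ => ?_
  rw [map_sum, ← Finset.sum_neg_distrib]
  refine Finset.sum_congr rfl fun j _ => ?_
  rw [qGen_swap n hcop hτ, neg_mul, neg_mul, neg_neg, map_sum, Finset.sum_mul, Finset.sum_mul]
  refine Finset.sum_congr rfl fun r _ => ?_
  rw [map_smul, abel_tr, smul_mul_assoc, smul_mul_assoc]
  simp only [map_mul, abelHom_freePartial, abelHom_ι]
  exact congrArg _ (by ring)

/-! ### Reflection symmetries of the sums multiplying the Euler operators. -/

section Cancellation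

variable {P : Type*} [CommRing P] [Algebra ℂ P] {n}

/-- Exchanging $a$ and $b$ and reflecting $l\mapsto a+b-l$ negates both arguments of $e$ and swaps
the roles of $y$ and $t$. -/
theorem sum_left_symm {e : ZMod n → ZMod n → ℂ} (he : ∀ u t, e (-u) (-t) = e u t)
    (x y t : ZMod n → P) :
    ∑ l, ∑ b, ∑ a, e (a - l) (b - l) • (y (b + a - l) * x b * t l * x a) =
      ∑ l, ∑ b, ∑ a, e (a - l) (b - l) • (t (b + a - l) * x b * y l * x a) := by
  have h : ∀ y t : ZMod n → P,
      ∑ l, ∑ b, ∑ a, e (a - l) (b - l) • (y (b + a - l) * x b * t l * x a) =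
      ∑ b, ∑ a, ∑ l, e (a - l) (b - l) • (y (b + a - l) * x b * t l * x a) := fun y t => by
    rw [Finset.sum_comm]
    exact Finset.sum_congr rfl fun b _ => Finset.sum_comm
  rw [h, h, Finset.sum_comm]
  refine Finset.sum_congr rfl fun a _ => Finset.sum_congr rfl fun b _ => ?_
  refine Fintype.sum_equiv (Equiv.subLeft (b + a)) _ _ fun l => ?_
  rw [Equiv.subLeft_apply, ← he (a - l), show b - (b + a - l) = -(a - l) by ring,
    show a - (b + a - l) = -(b - l) by ring, show a + b - (b + a - l) = l by ring]
  congr 1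
  ring

/-- Exchange $j$ with $l$ and replace $v$ by $-v$. -/
theorem sum_right_symm {d : ZMod n → ZMod n → ℂ} (hd : ∀ u t, d (-u) (-t) = d u t)
    (x z t : ZMod n → P) :
    ∑ j, ∑ l, ∑ v, d v (j - v - l) • (z j * x (j - v) * t l * x (l + v)) =
      ∑ j, ∑ l, ∑ v, d v (j - v - l) • (t j * x (j - v) * z l * x (l + v)) := by
  rw [Finset.sum_comm]
  refine Finset.sum_congr rfl fun j _ => Finset.sum_congr rfl fun l _ => ?_
  refine Fintype.sum_equiv (Equiv.neg _) _ _ fun v => ?_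
  rw [Equiv.neg_apply, ← hd v, show -(l - v - j) = j - -v - l by ring, sub_neg_eq_add,
    ← sub_eq_add_neg]
  congr 1
  ring

end Cancellation

theorem abel_eulerForm (d e : ZMod n → ZMod n → ℂ) (f g h : Cyc (Aff n)) (L E : Aff n) :
    abel n (eulerForm d e (FreeAlgebra.ι ℂ) (fun i => freePartial i f) (fun i => freePartial i g)
      (fun i => freePartial i h) L E) =
    abelHom n L * ∑ l, ∑ b, ∑ a, e (a - l) (b - l) •
      (pderiv (b + a - l) (abel n f) * X b * pderiv l (abel n h) * X a) -
    abelHom n E * ∑ j, ∑ l, ∑ v, d v (j - v - l) •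
      (pderiv j (abel n g) * X (j - v) * pderiv l (abel n h) * X (l + v)) := by
  simp only [eulerForm, map_sub, map_sum, map_smul, abel_tr, map_mul, abelHom_freePartial,
    abelHom_ι, Finset.mul_sum, mul_smul_comm]
  refine congrArg₂ _ ?_ ?_
  · refine Finset.sum_congr rfl fun l _ => Finset.sum_congr rfl fun b _ =>
      Finset.sum_congr rfl fun a _ => congrArg _ ?_
    ring
  · simp only [mul_assoc]

/-- After abelianization each Euler operator factors out of a sum that is symmetric in the other two
functions, while the Jacobi sum is a difference under exchanging $f$ and $g$; so the terms cancel in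
pairs, although the Euler operators are not zero. -/
theorem abel_jacobiator (hcop : Nat.Coprime k n) (hτ : 0 < τ.im) (f g h : Cyc (Aff n)) :
    abel n (jacobiator (ellNu n k τ) f g h) = 0 := by
  have hr : ∀ f : Cyc (Aff n), abelHom n (∑ i, freePartial i f * FreeAlgebra.ι ℂ i) =
      abelHom n (∑ i, FreeAlgebra.ι ℂ i * freePartial i f) := fun f => by
    simp only [map_sum, map_mul, mul_comm]
  have hW := fun f h : Cyc (Aff n) => sum_left_symm (eulerE_neg n (k := k) hτ)
    (X : ZMod n → MvPolynomial (ZMod n) ℂ) (fun i => pderiv i (abel n f))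
    (fun i => pderiv i (abel n h))
  have hV := fun f h : Cyc (Aff n) => sum_right_symm (eulerD_neg n (k := k) hτ)
    (X : ZMod n → MvPolynomial (ZMod n) ℂ) (fun i => pderiv i (abel n f))
    (fun i => pderiv i (abel n h))
  rw [jacobiator_ellNu n hcop hτ]
  simp only [cycEuler, map_sub, map_add, abel_eulerForm, hr]
  rw [hW f h, hW g f, hW h g, hV g h, hV h f, hV f g]
  ring

theorem isPoissonBracket_qBracket (hcop : Nat.Coprime k n) (hτ : 0 < τ.im) :
    IsPoissonBracket (qBracket n k τ) := by
  refine ⟨fun f g => ?_, fun f g h => ?_, fun f g h => ?_⟩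
  · rw [qBracket_apply, qBracket_apply, Finset.sum_comm, ← Finset.sum_neg_distrib]
    refine Finset.sum_congr rfl fun j _ => ?_
    rw [← Finset.sum_neg_distrib]
    refine Finset.sum_congr rfl fun i _ => ?_
    rw [qGen_antisymm n hcop hτ]
    ring
  · simp only [qBracket_apply, Derivation.leibniz, smul_eq_mul, Finset.mul_sum]
    rw [← Finset.sum_add_distrib]
    refine Finset.sum_congr rfl fun i _ => ?_
    rw [← Finset.sum_add_distrib]
    refine Finset.sum_congr rfl fun j _ => ?_
    ring
  -- Every polynomial is an abelianization, so the Jacobi identity is the image of the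
  -- noncommutative Jacobi sum; the sign of the bracket enters it twice.
  · obtain ⟨f, rfl⟩ := abel_surjective n f
    obtain ⟨g, rfl⟩ := abel_surjective n g
    obtain ⟨h, rfl⟩ := abel_surjective n h
    have hA := isAbelianization_ellNu n hcop hτ
    have := abel_jacobiator n hcop hτ f g h
    simpa only [jacobiator, map_add, hA _ _, LinearMap.neg_apply, map_neg, neg_neg] using this

theorem relabel_X (i : ZMod n) : relabel n (X i) = X (-i) := by
  simp [relabel]

theorem relabel_qGen (hcop : Nat.Coprime k n) (hτ : 0 < τ.im) (i j : ZMod n) :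
    relabel n (qGen n k τ i j) = -qGen n k τ (-i) (-j) := by
  rw [qGen_eq n hcop hτ, qGen_swap n hcop hτ, neg_neg, map_sum]
  refine Finset.sum_congr rfl fun r _ => ?_
  rw [map_smul, map_mul, relabel_X, relabel_X, mul_comm, show -i - -j = j - i by ring,
    show -(i + r) = -i - r by ring, show -(j - r) = -j + r by ring]

theorem relabel_pderiv (i : ZMod n) (f : MvPolynomial (ZMod n) ℂ) :
    relabel n (pderiv i f) = pderiv (-i) (relabel n f) :=
  (pderiv_rename neg_injective i f).symm

theorem relabel_qBracket (hcop : Nat.Coprime k n) (hτ : 0 < τ.im)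
    (f g : MvPolynomial (ZMod n) ℂ) :
    relabel n ((-qBracket n k τ) f g) = qBracket n k τ (relabel n f) (relabel n g) := by
  rw [LinearMap.neg_apply, LinearMap.neg_apply, qBracket_apply, qBracket_apply, map_neg, map_sum,
    ← Finset.sum_neg_distrib]
  refine Fintype.sum_equiv (Equiv.neg _) _ _ fun i => ?_
  rw [map_sum, ← Finset.sum_neg_distrib]
  refine Fintype.sum_equiv (Equiv.neg _) _ _ fun j => ?_
  rw [map_mul, map_mul, relabel_qGen n hcop hτ, relabel_pderiv, relabel_pderiv]
  simp only [Equiv.neg_apply]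
  ring

end Abelianization

end NCPoisson

end

theorem mainTheorem1 (n k : ℕ) [NeZero n] (hk : 1 ≤ k) (hkn : k < n) (hcop : Nat.Coprime k n)
    (τ : ℂ) (hτ : 0 < τ.im) :
    -- `ν` is a homogeneous nonabelian bivector field
    IsNCBivector (ellNu n k τ) ∧
    (∀ f g : Aff n,
      ellNuA n k τ (tr (dilate n (inclA n f))) (tr (dilate n (inclA n g))) =
        Cyc.map (dilate n) (Cyc.map (inclA n) (ellNu n k τ (tr f) (tr g)))) ∧
    -- its Schouten square vanishes modulo the Euler-type identities
    schouten (ellNu n k τ) (ellNu n k τ) ∈ eulerSpan n ∧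
    -- it induces a nonabelian Poisson structure on the noncommutative projective space
    (∃ b : ∀ j, Cyc (Chart n j) →ₗ[ℂ] Cyc (Chart n j) →ₗ[ℂ] Cyc (Chart n j),
      IsProjPoisson n b ∧
      ∀ j f g, Cyc.map (chartEmb n j) (b j f g) =
        ellNuLaurent n k τ (Cyc.map (chartEmb n j) f) (Cyc.map (chartEmb n j) g)) ∧
    -- its abelianization is `q_{n,k}(τ)` with the sign of the bracket reversed, which
    -- the relabelling `x_i ↦ x_{-i}` identifies with `q_{n,k}(τ)`
    IsPoissonBracket (qBracket n k τ) ∧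
    IsAbelianization n (ellNu n k τ) (-qBracket n k τ) ∧
    (∀ f g, relabel n ((-qBracket n k τ) f g) =
      qBracket n k τ (relabel n f) (relabel n g)) := by
  exact ⟨isNCBivector_ellNu n hcop hτ, ellNu_homogeneous n k τ, schouten_ellNu_mem n hcop hτ,
    ⟨chartBracket n k τ, isProjPoisson_chartBracket n k hcop hτ, chartBracket_chartEmb n k τ⟩,
    isPoissonBracket_qBracket n hcop hτ, isAbelianization_ellNu n hcop hτ,
    relabel_qBracket n hcop hτ⟩
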